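/- Let $p>2$ be a prime. Denote by $\mathbb{Q}_p\langle\langle x,y\rangle\rangle$ the algebra of noncommutative formal power series in two letters, with the coproduct for which $x$ and $y$ are primitive. Let $\mathfrak{t}_4$ be the Lie algebra over $\mathbb{Q}_p$ with generators $t_{i,j}=t_{j,i}$ ($1\le i\ne j\le 4$) and relations $[t_{i,j},t_{i,k}+t_{j,k}]=0$ for distinct $i,j,k$ and $[t_{i,j},t_{k,l}]=0$ for distinct $i,j,k,l$. Let $\Phi\in \mathrm{Assoc}_1(\mathbb{Q}_p)$ be a Drinfeld associator, that is, a group-like element of $\mathbb{Q}_p\langle\langle x,y\rangle\rangle$ such that $\Phi(x,y)=\Phi(y,x)^{-1}$, $$e^{x/2}\,\Phi(z,x)\,e^{z/2}\,\Phi(y,z)\,e^{y/2}\,\Phi(x,y)=1\quad\text{for } x+y+z=0,$$ and, in the degree completion of the universal enveloping algebra of $\mathfrak{t}_4$, $$\Phi(t_{1,2},t_{2,3}+t_{2,4})\,\Phi(t_{1,3}+t_{2,3},t_{3,4})=\Phi(t_{2,3},t_{3,4})\,\Phi(t_{1,2}+t_{1,3},t_{2,4}+t_{3,4})\,\Phi(t_{1,2},t_{2,3}).$$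 Suppose that $$\Phi\in 1+\mathbb{Z}_p\langle\langle x,y\rangle\rangle^{\ge 1}+p^{-1}\,\mathbb{Z}_p\langle x,y\rangle^{p-1}+\mathbb{Q}_p\langle\langle x,y\rangle\rangle^{\ge p},$$ where the exponents denote degrees. Let $\psi\in\mathbb{Q}_p\langle\langle x,y\rangle\rangle$ be the series given by $$\Phi(x,y)^{-1}\,\frac{d}{d\lambda}\Phi(\lambda x,\lambda y)\Big|_{\lambda=1}=\psi\bigl(x,\ \Phi(x,y)^{-1}\,y\,\Phi(x,y)\bigr).$$ Then the part of degree $p-1$ of $p\,\psi$ has coefficients in $\mathbb{Z}_p$. Let $\sigma_p\in\mathbb{F}_p\langle x,y\rangle$ be its reduction modulo $p$, and put $a(x,y)=\sigma_p(-x-y,x)$ and $b(x,y)=\sigma_p(-x-y,y)$. For $c\in\mathbb{F}_p\langle x,y\rangle$ let $c=c_0+(\partial_x c)\,x+(\partial_y c)\,y$ with $c_0\in\mathbb{F}_p$ be the unique decomposition of this form, and let $\mathrm{tr}$ be the canonical projection of $\mathbb{F}_p\langle x,y\rangle$ onto its quotient $\mathfrak{tr}_2(\mathbb{F}_p)$ by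 the linear span of all commutators $uv-vu$ (the space of cyclic words). Then $$\mathrm{tr}\bigl(x\,(\partial_x a)+y\,(\partial_y b)\bigr)=\tfrac12\,\mathrm{tr}\bigl((x+y)^{p-1}-x^{p-1}-y^{p-1}\bigr)\quad\text{in }\mathfrak{tr}_2(\mathbb{F}_p).$$ -/

import Mathlib

open scoped TensorProduct PowerSeries

noncomputable section

namespace KashiwaraVergne

/-! ### Noncommutative formal power series in two letters -/

/-- The letters are `0 : Fin 2` (for `x`) and `1 : Fin 2` (for `y`). An element of `K⟨⟨x, y⟩⟩` is
given by its family of coefficients, indexed by all words in the two letters. -/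
abbrev NCSeries (K : Type*) := List (Fin 2) → K

section Completion

variable {K : Type*} [Field K] {U : Type*} [Ring U] [Algebra K U]

/-- The degree completion `∏ₙ Uₙ` of a graded algebra `U = ⨁ₙ Uₙ` is the subalgebra of `U⟦ℏ⟧` of the
series `∑ₙ uₙ ℏⁿ` with `uₙ ∈ Uₙ`. All identities in degree completed algebras are written in `U⟦ℏ⟧`
through this embedding; an element `a` of degree one is the series `a ℏ`. -/
def degOne (a : U) : U⟦X⟧ := PowerSeries.monomial 1 a

/-- The value `f(A, B) = ∑ f_w w(A, B)` of a noncommutative series at two elements without constant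
term: a word of length `k > n` does not contribute to the coefficient of `ℏⁿ`, so that the sum is
finite in every degree. -/
def NCSeries.eval (f : NCSeries K) (A B : U⟦X⟧) : U⟦X⟧ :=
  PowerSeries.mk fun n => ∑ k ∈ Finset.range (n + 1), ∑ w : Fin k → Fin 2,
    f (List.ofFn w) • PowerSeries.coeff n ((List.ofFn w).map ![A, B]).prod

variable (K) in
/-- The exponential `∑ Aᵏ / k!` of an element without constant term (`K` of characteristic zero). -/
def expSeries (A : U⟦X⟧) : U⟦X⟧ :=
  PowerSeries.mk fun n => ∑ k ∈ Finset.range (n + 1),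
    ((k.factorial : K)⁻¹) • PowerSeries.coeff n (A ^ k)

end Completion

/-! ### The Lie algebra of infinitesimal braids on four strands -/

/-- Unordered pairs of distinct strands: the index set of the generators `t_{i,j} = t_{j,i}`. -/
abbrev StrandPair := {e : Sym2 (Fin 4) // ¬ e.IsDiag}

/-- The pair `{i, j}`. -/
def pair (i j : Fin 4) (h : i ≠ j) : StrandPair := ⟨s(i, j), by simpa using h⟩

section Braids

variable (K : Type*) [Field K]

/-- The generator `t_{i,j}` in the free Lie algebra. -/
def freeT (i j : Fin 4) (h : i ≠ j) : FreeLieAlgebra K StrandPair :=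
  FreeLieAlgebra.of K (pair i j h)

/-- The relators of `𝔱₄`: `[t_{i,j}, t_{i,k} + t_{j,k}]` for distinct `i, j, k`, and
`[t_{i,j}, t_{k,l}]` for distinct `i, j, k, l`. -/
inductive IsBraidRelator : FreeLieAlgebra K StrandPair → Prop
  | three (i j k : Fin 4) (hij : i ≠ j) (hik : i ≠ k) (hjk : j ≠ k) :
      IsBraidRelator ⁅freeT K i j hij, freeT K i k hik + freeT K j k hjk⁆
  | four (i j k l : Fin 4) (hij : i ≠ j) (hkl : k ≠ l)
      (_hik : i ≠ k) (_hil : i ≠ l) (_hjk : j ≠ k) (_hjl : j ≠ l) :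
      IsBraidRelator ⁅freeT K i j hij, freeT K k l hkl⁆

/-- The Lie algebra `𝔱₄` of infinitesimal braids (before degree completion). -/
abbrev T4 := FreeLieAlgebra K StrandPair ⧸
  (LieSubmodule.lieSpan K (FreeLieAlgebra K StrandPair) {r | IsBraidRelator K r} :
    LieIdeal K (FreeLieAlgebra K StrandPair))

/-- The universal enveloping algebra of `𝔱₄`; the group `exp(𝔱₄)` is a subgroup of the group of units
of its degree completion. -/
abbrev UT4 := UniversalEnvelopingAlgebra K (T4 K)

/-- The generator `t_{i,j}` as an element of degree one in the completion of `U(𝔱₄)`. -/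
def t (i j : Fin 4) (h : i ≠ j := by decide) : (UT4 K)⟦X⟧ :=
  degOne (UniversalEnvelopingAlgebra.ι K (LieSubmodule.Quotient.mk (freeT K i j h) : T4 K))

end Braids

/-! ### Drinfeld associators -/

section Associators

variable {K : Type*} [Field K]

variable (K) in
/-- The letter `x` in (the degree completion of) `K⟨x, y⟩`. -/
def xhat : (FreeAlgebra K (Fin 2))⟦X⟧ := degOne (FreeAlgebra.ι K 0)

variable (K) in
/-- The letter `y` in (the degree completion of) `K⟨x, y⟩`. -/
def yhat : (FreeAlgebra K (Fin 2))⟦X⟧ := degOne (FreeAlgebra.ι K 1)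

/-- Group-like series: constant term `1` and `Δ Φ = (Φ ⊗ 1)(1 ⊗ Φ)`, where `Δ` is the continuous
algebra morphism with `Δ x = x ⊗ 1 + 1 ⊗ x` and `Δ y = y ⊗ 1 + 1 ⊗ y`. -/
def IsGroupLike (Φ : NCSeries K) : Prop :=
  let A := FreeAlgebra K (Fin 2)
  let l : Fin 2 → (A ⊗[K] A)⟦X⟧ := fun i => degOne (FreeAlgebra.ι K i ⊗ₜ 1)
  let r : Fin 2 → (A ⊗[K] A)⟦X⟧ := fun i => degOne (1 ⊗ₜ FreeAlgebra.ι K i)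
  Φ [] = 1 ∧ Φ.eval (l 0 + r 0) (l 1 + r 1) = Φ.eval (l 0) (l 1) * Φ.eval (r 0) (r 1)

/-- `Φ ∈ Assoc_μ(K)`: Drinfeld associators with parameter `μ` (`K` of characteristic zero). -/
structure IsAssociator (μ : K) (Φ : NCSeries K) : Prop where
  groupLike : IsGroupLike Φ
  /-- `Φ(x, y) = Φ(y, x)⁻¹` -/
  inversion : Φ.eval (xhat K) (yhat K) = Ring.inverse (Φ.eval (yhat K) (xhat K))
  /-- `e^{μx/2} Φ(z, x) e^{μz/2} Φ(y, z) e^{μy/2} Φ(x, y) = 1` for `z = -x-y` -/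
  hexagon : ∀ z, xhat K + yhat K + z = 0 →
    expSeries K ((μ / 2) • xhat K) * Φ.eval z (xhat K) *
      expSeries K ((μ / 2) • z) * Φ.eval (yhat K) z *
      expSeries K ((μ / 2) • yhat K) * Φ.eval (xhat K) (yhat K) = 1
  /-- the pentagon equation; strands `1, 2, 3, 4` are numbered `0, 1, 2, 3` -/
  pentagon :
    Φ.eval (t K 0 1) (t K 1 2 + t K 1 3) * Φ.eval (t K 0 2 + t K 1 2) (t K 2 3) =
      Φ.eval (t K 1 2) (t K 2 3) * Φ.eval (t K 0 1 + t K 0 2) (t K 1 3 + t K 2 3) *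
        Φ.eval (t K 0 1) (t K 1 2)

/-- The series `d/dλ Φ(λx, λy)` at `λ = 1`: the coefficient of a word `w` in `Φ(λx, λy)` is
`λ ^ |w| Φ_w`. -/
def scalingDeriv (Φ : NCSeries K) : NCSeries K := fun w => (w.length : K) * Φ w

/-- The relation `Φ⁻¹ · d/dλ Φ(λx, λy)|_{λ = 1} = ψ(x, Φ⁻¹ y Φ)` between `Φ` and `ψ`. -/
def IsGenerator (Φ ψ : NCSeries K) : Prop :=
  let P := Φ.eval (xhat K) (yhat K)
  Ring.inverse P * (scalingDeriv Φ).eval (xhat K) (yhat K) =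
    ψ.eval (xhat K) (Ring.inverse P * yhat K * P)

end Associators

/-! ### Reduction modulo `p` -/

section Reduction

variable (p : ℕ) [Fact p.Prime]

/-- `Φ ∈ 1 + ℤ_p⟨⟨x, y⟩⟩^{≥ 1} + p⁻¹ ℤ_p⟨x, y⟩^{p-1} + ℚ_p⟨⟨x, y⟩⟩^{≥ p}`. -/
structure HasSimplePoleBound (Φ : NCSeries ℚ_[p]) : Prop where
  const : Φ [] = 1
  integral : ∀ w : List (Fin 2), 1 ≤ w.length → w.length < p - 1 → ‖Φ w‖ ≤ 1
  pole : ∀ w : List (Fin 2), w.length = p - 1 → ‖(p : ℚ_[p]) * Φ w‖ ≤ 1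

/-- Reduction of a `p`-adic integer modulo `p` (only used on `p`-adic integers; `0` elsewhere). -/
def residue (q : ℚ_[p]) : ZMod p :=
  if h : ‖q‖ ≤ 1 then PadicInt.toZMod (⟨q, h⟩ : ℤ_[p]) else 0

/-- The reduction modulo `p` of the part of degree `p - 1` of `p ψ`, an element of `𝔽_p⟨x, y⟩`. -/
def sigma (ψ : NCSeries ℚ_[p]) : FreeAlgebra (ZMod p) (Fin 2) :=
  ∑ w : Fin (p - 1) → Fin 2,
    residue p ((p : ℚ_[p]) * ψ (List.ofFn w)) •
      ((List.ofFn w).map (FreeAlgebra.ι (ZMod p))).prod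

end Reduction

/-! ### Noncommutative polynomials: substitution, `∂_x`, `∂_y` and the trace -/

section Polynomials

variable {k : Type*} [CommRing k]

/-- The substitution `s(u, v)` for a noncommutative polynomial `s(x, y)`. -/
def subst (s u v : FreeAlgebra k (Fin 2)) : FreeAlgebra k (Fin 2) :=
  FreeAlgebra.lift k ![u, v] s

/-- The algebra morphism with `x_j ↦ [[x_j, δ_{ij}], [0, 0]]`; it maps `a` to
`[[a, ∂_i a], [0, a₀]]`, where `a₀` is the constant term of `a`. -/
def pdAux (i : Fin 2) :
    FreeAlgebra k (Fin 2) →ₐ[k] Matrix (Fin 2) (Fin 2) (FreeAlgebra k (Fin 2)) :=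
  FreeAlgebra.lift k fun j => !![FreeAlgebra.ι k j, if i = j then 1 else 0; 0, 0]

/-- The operators `∂_x = pd 0` and `∂_y = pd 1`: by `eq_const_add_pd` and `pd_eq_of_eq` below,
`a = a₀ + (∂_x a) x + (∂_y a) y` is the unique decomposition of `a` of this form. -/
def pd (i : Fin 2) (a : FreeAlgebra k (Fin 2)) : FreeAlgebra k (Fin 2) := pdAux i a 0 1

theorem pdAux_entries (i : Fin 2) (a : FreeAlgebra k (Fin 2)) :
    pdAux i a 0 0 = a ∧ pdAux i a 1 0 = 0 ∧
      pdAux i a 1 1 = algebraMap k _ (FreeAlgebra.algebraMapInv a) := by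
  induction a using FreeAlgebra.induction with
  | grade0 r => simp [Matrix.algebraMap_matrix_apply]
  | grade1 j => simp [pdAux, FreeAlgebra.algebraMapInv]
  | mul a b ha hb =>
    obtain ⟨h1, h2, h3⟩ := ha
    obtain ⟨g1, g2, g3⟩ := hb
    simp [Matrix.mul_apply, h1, h2, h3, g1, g2, g3]
  | add a b ha hb =>
    obtain ⟨h1, h2, h3⟩ := ha
    obtain ⟨g1, g2, g3⟩ := hb
    simp [h1, h2, h3, g1, g2, g3]

theorem pd_mul (i : Fin 2) (a b : FreeAlgebra k (Fin 2)) :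
    pd i (a * b) = a * pd i b + pd i a * algebraMap k _ (FreeAlgebra.algebraMapInv b) := by
  simp [pd, Matrix.mul_apply, (pdAux_entries i a).1, (pdAux_entries i b).2.2]

theorem pd_add (i : Fin 2) (a b : FreeAlgebra k (Fin 2)) : pd i (a + b) = pd i a + pd i b := by
  simp [pd]

theorem pd_algebraMap (i : Fin 2) (r : k) :
    pd i (algebraMap k (FreeAlgebra k (Fin 2)) r) = 0 := by
  simp [pd, Matrix.algebraMap_matrix_apply]

theorem pd_ι (i j : Fin 2) : pd i (FreeAlgebra.ι k j) = if i = j then 1 else 0 := by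
  simp [pd, pdAux]

theorem eq_const_add_pd (a : FreeAlgebra k (Fin 2)) :
    a = algebraMap k _ (FreeAlgebra.algebraMapInv a) +
      pd 0 a * FreeAlgebra.ι k 0 + pd 1 a * FreeAlgebra.ι k 1 := by
  induction a using FreeAlgebra.induction with
  | grade0 r => simp [pd_algebraMap]
  | grade1 j => fin_cases j <;> simp [pd_ι, FreeAlgebra.algebraMapInv]
  | mul a b ha hb =>
    have hx := Algebra.commutes (FreeAlgebra.algebraMapInv b) (FreeAlgebra.ι k (0 : Fin 2))
    have hy := Algebra.commutes (FreeAlgebra.algebraMapInv b) (FreeAlgebra.ι k (1 : Fin 2))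
    simp only [pd_mul, map_mul]
    generalize algebraMap k (FreeAlgebra k (Fin 2)) (FreeAlgebra.algebraMapInv b) = β at *
    generalize algebraMap k (FreeAlgebra k (Fin 2)) (FreeAlgebra.algebraMapInv a) = α at *
    have hβ : a * β = α * β + pd 0 a * β * FreeAlgebra.ι k 0 + pd 1 a * β * FreeAlgebra.ι k 1 := by
      conv_lhs => rw [ha]
      simp only [add_mul, mul_assoc, hx, hy]
    calc a * b = a * β + a * (pd 0 b * FreeAlgebra.ι k 0 + pd 1 b * FreeAlgebra.ι k 1) := by
          conv_lhs => rw [hb]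
          simp only [mul_add, add_assoc]
      _ = _ := by
          rw [hβ]
          simp only [mul_add, add_mul, mul_assoc]
          abel
  | add a b ha hb =>
    simp only [pd_add, map_add, add_mul]
    conv_lhs => rw [ha, hb]
    abel

theorem pd_eq_of_eq (a a₁ a₂ : FreeAlgebra k (Fin 2)) (a₀ : k)
    (h : a = algebraMap k _ a₀ + a₁ * FreeAlgebra.ι k 0 + a₂ * FreeAlgebra.ι k 1) :
    a₁ = pd 0 a ∧ a₂ = pd 1 a := by
  subst h
  constructor <;> simp [pd_add, pd_mul, pd_algebraMap, pd_ι, FreeAlgebra.algebraMapInv]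

variable (k) in
/-- The subspace of `k⟨x, y⟩` spanned by the commutators `uv - vu`. -/
def commutators : Submodule k (FreeAlgebra k (Fin 2)) :=
  Submodule.span k {c | ∃ u v, c = u * v - v * u}

variable (k) in
/-- The space of cyclic words `𝔱𝔯₂(k)`. -/
abbrev CyclicWords := FreeAlgebra k (Fin 2) ⧸ commutators k

/-- The canonical projection `tr : k⟨x, y⟩ → 𝔱𝔯₂(k)`. -/
def tr : FreeAlgebra k (Fin 2) →ₗ[k] CyclicWords k := (commutators k).mkQ

end Polynomials

end KashiwaraVergne

end

/-! Let φ be the reduction modulo `p` of the part of degree `p - 1` of `pΦ` (`leading`). Below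
degree `p - 1` the series Φ is integral with constant term 1. For such series the degree `p - 1`
part, multiplied by `p` and reduced, is additive under products (`HasTop.mul`), so every
multiplicative equation for Φ becomes a linear equation for φ: φ is antisymmetric, satisfies the
hexagon without exponentials (these are integral through degree `p - 1`) and the additive pentagon.
Group-likeness becomes φ = -D(φ) with the Dynkin operator D (`topResidue_dynkin`), so φ is a
combination of brackets of length `p - 1` ≥ 2. Thus φ behaves like an element of the graded
Grothendieck–Teichmüller Lie algebra over 𝔽_p. The equation for ψ gives ψ ≡ (`p` - 1)Φ in degree `p
- 1` up to integral terms, whence σ_p = -φ (`IsGenerator.sigma_eq`).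

The trace identity then follows an argument in the style of Alekseev and Torossian. The relations of
𝔱₄ are realised on the free algebra in three letters: one strand gives left multiplications, the
other three give derivations D_{ij} (`braidOp`). Three placements of the special strand in the
pentagon show that the derivation φ(D₀₁, D₁₂) is tangential, X_i ↦ [v_i, X_i], where the v_i are the
components of the simplicial coboundary of the pair A = φ(-x-y, x), B = φ(-x-y, y)
(`leading_der_apply_zero`, `leading_der_apply_one`, `leading_der_apply_two`). The divergence is a
1-cocycle modulo commutators and is linear on the D_{ij}, so it vanishes on their brackets. Hence G
= x ∂_x A + y ∂_y B satisfies, in cyclic words, G(X₀+X₁, X₂) + G(X₀, X₁) - G(X₀, X₁+X₂) - G(X₁, X₂)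
= 0 (`divPart_cocycle`).

In degree `p - 1` this equation forces G ≡ -β((x+y)^{p-1} - x^{p-1} - y^{p-1}): linearising in the
first variable determines the image of G under the derivation counting the letters x, and by Fermat
a power of that derivation recovers G (`cocycle_solution`). The scalar β is the coefficient of
x^{p-2}y in φ (`dualHom_divPart`). Two hexagons evaluated in triangular 2 × 2 matrices identify the
even part of the generating series of the coefficients of x^{n-1}y in Φ with (ħ/2) coth(ħ/2) - 1, up
to a factor 2 (`IsAssociator.linear_part`). Its coefficient of degree `p - 1`, multiplied by `p`,
gives 2β = 1 by Fermat and Wilson (`two_mul_leading`). -/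

noncomputable section

namespace KashiwaraVergne

/-! ### Homogeneous parts of series and their values -/

section HomPart

variable {R : Type*} [CommRing R] {S : Type*} [Ring S] [Algebra R S]

/-- The value at `(u, v)` of the part of degree `n` of a noncommutative series. -/
def homPart (f : NCSeries R) (n : ℕ) (u v : S) : S :=
  ∑ w : Fin n → Fin 2, f (List.ofFn w) • ((List.ofFn w).map ![u, v]).prod

theorem map_vec {α β : Type*} (g : α → β) (u v : α) : g ∘ ![u, v] = ![g u, g v] := by
  ext i; fin_cases i <;> rfl

theorem map_homPart {S' : Type*} [Ring S'] [Algebra R S'] (g : S →ₐ[R] S') (f : NCSeries R) (n : ℕ) (u v : S) :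
    g (homPart f n u v) = homPart f n (g u) (g v) := by
  simp only [homPart, map_sum, map_smul, map_list_prod, List.map_map, map_vec]

theorem homPart_congr {f f' : NCSeries R} {n : ℕ} (h : ∀ w, w.length = n → f w = f' w) (u v : S) :
    homPart f n u v = homPart f' n u v :=
  Finset.sum_congr rfl fun w _ => by rw [h _ (List.length_ofFn)]

theorem homPart_neg_coeff (f : NCSeries R) (n : ℕ) (u v : S) :
    homPart (-f) n u v = -homPart f n u v := by
  simp [homPart]

theorem homPart_smul_coeff (c : R) (f : NCSeries R) (n : ℕ) (u v : S) :
    homPart (c • f) n u v = c • homPart f n u v := by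
  simp [homPart, Finset.smul_sum, mul_smul]

theorem homPart_zero_degree (f : NCSeries R) (u v : S) : homPart f 0 u v = f [] • 1 := by
  simp [homPart]

/-- Homogeneous parts are compatible with change of scalars. -/
theorem homPart_semilinear {R' S' : Type*} [CommRing R'] [Ring S'] [Algebra R' S'] (c : R → R')
    (g : S →+* S')
    (hg : ∀ r s, g (r • s) = c r • g s) (f : NCSeries R) (f' : NCSeries R') (n : ℕ)
    (hf : ∀ w, w.length = n → f' w = c (f w)) (u v : S) :
    g (homPart f n u v) = homPart f' n (g u) (g v) := by
  simp only [homPart, map_sum, hg, map_list_prod, List.map_map, map_vec]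
  exact Finset.sum_congr rfl fun w _ => by rw [hf _ List.length_ofFn]

theorem homPart_smul_smul (f : NCSeries R) (n : ℕ) (c : R) (u v : S) :
    homPart f n (c • u) (c • v) = c ^ n • homPart f n u v := by
  simp only [homPart, Finset.smul_sum]
  refine Finset.sum_congr rfl fun w _ => ?_
  rw [smul_comm]
  congr 1
  have (l : List (Fin 2)) : (l.map ![c • u, c • v]).prod = c ^ l.length • (l.map ![u, v]).prod := by
    induction l with
    | nil => simp
    | cons i l ih =>
      have hi : ![c • u, c • v] i = c • ![u, v] i := by fin_cases i <;> rfl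
      simp [ih, hi, pow_succ, mul_smul]
  simpa using this (List.ofFn w)

end HomPart

section Series

variable {K : Type*} [Field K] {U V : Type*} [Ring U] [Algebra K U] [Ring V] [Algebra K V]

theorem degOne_add (a b : U) : degOne (a + b) = degOne a + degOne b := map_add _ _ _

theorem degOne_neg (a : U) : degOne (-a) = -degOne a := map_neg _ _

theorem degOne_smul (c : K) (a : U) : degOne (c • a) = c • degOne a := by
  ext n
  simp only [degOne, PowerSeries.coeff_monomial, PowerSeries.coeff_smul]
  split_ifs <;> simp

theorem prod_map_degOne (l : List U) :
    (l.map degOne).prod = PowerSeries.monomial l.length l.prod := by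
  induction l with
  | nil => simp
  | cons a l ih =>
    rw [List.map_cons, List.prod_cons, ih, degOne, PowerSeries.monomial_mul_monomial]
    simp [add_comm]

theorem coeff_eval_degOne (f : NCSeries K) (a b : U) (n : ℕ) :
    PowerSeries.coeff n (f.eval (degOne a) (degOne b)) = homPart f n a b := by
  have h (k : ℕ) (w : Fin k → Fin 2) : PowerSeries.coeff n
      ((List.ofFn w).map ![degOne a, degOne b]).prod =
        if n = k then ((List.ofFn w).map ![a, b]).prod else 0 := by
    rw [← map_vec degOne, ← List.map_map, prod_map_degOne, PowerSeries.coeff_monomial]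
    simp
  rw [NCSeries.eval, PowerSeries.coeff_mk, Finset.sum_eq_single n]
  · simp only [h, homPart, if_true]
  · intro k _ hk
    simp only [h, hk.symm, if_false, smul_zero, Finset.sum_const_zero]
  · simp

theorem coeff_expSeries_degOne (a : U) (n : ℕ) :
    PowerSeries.coeff n (expSeries K (degOne a)) = ((n.factorial : K)⁻¹) • a ^ n := by
  have h (k : ℕ) : PowerSeries.coeff n (degOne a ^ k) = if n = k then a ^ k else 0 := by
    have := prod_map_degOne (List.replicate k a)
    simp only [List.map_replicate, List.prod_replicate, List.length_replicate] at this
    rw [this, PowerSeries.coeff_monomial]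
  rw [expSeries, PowerSeries.coeff_mk, Finset.sum_eq_single n]
  · simp [h]
  · intro k _ hk
    simp [h, hk.symm]
  · simp

theorem map_eval_degOne (g : U →ₐ[K] V) (f : NCSeries K) (a b : U) :
    PowerSeries.map (g : U →+* V) (f.eval (degOne a) (degOne b)) =
      f.eval (degOne (g a)) (degOne (g b)) := by
  ext n
  rw [PowerSeries.coeff_map, coeff_eval_degOne, coeff_eval_degOne, ← map_homPart]
  rfl

theorem map_expSeries_degOne (g : U →ₐ[K] V) (a : U) :
    PowerSeries.map (g : U →+* V) (expSeries K (degOne a)) = expSeries K (degOne (g a)) := by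
  ext n
  rw [PowerSeries.coeff_map, coeff_expSeries_degOne, coeff_expSeries_degOne]
  simp

end Series

/-! ### Families satisfying the infinitesimal braid relations -/

/-- The infinitesimal braid relations for a family of elements of an associative ring. -/
structure IsBraidFamily {ι S : Type*} [Ring S] (T : ι → ι → S) : Prop where
  symm : ∀ i j, T i j = T j i
  three : ∀ i j k, i ≠ j → i ≠ k → j ≠ k → ⁅T i j, T i k + T j k⁆ = 0
  four : ∀ i j k l, i ≠ j → k ≠ l → i ≠ k → i ≠ l → j ≠ k → j ≠ l → ⁅T i j, T k l⁆ = 0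

theorem IsBraidFamily.comp {ι κ S : Type*} [Ring S] {T : ι → ι → S} (hT : IsBraidFamily T)
    {e : κ → ι} (he : Function.Injective e) : IsBraidFamily fun i j => T (e i) (e j) where
  symm _ _ := hT.symm _ _
  three _ _ _ h1 h2 h3 := hT.three _ _ _ (he.ne h1) (he.ne h2) (he.ne h3)
  four _ _ _ _ h1 h2 h3 h4 h5 h6 :=
    hT.four _ _ _ _ (he.ne h1) (he.ne h2) (he.ne h3) (he.ne h4) (he.ne h5) (he.ne h6)

theorem IsBraidFamily.map {ι S S' : Type*} [Ring S] [Ring S'] {T : ι → ι → S}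
    (hT : IsBraidFamily T) (g : S →+* S') : IsBraidFamily fun i j => g (T i j) where
  symm i j := by rw [hT.symm]
  three i j k h1 h2 h3 := by
    have := congrArg g (hT.three i j k h1 h2 h3)
    simpa [Ring.lie_def] using this
  four i j k l h1 h2 h3 h4 h5 h6 := by
    have := congrArg g (hT.four i j k l h1 h2 h3 h4 h5 h6)
    simpa [Ring.lie_def] using this

section BraidHom

variable {K : Type*} [Field K] {S : Type*} [Ring S] [Algebra K S]

/-- Universal properties of the free Lie algebra, its quotient and the enveloping algebra. This
makes the pentagon available in any algebra, without any knowledge of the structure of 𝔱₄. -/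
theorem IsBraidFamily.exists_algHom {T : Fin 4 → Fin 4 → S} (hT : IsBraidFamily T) :
    ∃ φ : UT4 K →ₐ[K] S, ∀ i j h, φ (UniversalEnvelopingAlgebra.ι K
      (LieSubmodule.Quotient.mk (freeT K i j h) : T4 K)) = T i j := by
  let _ : LieRing S := LieRing.ofAssociativeRing
  let _ : LieAlgebra K S := LieAlgebra.ofAssociativeAlgebra
  let f : StrandPair → S := fun e => Sym2.lift ⟨T, hT.symm⟩ e.1
  let F : FreeLieAlgebra K StrandPair →ₗ⁅K⁆ S := FreeLieAlgebra.lift K f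
  have hF : ∀ i j h, F (freeT K i j h) = T i j := fun i j h => by
    simp [F, freeT, f, pair]
  let I : LieIdeal K (FreeLieAlgebra K StrandPair) :=
    LieSubmodule.lieSpan K (FreeLieAlgebra K StrandPair) {r | IsBraidRelator K r}
  have hI : I ≤ F.ker := by
    refine LieSubmodule.lieSpan_le.2 ?_
    intro r hr
    simp only [SetLike.mem_coe, LieHom.mem_ker]
    cases hr with
    | three i j k hij hik hjk =>
      rw [LieHom.map_lie, map_add, hF, hF, hF, hT.three i j k hij hik hjk]
    | four i j k l hij hkl h1 h2 h3 h4 =>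
      rw [LieHom.map_lie, hF, hF, hT.four i j k l hij hkl h1 h2 h3 h4]
  let Q : T4 K →ₗ⁅K⁆ S :=
    { (I.toSubmodule).liftQ (F : FreeLieAlgebra K StrandPair →ₗ[K] S)
        (fun x hx => (LieHom.mem_ker).1 (hI hx)) with
      map_lie' := by
        intro x y
        obtain ⟨x, rfl⟩ := Submodule.Quotient.mk_surjective _ x
        obtain ⟨y, rfl⟩ := Submodule.Quotient.mk_surjective _ y
        exact F.map_lie x y }
  refine ⟨UniversalEnvelopingAlgebra.lift K Q, fun i j h => ?_⟩
  rw [UniversalEnvelopingAlgebra.lift_ι_apply]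
  exact hF i j h

/-- The pentagon equation holds for every family satisfying the infinitesimal braid relations. -/
theorem IsAssociator.pentagon_of_family {μ : K} {Φ : NCSeries K} (hΦ : IsAssociator μ Φ)
    {T : Fin 4 → Fin 4 → S} (hT : IsBraidFamily T) :
    Φ.eval (degOne (T 0 1)) (degOne (T 1 2 + T 1 3)) *
        Φ.eval (degOne (T 0 2 + T 1 2)) (degOne (T 2 3)) =
      Φ.eval (degOne (T 1 2)) (degOne (T 2 3)) *
        Φ.eval (degOne (T 0 1 + T 0 2)) (degOne (T 1 3 + T 2 3)) *
        Φ.eval (degOne (T 0 1)) (degOne (T 1 2)) := by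
  obtain ⟨φ, hφ⟩ := hT.exists_algHom (K := K)
  have h := congrArg (PowerSeries.map (φ : UT4 K →+* S)) hΦ.pentagon
  simp only [t, ← degOne_add, map_mul, map_eval_degOne, map_add, hφ] at h
  exact h

variable {μ : K} {Φ : NCSeries K}

theorem IsAssociator.const (hΦ : IsAssociator μ Φ) : Φ [] = 1 := hΦ.groupLike.1

theorem IsAssociator.inversion_mul (hΦ : IsAssociator μ Φ) (a b : S) :
    Φ.eval (degOne a) (degOne b) * Φ.eval (degOne b) (degOne a) = 1 := by
  have h1 : Φ.eval (xhat K) (yhat K) ≠ 0 := by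
    intro h
    have := congrArg (PowerSeries.coeff 0) h
    rw [xhat, yhat, coeff_eval_degOne, homPart_zero_degree, hΦ.const] at this
    simp at this
  -- `Ring.inverse` is zero on non-units, so that the inversion axiom says nothing until Φ(y, x) is
  -- known to be a unit; this follows because Φ(x, y) has constant term 1.
  have h2 : IsUnit (Φ.eval (yhat K) (xhat K)) := by
    by_contra h
    exact h1 (by rw [hΦ.inversion, Ring.inverse_non_unit _ h])
  have h3 : Φ.eval (xhat K) (yhat K) * Φ.eval (yhat K) (xhat K) = 1 := by
    rw [hΦ.inversion, Ring.inverse_mul_cancel _ h2]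
  have := congrArg (PowerSeries.map ((FreeAlgebra.lift K ![a, b] : _ →ₐ[K] S) : _ →+* S)) h3
  simp only [xhat, yhat, map_mul, map_eval_degOne, map_one] at this
  simpa using this

theorem IsAssociator.inverse_eq (hΦ : IsAssociator μ Φ) :
    Ring.inverse (Φ.eval (xhat K) (yhat K)) = Φ.eval (yhat K) (xhat K) := by
  have h1 := hΦ.inversion_mul (FreeAlgebra.ι K (0 : Fin 2)) (FreeAlgebra.ι K 1)
  have h2 := hΦ.inversion_mul (FreeAlgebra.ι K (1 : Fin 2)) (FreeAlgebra.ι K 0)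
  exact Ring.inverse_unit ⟨Φ.eval (xhat K) (yhat K), Φ.eval (yhat K) (xhat K), h1, h2⟩

theorem IsAssociator.hexagon_of_eq (hΦ : IsAssociator μ Φ) {a b c : S} (h : a + b + c = 0) :
    expSeries K (degOne ((μ / 2) • a)) * Φ.eval (degOne c) (degOne a) *
      expSeries K (degOne ((μ / 2) • c)) * Φ.eval (degOne b) (degOne c) *
      expSeries K (degOne ((μ / 2) • b)) * Φ.eval (degOne a) (degOne b) = 1 := by
  have h0 := hΦ.hexagon (degOne (-(FreeAlgebra.ι K 0 + FreeAlgebra.ι K 1)))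
    (by rw [xhat, yhat, degOne_neg, degOne_add]; abel)
  have h1 := congrArg (PowerSeries.map ((FreeAlgebra.lift K ![a, b] : _ →ₐ[K] S) : _ →+* S)) h0
  have hc : c = -(a + b) := by rw [eq_neg_iff_add_eq_zero, ← h]; abel
  simp only [xhat, yhat, map_mul, ← degOne_smul, map_eval_degOne, map_expSeries_degOne,
    map_one, map_smul, map_neg, map_add] at h1
  simpa [hc] using h1

end BraidHom

/-! ### Leading poles -/

section Poles

variable {p : ℕ} [hp : Fact p.Prime]

/-- The `p`-adic integer equal to `q` if `q` is integral, and `0` elsewhere. -/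
def integralLift (q : ℚ_[p]) : ℤ_[p] := if h : ‖q‖ ≤ 1 then ⟨q, h⟩ else 0

theorem coe_integralLift {q : ℚ_[p]} (h : ‖q‖ ≤ 1) : (integralLift q : ℚ_[p]) = q :=
  congrArg (fun z : ℤ_[p] => (z : ℚ_[p])) (dif_pos h)

theorem toZMod_integralLift (q : ℚ_[p]) : PadicInt.toZMod (integralLift q) = residue p q := by
  by_cases h : ‖q‖ ≤ 1
  · have h1 : residue p q = PadicInt.toZMod (⟨q, h⟩ : ℤ_[p]) := dif_pos h
    exact (congrArg PadicInt.toZMod (dif_pos h)).trans h1.symm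
  · have h1 : residue p q = 0 := dif_neg h
    exact (congrArg PadicInt.toZMod (dif_neg h)).trans ((map_zero _).trans h1.symm)

theorem residue_coe (r : ℤ_[p]) : residue p (r : ℚ_[p]) = PadicInt.toZMod r := by
  rw [← toZMod_integralLift]
  congr 1
  exact Subtype.ext (coe_integralLift r.2)

/-- The coefficients of `p Φ`, as `p`-adic integers. -/
def topLift (Φ : NCSeries ℚ_[p]) : NCSeries ℤ_[p] := fun w => integralLift (p * Φ w)

/-- The coefficients of `Φ`, as `p`-adic integers. -/
def lowLift (Φ : NCSeries ℚ_[p]) : NCSeries ℤ_[p] := fun w => integralLift (Φ w)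

/-- The reduction modulo `p` of the coefficients of `p Φ`. -/
def topResidue (Φ : NCSeries ℚ_[p]) : NCSeries (ZMod p) := fun w => residue p (p * Φ w)

theorem HasSimplePoleBound.norm_le {Φ : NCSeries ℚ_[p]} (h : HasSimplePoleBound p Φ)
    {w : List (Fin 2)} (hw : w.length < p - 1) : ‖Φ w‖ ≤ 1 := by
  rcases Nat.eq_zero_or_pos w.length with h0 | h0
  · rw [List.length_eq_zero_iff.1 h0, h.const, norm_one]
  · exact h.integral w h0 hw

variable {S U : Type*} [Ring S] [Algebra ℤ_[p] S] [Ring U] [Algebra ℚ_[p] U]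

/-- A ring homomorphism from an algebra over `ℤ_p` to an algebra over `ℚ_p` compatible with the
scalars. -/
def IsScalarExt (p : ℕ) [Fact p.Prime] {S U : Type*} [Ring S] [Algebra ℤ_[p] S] [Ring U]
    [Algebra ℚ_[p] U] (j : S →+* U) : Prop := ∀ (r : ℤ_[p]) s, j (r • s) = (r : ℚ_[p]) • j s

/-- The series `Y` has constant term `1`, integral coefficients in degrees `< n`, and its coefficient
of degree `n` multiplied by `p` is integral and congruent to `s` modulo `p`. -/
structure HasTop (p : ℕ) [Fact p.Prime] {S U : Type*} [Ring S] [Algebra ℤ_[p] S] [Ring U]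
    [Algebra ℚ_[p] U] (j : S →+* U) (n : ℕ) (Y : U⟦X⟧) (s : S) : Prop where
  const : PowerSeries.coeff 0 Y = 1
  low : ∀ m < n, PowerSeries.coeff m Y ∈ j.range
  top : ∃ b, (p : ℚ_[p]) • PowerSeries.coeff n Y = j (s + (p : ℤ_[p]) • b)

variable {j : S →+* U}

theorem IsScalarExt.p_smul (hj : IsScalarExt p j) (s : S) :
    (p : ℚ_[p]) • j s = j ((p : ℤ_[p]) • s) := by
  rw [hj]; simp

theorem HasTop.mul (hj : IsScalarExt p j) {n : ℕ} {Y Z : U⟦X⟧} {s t : S}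
    (hY : HasTop p j n Y s) (hZ : HasTop p j n Z t) (hn : 0 < n) : HasTop p j n (Y * Z) (s + t) where
  const := by
    have h1 := hY.const
    have h2 := hZ.const
    simp only [PowerSeries.coeff_zero_eq_constantCoeff_apply] at *
    rw [map_mul, h1, h2, one_mul]
  low m hm := by
    rw [PowerSeries.coeff_mul]
    refine Subring.sum_mem _ fun q hq => ?_
    have := Finset.HasAntidiagonal.mem_antidiagonal.1 hq
    exact Subring.mul_mem _ (hY.low _ (by lia)) (hZ.low _ (by lia))
  top := by
    obtain ⟨m, rfl⟩ := Nat.exists_eq_succ_of_ne_zero hn.ne'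
    obtain ⟨b, hb⟩ := hY.top
    obtain ⟨c, hc⟩ := hZ.top
    have hmid : ∑ k ∈ Finset.range m, PowerSeries.coeff (k + 1) Y *
        PowerSeries.coeff (m + 1 - (k + 1)) Z ∈ j.range := by
      refine Subring.sum_mem _ fun k hk => ?_
      have := Finset.mem_range.1 hk
      exact Subring.mul_mem _ (hY.low _ (by lia)) (hZ.low _ (by lia))
    obtain ⟨d, hd⟩ := hmid
    refine ⟨b + c + d, ?_⟩
    rw [PowerSeries.coeff_mul, Finset.Nat.sum_antidiagonal_eq_sum_range_succ_mk,
      Finset.sum_range_succ, Finset.sum_range_succ', ← hd]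
    simp only [Nat.sub_self, Nat.sub_zero, Nat.succ_eq_add_one]
    rw [hY.const, hZ.const, mul_one, one_mul, smul_add, smul_add, hb, hc, hj.p_smul]
    simp only [map_add, smul_add]
    abel

theorem hasTop_one (n : ℕ) (hn : 0 < n) : HasTop p j n (1 : U⟦X⟧) 0 where
  const := by simp
  low m _ := by
    rw [PowerSeries.coeff_one]
    split_ifs
    exacts [Subring.one_mem _, Subring.zero_mem _]
  top := ⟨0, by simp [PowerSeries.coeff_one, hn.ne']⟩

/-- The leading pole of a series is well defined modulo `p`; two ways of writing the same series
therefore yield a congruence. -/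
theorem HasTop.congr (hinj : Function.Injective j) {n : ℕ} {Y : U⟦X⟧} {s t : S}
    (hs : HasTop p j n Y s) (ht : HasTop p j n Y t) : ∃ b, s - t = (p : ℤ_[p]) • b := by
  obtain ⟨b, hb⟩ := hs.top
  obtain ⟨c, hc⟩ := ht.top
  refine ⟨c - b, ?_⟩
  have := hinj (hb.symm.trans hc)
  rw [smul_sub, sub_eq_sub_iff_add_eq_add, this, add_comm]

theorem map_homPart_of_integral (hj : IsScalarExt p j) {f : NCSeries ℚ_[p]} {n : ℕ}
    (hf : ∀ w, w.length = n → ‖f w‖ ≤ 1) (u v : S) :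
    homPart f n (j u) (j v) = j (homPart (fun w => integralLift (f w)) n u v) :=
  (homPart_semilinear _ j hj _ f n (fun w hw => (coe_integralLift (hf w hw)).symm) u v).symm

theorem map_homPart_topLift (hj : IsScalarExt p j) {Φ : NCSeries ℚ_[p]}
    (h : HasSimplePoleBound p Φ) (u v : S) :
    (p : ℚ_[p]) • homPart Φ (p - 1) (j u) (j v) = j (homPart (topLift Φ) (p - 1) u v) := by
  rw [← homPart_smul_coeff]
  exact map_homPart_of_integral hj (f := (p : ℚ_[p]) • Φ) (fun w hw => h.pole w hw) u v

theorem HasSimplePoleBound.hasTop_eval (hj : IsScalarExt p j) {Φ : NCSeries ℚ_[p]}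
    (h : HasSimplePoleBound p Φ) (u v : S) :
    HasTop p j (p - 1) (Φ.eval (degOne (j u)) (degOne (j v)))
      (homPart (topLift Φ) (p - 1) u v) where
  const := by rw [coeff_eval_degOne, homPart_zero_degree, h.const, one_smul]
  low m hm := by
    rw [coeff_eval_degOne, map_homPart_of_integral hj (fun w hw => h.norm_le (by lia))]
    exact ⟨_, rfl⟩
  top := ⟨0, by rw [coeff_eval_degOne, map_homPart_topLift hj h, smul_zero, add_zero]⟩

theorem norm_natCast_factorial {m : ℕ} (hm : m < p) : ‖(m.factorial : ℚ_[p])‖ = 1 := by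
  refine le_antisymm (by exact_mod_cast Padic.norm_int_le_one (p := p) m.factorial) ?_
  by_contra! hlt
  have h1 : ‖((m.factorial : ℤ) : ℚ_[p])‖ < 1 := by exact_mod_cast hlt
  rw [Padic.norm_intCast_lt_one_iff] at h1
  have := (Nat.Prime.dvd_factorial hp.out).1 (by exact_mod_cast h1)
  lia

theorem norm_two (h2 : 2 < p) : ‖(2 : ℚ_[p])‖ = 1 := by
  simpa using norm_natCast_factorial (p := p) h2

theorem norm_exp_coeff (h2 : 2 < p) {m : ℕ} (hm : m < p) :
    ‖((m.factorial : ℚ_[p])⁻¹ * (1 / 2) ^ m)‖ ≤ 1 := by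
  simp [norm_natCast_factorial hm, norm_two h2]

/-- The factorials up to (`p` - 1)! and the powers of 2 are units because `p` is odd, so
exponentials have no pole through degree `p - 1` and drop out of the hexagon. -/
theorem hasTop_expSeries (hj : IsScalarExt p j) (h2 : 2 < p) (u : S) :
    HasTop p j (p - 1) (expSeries ℚ_[p] (degOne (((1 : ℚ_[p]) / 2) • j u))) 0 := by
  have key : ∀ m ≤ p - 1, ∃ b : S,
      PowerSeries.coeff m (expSeries ℚ_[p] (degOne (((1 : ℚ_[p]) / 2) • j u))) = j b := by
    intro m hm
    refine ⟨integralLift ((m.factorial : ℚ_[p])⁻¹ * (1 / 2) ^ m) • u ^ m, ?_⟩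
    rw [coeff_expSeries_degOne, hj, coe_integralLift (norm_exp_coeff h2 (by lia)), smul_pow,
      smul_smul, map_pow]
  refine ⟨?_, fun m hm => ?_, ?_⟩
  · rw [coeff_expSeries_degOne]; simp
  · obtain ⟨b, hb⟩ := key m hm.le
    exact ⟨b, hb.symm⟩
  · obtain ⟨b, hb⟩ := key _ le_rfl
    exact ⟨b, by rw [hb, zero_add, hj.p_smul]⟩

end Poles

/-! ### The equations for the leading pole -/

section Leading

variable {p : ℕ} [hp : Fact p.Prime] {S : Type*} [Ring S] [Algebra ℤ_[p] S]

variable (p S) in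
/-- The map from an algebra over `ℤ_p` to its base change to `ℚ_p`. -/
def toGeneric : S →+* ℚ_[p] ⊗[ℤ_[p]] S :=
  (Algebra.TensorProduct.includeRight : S →ₐ[ℤ_[p]] ℚ_[p] ⊗[ℤ_[p]] S).toRingHom

theorem isScalarExt_toGeneric : IsScalarExt p (toGeneric p S) := by
  intro r s
  have : ((r : ℚ_[p])) • ((1 : ℚ_[p]) ⊗ₜ[ℤ_[p]] s) = (r • (1 : ℚ_[p])) ⊗ₜ[ℤ_[p]] s := by
    rw [TensorProduct.smul_tmul']; rfl
  change (1 : ℚ_[p]) ⊗ₜ[ℤ_[p]] (r • s) = (r : ℚ_[p]) • ((1 : ℚ_[p]) ⊗ₜ[ℤ_[p]] s)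
  rw [this, TensorProduct.smul_tmul]

/-- This is the reason for working with torsion-free algebras: identities which hold after inverting
`p` descend. -/
theorem toGeneric_injective [Module.IsTorsionFree ℤ_[p] S] :
    Function.Injective (toGeneric p S) :=
  Algebra.TensorProduct.includeRight_injective (R := ℤ_[p]) (A := ℚ_[p]) (B := S)
    (FaithfulSMul.algebraMap_injective ℤ_[p] ℚ_[p])

variable [Module.IsTorsionFree ℤ_[p] S] {Φ : NCSeries ℚ_[p]}

theorem topLift_inversion (hΦ : IsAssociator 1 Φ) (hb : HasSimplePoleBound p Φ) (u v : S) :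
    ∃ b, homPart (topLift Φ) (p - 1) u v + homPart (topLift Φ) (p - 1) v u = (p : ℤ_[p]) • b := by
  have hj := isScalarExt_toGeneric (p := p) (S := S)
  have hn : 0 < p - 1 := by have := hp.out.two_le; lia
  have h1 := (hb.hasTop_eval hj u v).mul hj (hb.hasTop_eval hj v u) hn
  rw [hΦ.inversion_mul] at h1
  simpa using h1.congr toGeneric_injective (hasTop_one _ hn)

theorem topLift_hexagon (h2 : 2 < p) (hΦ : IsAssociator 1 Φ) (hb : HasSimplePoleBound p Φ)
    {u v w : S} (h : u + v + w = 0) :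
    ∃ b, homPart (topLift Φ) (p - 1) w u + homPart (topLift Φ) (p - 1) v w +
      homPart (topLift Φ) (p - 1) u v = (p : ℤ_[p]) • b := by
  have hj := isScalarExt_toGeneric (p := p) (S := S)
  have hn : 0 < p - 1 := by have := hp.out.two_le; lia
  have h1 := ((((((hasTop_expSeries hj h2 u).mul hj (hb.hasTop_eval hj w u) hn).mul hj
    (hasTop_expSeries hj h2 w) hn).mul hj (hb.hasTop_eval hj v w) hn).mul hj
    (hasTop_expSeries hj h2 v) hn).mul hj (hb.hasTop_eval hj u v) hn)
  rw [hΦ.hexagon_of_eq (by rw [← map_add, ← map_add, h, map_zero])] at h1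
  simpa using h1.congr toGeneric_injective (hasTop_one _ hn)

/-- Formulated for braid families in a torsion-free algebra instead of an integral form of U(𝔱₄),
whose torsion would have to be controlled. The operators on the free algebra in three letters are
such a family. -/
theorem topLift_pentagon (hΦ : IsAssociator 1 Φ) (hb : HasSimplePoleBound p Φ)
    {T : Fin 4 → Fin 4 → S} (hT : IsBraidFamily T) :
    ∃ b, (homPart (topLift Φ) (p - 1) (T 0 1) (T 1 2 + T 1 3) +
        homPart (topLift Φ) (p - 1) (T 0 2 + T 1 2) (T 2 3)) -
      (homPart (topLift Φ) (p - 1) (T 1 2) (T 2 3) +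
        homPart (topLift Φ) (p - 1) (T 0 1 + T 0 2) (T 1 3 + T 2 3) +
        homPart (topLift Φ) (p - 1) (T 0 1) (T 1 2)) = (p : ℤ_[p]) • b := by
  have hj := isScalarExt_toGeneric (p := p) (S := S)
  have hn : 0 < p - 1 := by have := hp.out.two_le; lia
  have h1 := (hb.hasTop_eval hj (T 0 1) (T 1 2 + T 1 3)).mul hj
    (hb.hasTop_eval hj (T 0 2 + T 1 2) (T 2 3)) hn
  have h2 := ((hb.hasTop_eval hj (T 1 2) (T 2 3)).mul hj
    (hb.hasTop_eval hj (T 0 1 + T 0 2) (T 1 3 + T 2 3)) hn).mul hj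
    (hb.hasTop_eval hj (T 0 1) (T 1 2)) hn
  have h3 := hΦ.pentagon_of_family (hT.map (toGeneric p S))
  simp only [← map_add] at h3
  rw [h3] at h1
  exact h1.congr toGeneric_injective h2

end Leading

/-! ### Nested brackets and the Dynkin operator -/

section Dynkin

/-- The right-normed bracket `[a₁, [a₂, …, [aₙ₋₁, aₙ]]]`. -/
def nestedBracket {S : Type*} [Ring S] : List S → S
  | [] => 0
  | [a] => a
  | a :: b :: l => a * nestedBracket (b :: l) - nestedBracket (b :: l) * a

theorem map_nestedBracket {S S' : Type*} [Ring S] [Ring S'] (g : S →+* S') (l : List S) :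
    g (nestedBracket l) = nestedBracket (l.map g) := by
  induction l with
  | nil => simp [nestedBracket]
  | cons a l ih =>
    cases l with
    | nil => simp [nestedBracket]
    | cons b l => simpa [nestedBracket] using by rw [ih]; rfl

/-- The part of degree `n` of a series, with words replaced by right-normed brackets. -/
def bracketPart {R S : Type*} [CommRing R] [Ring S] [Algebra R S] (f : NCSeries R) (n : ℕ)
    (u v : S) : S :=
  ∑ w : Fin n → Fin 2, f (List.ofFn w) • nestedBracket ((List.ofFn w).map ![u, v])

theorem bracketPart_semilinear {R S R' S' : Type*} [CommRing R] [Ring S] [Algebra R S]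
    [CommRing R'] [Ring S'] [Algebra R' S'] (c : R → R')
    (g : S →+* S') (hg : ∀ r s, g (r • s) = c r • g s) (f : NCSeries R) (f' : NCSeries R') (n : ℕ)
    (hf : ∀ w, w.length = n → f' w = c (f w)) (u v : S) :
    g (bracketPart f n u v) = bracketPart f' n (g u) (g v) := by
  simp only [bracketPart, map_sum, hg, map_nestedBracket, List.map_map, map_vec]
  exact Finset.sum_congr rfl fun w _ => by rw [hf _ List.length_ofFn]

theorem bracketPart_smul_coeff {R S : Type*} [CommRing R] [Ring S] [Algebra R S] (c : R)
    (f : NCSeries R) (n : ℕ) (u v : S) : bracketPart (c • f) n u v = c • bracketPart f n u v := by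
  simp [bracketPart, Finset.smul_sum, mul_smul]

theorem bracketPart_zero_degree {R S : Type*} [CommRing R] [Ring S] [Algebra R S]
    (f : NCSeries R) (u v : S) : bracketPart f 0 u v = 0 := by
  simp [bracketPart, nestedBracket]

variable {K : Type*} [Field K]

local notation "𝒜" => FreeAlgebra K (Fin 2)

/-- One step of the Dynkin operator: the second component remembers the constant term. -/
def dynkinStep (i : Fin 2) : Module.End K (FreeAlgebra K (Fin 2) × K) :=
  LinearMap.prod
    ((LinearMap.mulLeft K (FreeAlgebra.ι K i) - LinearMap.mulRight K (FreeAlgebra.ι K i)).comp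
        (LinearMap.fst K _ _) +
      (LinearMap.toSpanSingleton K _ (FreeAlgebra.ι K i)).comp (LinearMap.snd K _ _)) 0

variable (K) in
/-- The Dynkin operator, which maps a word to the corresponding right-normed bracket, together with
the constant term. -/
def dynkinPair : FreeAlgebra K (Fin 2) →ₗ[K] FreeAlgebra K (Fin 2) × K :=
  (LinearMap.applyₗ ((0, 1) : FreeAlgebra K (Fin 2) × K)).comp
    (FreeAlgebra.lift K (dynkinStep (K := K))).toLinearMap

theorem dynkinPair_one : dynkinPair K 1 = (0, 1) := by
  simp [dynkinPair]

/-- The recursion D(x_i u) = [x_i, D(u)] + ε(u) x_i. The constant term ε is carried along because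
the bracket of the empty word is 0, not a unit for bracketing. -/
theorem dynkinPair_mul (i : Fin 2) (u : 𝒜) : dynkinPair K (FreeAlgebra.ι K i * u) =
    (FreeAlgebra.ι K i * (dynkinPair K u).1 - (dynkinPair K u).1 * FreeAlgebra.ι K i +
      (dynkinPair K u).2 • FreeAlgebra.ι K i, 0) := by
  simp [dynkinPair, dynkinStep]

theorem dynkinPair_prod (w : List (Fin 2)) :
    dynkinPair K (w.map (FreeAlgebra.ι K)).prod =
      (nestedBracket (w.map (FreeAlgebra.ι K)), if w = [] then 1 else 0) := by
  induction w with
  | nil => simp [dynkinPair_one, nestedBracket]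
  | cons i w ih =>
    rw [List.map_cons, List.prod_cons, dynkinPair_mul, ih]
    cases w <;> simp [nestedBracket]

/-- The map `u ⊗ v ↦ D(u) v` with the Dynkin operator `D`. -/
def dynkinMul : 𝒜 ⊗[K] 𝒜 →ₗ[K] 𝒜 :=
  TensorProduct.lift ((LinearMap.mul K 𝒜).comp ((LinearMap.fst K _ _).comp (dynkinPair K)))

/-- The map `u ⊗ v ↦ ε(u) v` with the constant term `ε`. -/
def counitMul : 𝒜 ⊗[K] 𝒜 →ₗ[K] 𝒜 :=
  TensorProduct.lift ((LinearMap.lsmul K 𝒜).comp ((LinearMap.snd K _ _).comp (dynkinPair K)))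

theorem dynkinMul_tmul (u v : 𝒜) : dynkinMul (u ⊗ₜ[K] v) = (dynkinPair K u).1 * v := rfl

theorem counitMul_tmul (u v : 𝒜) : counitMul (u ⊗ₜ[K] v) = (dynkinPair K u).2 • v := rfl

theorem dynkinMul_mul (i : Fin 2) (T : 𝒜 ⊗[K] 𝒜) :
    dynkinMul ((FreeAlgebra.ι K i ⊗ₜ 1 + 1 ⊗ₜ FreeAlgebra.ι K i) * T) =
      FreeAlgebra.ι K i * (dynkinMul T + counitMul T) := by
  induction T with
  | zero => simp
  | add T T' h h' => simp only [mul_add, map_add] at *; rw [h, h']; abel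
  | tmul u v =>
    simp only [add_mul, Algebra.TensorProduct.tmul_mul_tmul, one_mul, map_add, dynkinMul_tmul,
      counitMul_tmul, dynkinPair_mul, mul_add, sub_mul, smul_mul_assoc, mul_smul_comm, mul_assoc]
    abel

theorem counitMul_mul (i : Fin 2) (T : 𝒜 ⊗[K] 𝒜) :
    counitMul ((FreeAlgebra.ι K i ⊗ₜ 1 + 1 ⊗ₜ FreeAlgebra.ι K i) * T) =
      FreeAlgebra.ι K i * counitMul T := by
  induction T with
  | zero => simp
  | add T T' h h' => simp only [mul_add, map_add] at *; rw [h, h']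
  | tmul u v =>
    simp [add_mul, Algebra.TensorProduct.tmul_mul_tmul, counitMul_tmul, dynkinPair_mul]

theorem counitMul_coproduct (w : List (Fin 2)) :
    counitMul (w.map fun i => (FreeAlgebra.ι K i ⊗ₜ[K] (1 : 𝒜) + 1 ⊗ₜ FreeAlgebra.ι K i)).prod =
      (w.map (FreeAlgebra.ι K)).prod := by
  induction w with
  | nil => simp [Algebra.TensorProduct.one_def, counitMul_tmul, dynkinPair_one]
  | cons i w ih => simp only [List.map_cons, List.prod_cons, counitMul_mul, ih]

/-- The convolution identity of Dynkin, Specht and Wever: applying u ⊗ v ↦ D(u)v to Δ(w) multiplies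
w by its length. In the recursion the commutator terms cancel, and each letter contributes w once
through the counit. -/
theorem dynkinMul_coproduct (w : List (Fin 2)) :
    dynkinMul (w.map fun i => (FreeAlgebra.ι K i ⊗ₜ[K] (1 : 𝒜) + 1 ⊗ₜ FreeAlgebra.ι K i)).prod =
      (w.length : K) • (w.map (FreeAlgebra.ι K)).prod := by
  induction w with
  | nil => simp [Algebra.TensorProduct.one_def, dynkinMul_tmul, dynkinPair_one]
  | cons i w ih =>
    simp only [List.map_cons, List.prod_cons, dynkinMul_mul, ih, counitMul_coproduct,
      List.length_cons, Nat.cast_add, Nat.cast_one, add_smul, one_smul, mul_add, mul_smul_comm]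

theorem vec_ι {X : Type*} (g : Fin 2 → X) : ![g 0, g 1] = g := by
  ext i; fin_cases i <;> rfl

theorem dynkinPair_homPart (f : NCSeries K) (n : ℕ) :
    (dynkinPair K (homPart f n (FreeAlgebra.ι K (0 : Fin 2)) (FreeAlgebra.ι K (1 : Fin 2)))).1 =
      bracketPart f n (FreeAlgebra.ι K (0 : Fin 2)) (FreeAlgebra.ι K (1 : Fin 2)) := by
  simp only [homPart, bracketPart, map_sum, map_smul, vec_ι, dynkinPair_prod, Prod.fst_sum,
    Prod.smul_fst]

theorem IsGroupLike.dynkin_free {Φ : NCSeries K} (h : IsGroupLike Φ) (n : ℕ) :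
    (n : K) • homPart Φ n (FreeAlgebra.ι K (0 : Fin 2)) (FreeAlgebra.ι K (1 : Fin 2)) =
      ∑ q ∈ Finset.HasAntidiagonal.antidiagonal n,
        bracketPart Φ q.1 (FreeAlgebra.ι K (0 : Fin 2)) (FreeAlgebra.ι K (1 : Fin 2)) *
          homPart Φ q.2 (FreeAlgebra.ι K (0 : Fin 2)) (FreeAlgebra.ι K (1 : Fin 2)) := by
  -- Apply u ⊗ v ↦ D(u)v to ΔΦ = (Φ ⊗ 1)(1 ⊗ Φ) in degree `n`.
  have h1 := congrArg (fun Y => dynkinMul (PowerSeries.coeff n Y)) h.2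
  simp only [← degOne_add, PowerSeries.coeff_mul, coeff_eval_degOne, map_sum] at h1
  have hl (m : ℕ) : homPart Φ m (FreeAlgebra.ι K (0 : Fin 2) ⊗ₜ[K] (1 : 𝒜)) (FreeAlgebra.ι K (1 : Fin 2) ⊗ₜ[K] 1) =
      homPart Φ m (FreeAlgebra.ι K (0 : Fin 2)) (FreeAlgebra.ι K (1 : Fin 2)) ⊗ₜ[K] 1 :=
    (map_homPart (Algebra.TensorProduct.includeLeft : 𝒜 →ₐ[K] 𝒜 ⊗[K] 𝒜) Φ m
      (FreeAlgebra.ι K (0 : Fin 2)) (FreeAlgebra.ι K (1 : Fin 2))).symm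
  have hr (m : ℕ) : homPart Φ m ((1 : 𝒜) ⊗ₜ[K] FreeAlgebra.ι K (0 : Fin 2)) (1 ⊗ₜ[K] FreeAlgebra.ι K (1 : Fin 2)) =
      1 ⊗ₜ[K] homPart Φ m (FreeAlgebra.ι K (0 : Fin 2)) (FreeAlgebra.ι K (1 : Fin 2)) :=
    (map_homPart (Algebra.TensorProduct.includeRight : 𝒜 →ₐ[K] 𝒜 ⊗[K] 𝒜) Φ m
      (FreeAlgebra.ι K (0 : Fin 2)) (FreeAlgebra.ι K (1 : Fin 2))).symm
  simp only [hl, hr, Algebra.TensorProduct.tmul_mul_tmul, one_mul, mul_one, dynkinMul_tmul,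
    dynkinPair_homPart] at h1
  rw [← h1]
  have hv : (![FreeAlgebra.ι K (0 : Fin 2) ⊗ₜ[K] (1 : 𝒜) + 1 ⊗ₜ FreeAlgebra.ι K (0 : Fin 2),
      FreeAlgebra.ι K (1 : Fin 2) ⊗ₜ[K] 1 + 1 ⊗ₜ FreeAlgebra.ι K (1 : Fin 2)] : Fin 2 → 𝒜 ⊗[K] 𝒜) =
      fun i => FreeAlgebra.ι K i ⊗ₜ[K] (1 : 𝒜) + 1 ⊗ₜ FreeAlgebra.ι K i :=
    vec_ι fun i => FreeAlgebra.ι K i ⊗ₜ[K] (1 : 𝒜) + 1 ⊗ₜ FreeAlgebra.ι K i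
  simp only [homPart, hv, map_sum, map_smul, dynkinMul_coproduct, Finset.smul_sum, vec_ι]
  refine Finset.sum_congr rfl fun w _ => ?_
  rw [smul_comm, List.length_ofFn]

theorem IsGroupLike.dynkin {Φ : NCSeries K} (h : IsGroupLike Φ) (n : ℕ) {S : Type*} [Ring S]
    [Algebra K S] (u v : S) :
    (n : K) • homPart Φ n u v =
      ∑ q ∈ Finset.HasAntidiagonal.antidiagonal n, bracketPart Φ q.1 u v * homPart Φ q.2 u v := by
  have h1 := congrArg (FreeAlgebra.lift K ![u, v] : 𝒜 →ₐ[K] S) (h.dynkin_free n)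
  have h2 (m : ℕ) : FreeAlgebra.lift K ![u, v]
      (bracketPart Φ m (FreeAlgebra.ι K (0 : Fin 2)) (FreeAlgebra.ι K (1 : Fin 2))) = bracketPart Φ m u v := by
    have := bracketPart_semilinear id ((FreeAlgebra.lift K ![u, v] : 𝒜 →ₐ[K] S) : 𝒜 →+* S)
      (fun r s => map_smul (FreeAlgebra.lift K ![u, v]) r s) Φ Φ m (fun _ _ => rfl)
      (FreeAlgebra.ι K (0 : Fin 2)) (FreeAlgebra.ι K (1 : Fin 2))
    simpa using this
  simpa [map_homPart, h2] using h1

end Dynkin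

/-! ### The equations modulo `p` -/

section Residue

variable {p : ℕ} [hp : Fact p.Prime] {Φ : NCSeries ℚ_[p]}

/-- In `n`Φ_n = ∑ D(Φ_i)Φ_{n-i} with `n = p - 1`, the term `i = 0` vanishes, the intermediate terms
are integral, and only D(Φ_{p-1}) can have a pole. Since `p - 1` is a unit modulo `p`, this exhibits
the leading pole as a combination of brackets without a criterion for Lie elements in characteristic
`p`. -/
theorem topLift_dynkin {S : Type*} [Ring S] [Algebra ℤ_[p] S] [Module.IsTorsionFree ℤ_[p] S]
    (hΦ : IsAssociator 1 Φ) (hb : HasSimplePoleBound p Φ) (u v : S) :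
    ∃ b, ((p - 1 : ℕ) : ℤ_[p]) • homPart (topLift Φ) (p - 1) u v -
      bracketPart (topLift Φ) (p - 1) u v = (p : ℤ_[p]) • b := by
  have hj := isScalarExt_toGeneric (p := p) (S := S)
  set j := toGeneric p S with hjdef
  have hlow (m : ℕ) (hm : m < p - 1) : homPart Φ m (j u) (j v) ∈ j.range := by
    rw [map_homPart_of_integral hj (fun w hw => hb.norm_le (by lia))]
    exact ⟨_, rfl⟩
  have hlowb (m : ℕ) (hm : m < p - 1) : bracketPart Φ m (j u) (j v) ∈ j.range := by
    rw [← bracketPart_semilinear _ j hj (lowLift Φ) Φ m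
      (fun w hw => (coe_integralLift (hb.norm_le (by lia))).symm)]
    exact ⟨_, rfl⟩
  have htopb : (p : ℚ_[p]) • bracketPart Φ (p - 1) (j u) (j v) =
      j (bracketPart (topLift Φ) (p - 1) u v) := by
    rw [← bracketPart_smul_coeff]
    exact (bracketPart_semilinear _ j hj (topLift Φ) ((p : ℚ_[p]) • Φ) (p - 1)
      (fun w hw => (coe_integralLift (hb.pole w hw)).symm) u v).symm
  have h1 := hΦ.groupLike.dynkin (p - 1) (j u) (j v)
  have htop := map_homPart_topLift hj hb u v
  obtain ⟨m, hm⟩ : ∃ m, p - 1 = m + 1 :=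
    ⟨p - 2, by have := hp.out.two_le; lia⟩
  rw [hm] at hlow hlowb h1 htop htopb ⊢
  have hmid : ∑ k ∈ Finset.range m, bracketPart Φ (k + 1) (j u) (j v) *
      homPart Φ (m + 1 - (k + 1)) (j u) (j v) ∈ j.range := by
    refine Subring.sum_mem _ fun k hk => ?_
    have := Finset.mem_range.1 hk
    exact Subring.mul_mem _ (hlowb _ (by lia)) (hlow _ (by lia))
  obtain ⟨d, hd⟩ := hmid
  rw [Finset.Nat.sum_antidiagonal_eq_sum_range_succ_mk, Finset.sum_range_succ,
    Finset.sum_range_succ', ← hd] at h1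
  simp only [Nat.sub_self, homPart_zero_degree, bracketPart_zero_degree, zero_mul, add_zero,
    hΦ.const, one_smul, mul_one] at h1
  refine ⟨d, toGeneric_injective (p := p) ?_⟩
  rw [← hjdef, map_sub, hj, ← htop, ← htopb, ← hj.p_smul, smul_comm, PadicInt.coe_natCast, h1,
    smul_add, add_sub_cancel_right]

/-- Reduction modulo `p` followed by evaluation. -/
theorem exists_residueHom {X S : Type*} [Ring S] [Algebra (ZMod p) S] (g : X → S) :
    ∃ r : FreeAlgebra ℤ_[p] X →+* S, (∀ i, r (FreeAlgebra.ι ℤ_[p] i) = g i) ∧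
      ∀ (c : ℤ_[p]) s, r (c • s) = PadicInt.toZMod c • r s := by
  let _ : Algebra ℤ_[p] S := Algebra.compHom S (PadicInt.toZMod : ℤ_[p] →+* ZMod p)
  exact ⟨FreeAlgebra.lift ℤ_[p] g, fun i => by simp, fun c s =>
    map_smul (FreeAlgebra.lift ℤ_[p] g) c s⟩

theorem toZMod_p : PadicInt.toZMod (p : ℤ_[p]) = 0 := by simp

variable {S : Type*} [Ring S] [Algebra (ZMod p) S]

theorem map_topLift_homPart {S' : Type*} [Ring S'] [Algebra ℤ_[p] S'] (r : S' →+* S)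
    (hr : ∀ (c : ℤ_[p]) s, r (c • s) = PadicInt.toZMod c • r s) (n : ℕ) (u v : S') :
    r (homPart (topLift Φ) n u v) = homPart (topResidue Φ) n (r u) (r v) :=
  homPart_semilinear _ r hr _ _ n (fun _ _ => (toZMod_integralLift _).symm) u v

theorem topResidue_inversion (hΦ : IsAssociator 1 Φ) (hb : HasSimplePoleBound p Φ) (u v : S) :
    homPart (topResidue Φ) (p - 1) u v = -homPart (topResidue Φ) (p - 1) v u := by
  obtain ⟨r, hr, hr'⟩ := exists_residueHom (p := p) ![u, v]
  obtain ⟨b, hb⟩ := topLift_inversion hΦ hb (FreeAlgebra.ι ℤ_[p] (0 : Fin 2)) (FreeAlgebra.ι ℤ_[p] (1 : Fin 2))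
  have := congrArg r hb
  rw [map_add, map_topLift_homPart r hr', map_topLift_homPart r hr', hr, hr, hr', toZMod_p,
    zero_smul] at this
  exact eq_neg_of_add_eq_zero_left this

theorem topResidue_hexagon (h2 : 2 < p) (hΦ : IsAssociator 1 Φ) (hb : HasSimplePoleBound p Φ)
    {u v w : S} (h : u + v + w = 0) :
    homPart (topResidue Φ) (p - 1) w u + homPart (topResidue Φ) (p - 1) v w +
      homPart (topResidue Φ) (p - 1) u v = 0 := by
  obtain ⟨r, hr, hr'⟩ := exists_residueHom (p := p) ![u, v]
  obtain ⟨b, hb⟩ := topLift_hexagon h2 hΦ hb (u := FreeAlgebra.ι ℤ_[p] (0 : Fin 2))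
    (v := FreeAlgebra.ι ℤ_[p] (1 : Fin 2)) (w := -(FreeAlgebra.ι ℤ_[p] (0 : Fin 2) + FreeAlgebra.ι ℤ_[p] (1 : Fin 2)))
    (by abel)
  have := congrArg r hb
  have hw : w = -(u + v) := by rw [eq_neg_iff_add_eq_zero, ← h]; abel
  have h0 : r (FreeAlgebra.ι ℤ_[p] (0 : Fin 2)) = u := hr 0
  have h1 : r (FreeAlgebra.ι ℤ_[p] (1 : Fin 2)) = v := hr 1
  simpa only [map_add, map_topLift_homPart r hr', map_neg, h0, h1, hr', toZMod_p,
    zero_smul, hw] using this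

theorem topResidue_dynkin (hΦ : IsAssociator 1 Φ) (hb : HasSimplePoleBound p Φ) (u v : S) :
    ((p - 1 : ℕ) : ZMod p) • homPart (topResidue Φ) (p - 1) u v =
      bracketPart (topResidue Φ) (p - 1) u v := by
  obtain ⟨r, hr, hr'⟩ := exists_residueHom (p := p) ![u, v]
  obtain ⟨b, hb⟩ := topLift_dynkin hΦ hb (FreeAlgebra.ι ℤ_[p] (0 : Fin 2)) (FreeAlgebra.ι ℤ_[p] (1 : Fin 2))
  have := congrArg r hb
  rw [map_sub, hr', map_topLift_homPart r hr', bracketPart_semilinear _ r hr' (topLift Φ) (topResidue Φ) (p - 1)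
    (fun _ _ => (toZMod_integralLift _).symm), hr, hr, hr', toZMod_p, zero_smul, map_natCast] at this
  exact sub_eq_zero.1 this

end Residue

/-! ### Derivations of free algebras -/

section Derivations

variable {R : Type*} [CommRing R]

/-- Derivations of an associative algebra. -/
def IsDer {A : Type*} [Ring A] [Algebra R A] (D : Module.End R A) : Prop :=
  ∀ a b, D (a * b) = D a * b + a * D b

section

variable {A : Type*} [Ring A] [Algebra R A] {D D' : Module.End R A}

theorem IsDer.map_one (h : IsDer D) : D 1 = 0 := by
  have := h 1 1
  simpa using this

theorem IsDer.add (h : IsDer D) (h' : IsDer D') : IsDer (D + D') := fun a b => by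
  simp only [LinearMap.add_apply, h a b, h' a b, add_mul, mul_add]; abel

theorem IsDer.smul (h : IsDer D) (c : R) : IsDer (c • D) := fun a b => by
  simp [h a b]

theorem IsDer.bracket (h : IsDer D) (h' : IsDer D') : IsDer (D * D' - D' * D) := fun a b => by
  simp only [LinearMap.sub_apply, Module.End.mul_apply, h a b, h' a b, map_add, h _ _, h' _ _]
  noncomm_ring

theorem isDer_zero : IsDer (0 : Module.End R A) := fun a b => by simp

variable (R A) in
/-- The space of derivations. -/
def derivations : Submodule R (Module.End R A) where
  carrier := {D | IsDer D}
  add_mem' h h' := by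
    simp only [Set.mem_ofPred_eq] at *
    exact h.add h'
  zero_mem' := by
    simp only [Set.mem_ofPred_eq]
    exact isDer_zero
  smul_mem' c _ h := by
    simp only [Set.mem_ofPred_eq] at *
    exact h.smul c

theorem mem_derivations : D ∈ derivations R A ↔ IsDer D := Iff.rfl

end

variable {X : Type*}

theorem IsDer.ext {D D' : Module.End R (FreeAlgebra R X)} (h : IsDer D) (h' : IsDer D')
    (hx : ∀ i, D (FreeAlgebra.ι R i) = D' (FreeAlgebra.ι R i)) : D = D' := by
  ext a
  induction a using FreeAlgebra.induction with
  | grade0 r =>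
    rw [Algebra.algebraMap_eq_smul_one, map_smul, map_smul, h.map_one, h'.map_one]
  | grade1 i => exact hx i
  | mul a b ha hb => rw [h, h', ha, hb]
  | add a b ha hb => rw [map_add, map_add, ha, hb]

/-- The algebra morphism `a ↦ a + D(a) ε` for the derivation `D` with given values on letters. -/
def derHom (d : X → FreeAlgebra R X) :
    FreeAlgebra R X →ₐ[R] TrivSqZeroExt (FreeAlgebra R X) (FreeAlgebra R X) :=
  FreeAlgebra.lift R fun i => TrivSqZeroExt.inl (FreeAlgebra.ι R i) + TrivSqZeroExt.inr (d i)

theorem fst_derHom (d : X → FreeAlgebra R X) (a : FreeAlgebra R X) : (derHom d a).fst = a := by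
  have : (TrivSqZeroExt.fstHom R (FreeAlgebra R X) (FreeAlgebra R X)).comp (derHom d) =
      AlgHom.id R _ := by
    ext i; simp [derHom]
  exact DFunLike.congr_fun this a

/-- The derivation of a free algebra with given values on letters. -/
def der (d : X → FreeAlgebra R X) : Module.End R (FreeAlgebra R X) where
  toFun a := (derHom d a).snd
  map_add' a b := by simp
  map_smul' c a := by simp

theorem der_ι (d : X → FreeAlgebra R X) (i : X) : der d (FreeAlgebra.ι R i) = d i := by
  simp [der, derHom]

theorem isDer_der (d : X → FreeAlgebra R X) : IsDer (der d) := fun a b => by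
  simp [der, TrivSqZeroExt.snd_mul, fst_derHom, add_comm]

end Derivations

/-! ### The action of infinitesimal braids on the free algebra in three letters -/

section BraidOp

variable (R : Type*) [CommRing R]

/-- The derivation `D_{ij}` with `x_i ↦ [x_i, x_j]`, `x_j ↦ [x_j, x_i]` and `x_k ↦ 0`. -/
def pairDer (i j : Fin 3) : Module.End R (FreeAlgebra R (Fin 3)) :=
  der fun k =>
    (if k = i then FreeAlgebra.ι R i * FreeAlgebra.ι R j - FreeAlgebra.ι R j * FreeAlgebra.ι R i
      else 0) +
    if k = j then FreeAlgebra.ι R j * FreeAlgebra.ι R i - FreeAlgebra.ι R i * FreeAlgebra.ι R j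
      else 0

/-- The operators of infinitesimal braids with strands `some 0`, `some 1`, `some 2`, `none`: the pair
`none, some i` acts by left multiplication by `x_i`, the other pairs by derivations. -/
def braidOp : Option (Fin 3) → Option (Fin 3) → Module.End R (FreeAlgebra R (Fin 3))
  | none, none => 0
  | none, some i => LinearMap.mulLeft R (FreeAlgebra.ι R i)
  | some i, none => LinearMap.mulLeft R (FreeAlgebra.ι R i)
  | some i, some j => pairDer R i j

variable {R}

theorem isDer_pairDer (i j : Fin 3) : IsDer (pairDer R i j) := isDer_der _

theorem pairDer_ι (i j k : Fin 3) : pairDer R i j (FreeAlgebra.ι R k) =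
    (if k = i then FreeAlgebra.ι R i * FreeAlgebra.ι R j - FreeAlgebra.ι R j * FreeAlgebra.ι R i
      else 0) +
    if k = j then FreeAlgebra.ι R j * FreeAlgebra.ι R i - FreeAlgebra.ι R i * FreeAlgebra.ι R j
      else 0 := der_ι _ k

theorem pairDer_comm (i j : Fin 3) : pairDer R i j = pairDer R j i := by
  refine (isDer_pairDer i j).ext (isDer_pairDer j i) fun k => ?_
  rw [pairDer_ι, pairDer_ι, add_comm]

theorem IsDer.mul_mulLeft {A : Type*} [Ring A] [Algebra R A] {D : Module.End R A} (h : IsDer D)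
    (a : A) : D * LinearMap.mulLeft R a - LinearMap.mulLeft R a * D = LinearMap.mulLeft R (D a) := by
  ext b
  simp [h a b]

theorem pairDer_three {i j k : Fin 3} (hij : i ≠ j) (hik : i ≠ k) (hjk : j ≠ k) :
    pairDer R i j * (pairDer R i k + pairDer R j k) -
      (pairDer R i k + pairDer R j k) * pairDer R i j = 0 := by
  refine ((isDer_pairDer i j).bracket ((isDer_pairDer i k).add (isDer_pairDer j k))).ext
    isDer_zero fun l => ?_
  have hl : l = i ∨ l = j ∨ l = k := by
    revert i j k l; decide
  simp only [LinearMap.sub_apply, Module.End.mul_apply, LinearMap.add_apply, LinearMap.zero_apply]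
  rcases hl with rfl | rfl | rfl
  all_goals
    simp [pairDer_ι, hij, hik, hjk, hij.symm, hik.symm, hjk.symm, isDer_pairDer _ _ _ _]
    noncomm_ring

theorem mulLeft_mul_sub (a b : FreeAlgebra R (Fin 3)) :
    LinearMap.mulLeft R a * LinearMap.mulLeft R b - LinearMap.mulLeft R b * LinearMap.mulLeft R a =
      LinearMap.mulLeft R (a * b - b * a) := by
  ext c
  simp [sub_mul, mul_assoc]

/-- This is the decomposition of 𝔱₄ as a free Lie algebra on the t_{none,i} extended by 𝔱₃: the free
part acts by left multiplication, 𝔱₃ by derivations, and [D, L_a] = L_{D(a)} for a derivation D. -/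
theorem isBraidFamily_braidOp : IsBraidFamily (braidOp R) where
  symm i j := by
    cases i <;> cases j <;> simp only [braidOp, pairDer_comm]
  three i j k hij hik hjk := by
    rw [Ring.lie_def]
    rcases i with _ | i <;> rcases j with _ | j <;> rcases k with _ | k <;>
      simp only [ne_eq, not_true_eq_false, Option.some.injEq] at hij hik hjk <;>
      simp only [braidOp]
    · have h := (isDer_pairDer (R := R) j k).mul_mulLeft (FreeAlgebra.ι R j)
      have h' := mulLeft_mul_sub (FreeAlgebra.ι R j) (FreeAlgebra.ι R k)
      rw [pairDer_ι, if_pos rfl, if_neg hjk, add_zero, ← h'] at h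
      rw [mul_add, add_mul, ← neg_eq_zero, ← sub_eq_zero.2 h]
      abel
    · have h := (isDer_pairDer (R := R) i k).mul_mulLeft (FreeAlgebra.ι R i)
      have h' := mulLeft_mul_sub (FreeAlgebra.ι R i) (FreeAlgebra.ι R k)
      rw [pairDer_ι, if_pos rfl, if_neg hik, add_zero, ← h'] at h
      rw [mul_add, add_mul, ← neg_eq_zero, ← sub_eq_zero.2 h]
      abel
    · have h := (isDer_pairDer (R := R) i j).mul_mulLeft (FreeAlgebra.ι R i + FreeAlgebra.ι R j)
      have h0 : pairDer R i j (FreeAlgebra.ι R i + FreeAlgebra.ι R j) = 0 := by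
        rw [map_add, pairDer_ι, pairDer_ι, if_pos rfl, if_neg hij, if_neg (Ne.symm hij),
          if_pos rfl]
        abel
      have hm : LinearMap.mulLeft R (FreeAlgebra.ι R i + FreeAlgebra.ι R j) =
          LinearMap.mulLeft R (FreeAlgebra.ι R i) + LinearMap.mulLeft R (FreeAlgebra.ι R j) := by
        ext; simp [add_mul]
      rw [h0, hm] at h
      rw [h]
      ext; simp
    · exact pairDer_three hij hik hjk
  four i j k l hij hkl hik hil hjk hjl := by
    rw [Ring.lie_def]
    have key {a b c : Fin 3} (h1 : a ≠ b) (h2 : a ≠ c) :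
        pairDer R b c * LinearMap.mulLeft R (FreeAlgebra.ι R a) -
          LinearMap.mulLeft R (FreeAlgebra.ι R a) * pairDer R b c = 0 := by
      rw [(isDer_pairDer b c).mul_mulLeft, pairDer_ι, if_neg h1, if_neg h2, add_zero]
      ext; simp
    have key' {a b c : Fin 3} (h1 : a ≠ b) (h2 : a ≠ c) :
        LinearMap.mulLeft R (FreeAlgebra.ι R a) * pairDer R b c -
          pairDer R b c * LinearMap.mulLeft R (FreeAlgebra.ι R a) = 0 := by
      rw [← neg_eq_zero, neg_sub, key h1 h2]
    rcases i with _ | i <;> rcases j with _ | j <;> rcases k with _ | k <;> rcases l with _ | l <;>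
      simp only [ne_eq, not_true_eq_false, Option.some.injEq] at hij hkl hik hil hjk hjl <;>
      simp only [braidOp]
    · exact key' hjk hjl
    · exact key' hik hil
    · exact key (Ne.symm hil) (Ne.symm hjl)
    · exact key (Ne.symm hik) (Ne.symm hjk)
    -- Four distinct ordinary strands do not exist.
    · exfalso; omega

end BraidOp

/-! ### Nested brackets of sums -/

section NestedBracket

variable {S : Type*} [Ring S]

theorem nestedBracket_mem {L : AddSubgroup S} (hL : ∀ a ∈ L, ∀ b ∈ L, a * b - b * a ∈ L)
    (l : List S) (hl : ∀ a ∈ l, a ∈ L) : nestedBracket l ∈ L := by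
  induction l with
  | nil => exact L.zero_mem
  | cons a l ih =>
    cases l with
    | nil => exact hl a (by simp)
    | cons b l => exact hL _ (hl a (by simp)) _ (ih fun c hc => hl c (by simp [hc]))

theorem commute_nestedBracket {c : S} (l : List S) (hl : ∀ a ∈ l, Commute c a) :
    Commute c (nestedBracket l) := by
  have := nestedBracket_mem (L := (Subring.centralizer {c}).toAddSubgroup)
    (fun a ha b hb => Subring.sub_mem _ (Subring.mul_mem _ ha hb) (Subring.mul_mem _ hb ha)) l
    (fun a ha => Subring.mem_centralizer_iff.2 (by simpa using (hl a ha).eq))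
  exact Subring.mem_centralizer_iff.1 this c rfl

theorem forall_mem_map_vec {S : Type*} {P : S → Prop} {u v : S} (hu : P u) (hv : P v) (w : List (Fin 2)) :
    ∀ a ∈ w.map ![u, v], P a := by
  intro a ha
  obtain ⟨i, -, rfl⟩ := List.mem_map.1 ha
  fin_cases i
  exacts [hu, hv]

/-- An element commuting with both arguments is invisible in brackets of length at least two. The
correction `d` survives only for words of length one; its commutation with `c` is carried for the
induction. -/
theorem nestedBracket_add_central {u v c : S} (hu : Commute c u) (hv : Commute c v)
    (w : List (Fin 2)) : ∃ d, Commute d u ∧ Commute d v ∧ Commute d c ∧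
      nestedBracket (w.map ![u + c, v]) = nestedBracket (w.map ![u, v]) + d ∧
      (2 ≤ w.length → d = 0) := by
  induction w with
  | nil => exact ⟨0, by simp, by simp, by simp, by simp [nestedBracket], fun _ => rfl⟩
  | cons i w ih =>
    have hi : ∃ e, Commute e u ∧ Commute e v ∧ Commute e c ∧ ![u + c, v] i = ![u, v] i + e ∧
        (e = 0 ∨ e = c) := by
      fin_cases i
      · exact ⟨c, hu, hv, Commute.refl c, rfl, .inr rfl⟩
      · exact ⟨0, by simp, by simp, by simp, by simp, .inl rfl⟩
    obtain ⟨e, heu, hev, hec, hi, he⟩ := hi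
    cases w with
    | nil => exact ⟨e, heu, hev, hec, by simpa [nestedBracket] using hi, by simp⟩
    | cons k w =>
      obtain ⟨d, hdu, hdv, hdc, hd, -⟩ := ih
      refine ⟨0, by simp, by simp, by simp, ?_, fun _ => rfl⟩
      have h1 : Commute e (nestedBracket ((k :: w).map ![u, v])) :=
        commute_nestedBracket _ (forall_mem_map_vec heu hev _)
      have h2 : Commute d (![u, v] i) := by
        fin_cases i
        exacts [hdu, hdv]
      have h3 : Commute d e := by
        rcases he with rfl | rfl
        exacts [Commute.zero_right d, hdc]
      have hb (x y : S) (l : List (Fin 2)) :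
          nestedBracket ((i :: k :: l).map ![x, y]) = ![x, y] i * nestedBracket ((k :: l).map ![x, y]) -
            nestedBracket ((k :: l).map ![x, y]) * ![x, y] i := rfl
      rw [hb, hb, hd, hi, add_zero]
      simp only [add_mul, mul_add]
      rw [h1.eq, h2.eq, h3.eq]
      abel

end NestedBracket

/-! ### The leading pole -/

section Leading

variable {p : ℕ} [hp : Fact p.Prime] {Φ : NCSeries ℚ_[p]} {S S' : Type*} [Ring S]
  [Algebra (ZMod p) S] [Ring S'] [Algebra (ZMod p) S']

/-- The value at `(u, v)` of the reduction modulo `p` of the part of degree `p - 1` of `p Φ`. -/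
def leading (Φ : NCSeries ℚ_[p]) (u v : S) : S := homPart (topResidue Φ) (p - 1) u v

theorem map_leading (g : S →ₐ[ZMod p] S') (u v : S) : g (leading Φ u v) = leading Φ (g u) (g v) :=
  map_homPart g _ _ u v

theorem cast_p_sub_one : ((p - 1 : ℕ) : ZMod p) = -1 := by
  rw [Nat.cast_sub hp.out.one_lt.le]; simp

theorem leading_swap (hΦ : IsAssociator 1 Φ) (hb : HasSimplePoleBound p Φ) (u v : S) :
    leading Φ v u = -leading Φ u v := topResidue_inversion hΦ hb v u

theorem leading_eq_neg_bracketPart (hΦ : IsAssociator 1 Φ) (hb : HasSimplePoleBound p Φ) (u v : S) :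
    leading Φ u v = -bracketPart (topResidue Φ) (p - 1) u v := by
  rw [← topResidue_dynkin hΦ hb, cast_p_sub_one, neg_smul, one_smul, neg_neg, leading]

/-- A bracket of length at least two lies in every submodule which contains the brackets. -/
theorem leading_mem_of_bracket_mem (h2 : 2 < p) (hΦ : IsAssociator 1 Φ)
    (hb : HasSimplePoleBound p Φ) {L L' : Submodule (ZMod p) S} (hL' : L' ≤ L)
    (hL : ∀ a ∈ L, ∀ b ∈ L, a * b - b * a ∈ L') {u v : S} (hu : u ∈ L)
    (hv : v ∈ L) : leading Φ u v ∈ L' := by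
  rw [leading_eq_neg_bracketPart hΦ hb]
  refine L'.neg_mem <| L'.sum_mem fun w _ => L'.smul_mem _ ?_
  have hmem := forall_mem_map_vec (P := (· ∈ L)) hu hv (List.ofFn w)
  obtain ⟨a, b, l, hl⟩ : ∃ a b l, (List.ofFn w).map ![u, v] = a :: b :: l := by
    have : ((List.ofFn w).map ![u, v]).length = p - 1 := by simp
    match h : (List.ofFn w).map ![u, v] with
    | [] => rw [h] at this; simp at this; lia
    | [_] => rw [h] at this; simp at this; lia
    | a :: b :: l => exact ⟨a, b, l, rfl⟩
  rw [hl] at hmem ⊢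
  exact hL _ (hmem a (by simp)) _ (nestedBracket_mem (L := L.toAddSubgroup)
    (fun a ha b hb => hL' (hL a ha b hb)) (b :: l) fun c hc => hmem c (List.mem_cons_of_mem _ hc))

theorem leading_add_left (h2 : 2 < p) (hΦ : IsAssociator 1 Φ) (hb : HasSimplePoleBound p Φ)
    {u v c : S} (hu : Commute c u) (hv : Commute c v) : leading Φ (u + c) v = leading Φ u v := by
  rw [leading_eq_neg_bracketPart hΦ hb, leading_eq_neg_bracketPart hΦ hb]
  congr 1
  refine Finset.sum_congr rfl fun w _ => ?_
  obtain ⟨d, -, -, -, hd, hd0⟩ := nestedBracket_add_central hu hv (List.ofFn w)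
  rw [hd, hd0 (by rw [List.length_ofFn]; lia), add_zero]

theorem leading_add_right (h2 : 2 < p) (hΦ : IsAssociator 1 Φ) (hb : HasSimplePoleBound p Φ)
    {u v c : S} (hu : Commute c u) (hv : Commute c v) : leading Φ u (v + c) = leading Φ u v := by
  rw [leading_swap hΦ hb, leading_add_left h2 hΦ hb hv hu, ← leading_swap hΦ hb]

theorem commute_leading {c u v : S} (hu : Commute c u) (hv : Commute c v) :
    Commute c (leading Φ u v) := by
  refine Commute.sum_right _ _ _ fun w _ => Commute.smul_right ?_ _
  exact Commute.list_prod_right _ _ (forall_mem_map_vec hu hv _)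

/-- Each argument is central for the other and can be removed, leaving φ(0, 0) = 0. -/
theorem leading_eq_zero (h2 : 2 < p) (hΦ : IsAssociator 1 Φ) (hb : HasSimplePoleBound p Φ)
    {u v : S} (h : Commute u v) : leading Φ u v = 0 := by
  have h1 := leading_add_left h2 hΦ hb (Commute.zero_right u) h
  have h3 := leading_add_right h2 hΦ hb (Commute.zero_right v) (Commute.zero_right v)
  have h4 : leading Φ (0 : S) 0 = 0 := by
    have := homPart_smul_smul (topResidue Φ) (p - 1) (0 : ZMod p) (0 : S) 0
    rwa [smul_zero, zero_pow (by lia), zero_smul] at this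
  rw [zero_add] at h1 h3
  rw [h1, h3, h4]

theorem leading_hexagon (h2 : 2 < p) (hΦ : IsAssociator 1 Φ) (hb : HasSimplePoleBound p Φ)
    {u v w : S} (h : u + v + w = 0) : leading Φ u v + leading Φ v w + leading Φ w u = 0 := by
  have := topResidue_hexagon h2 hΦ hb h
  rw [← this, leading, leading, leading]
  abel

/-- The component along `u` of the derivation attached to the leading pole. -/
def leadA (Φ : NCSeries ℚ_[p]) (u v : S) : S := leading Φ (-u - v) u

/-- The component along `v` of the derivation attached to the leading pole. -/
def leadB (Φ : NCSeries ℚ_[p]) (u v : S) : S := leading Φ (-u - v) v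

theorem leading_neg_sum (hΦ : IsAssociator 1 Φ) (hb : HasSimplePoleBound p Φ) (u v : S) :
    leading Φ u (-u - v) = -leadA Φ u v := leading_swap hΦ hb _ _

theorem leading_eq_leadB_sub (h2 : 2 < p) (hΦ : IsAssociator 1 Φ) (hb : HasSimplePoleBound p Φ)
    (u v : S) : leading Φ u v = leadB Φ u v - leadA Φ u v := by
  have h := leading_hexagon h2 hΦ hb (show u + v + (-u - v) = 0 by abel)
  rw [leading_swap hΦ hb (-u - v) v] at h
  rw [leadA, leadB, ← sub_eq_zero, ← h]
  abel

theorem map_leadA (g : S →ₐ[ZMod p] S') (u v : S) : g (leadA Φ u v) = leadA Φ (g u) (g v) := by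
  simp [leadA, map_leading]

theorem map_leadB (g : S →ₐ[ZMod p] S') (u v : S) : g (leadB Φ u v) = leadB Φ (g u) (g v) := by
  simp [leadB, map_leading]

end Leading

/-! ### The pentagon equation for the operators of infinitesimal braids -/

section Pentagon

/-- Operators over different rings are compared through a semilinear map between the modules on
which they act, so that reduction modulo `p` needs no map between endomorphism rings. -/
theorem homPart_intertwine {R R' A A' : Type*} [CommRing R] [CommRing R'] [AddCommGroup A]
    [Module R A] [AddCommGroup A'] [Module R' A'] (c : R → R') (r : A →+ A')
    (hr : ∀ x a, r (x • a) = c x • r a) {f : NCSeries R} {f' : NCSeries R'}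
    (hf : ∀ w, f' w = c (f w)) {U V : Module.End R A} {U' V' : Module.End R' A'}
    (hU : ∀ a, r (U a) = U' (r a)) (hV : ∀ a, r (V a) = V' (r a)) (n : ℕ) (a : A) :
    r (homPart f n U V a) = homPart f' n U' V' (r a) := by
  have key (w : List (Fin 2)) : ∀ a, r ((w.map ![U, V]).prod a) = (w.map ![U', V']).prod (r a) := by
    induction w with
    | nil => simp
    | cons i w ih =>
      intro a
      simp only [List.map_cons, List.prod_cons, Module.End.mul_apply]
      rw [← ih]
      fin_cases i
      exacts [hU _, hV _]
  simp only [homPart, LinearMap.sum_apply, LinearMap.smul_apply, map_sum, hr, key, hf]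

variable {p : ℕ} [hp : Fact p.Prime] {Φ : NCSeries ℚ_[p]}

instance : Module.IsTorsionFree ℤ_[p] (Module.End ℤ_[p] (FreeAlgebra ℤ_[p] (Fin 3))) where
  isSMulRegular r hr f g h := by
    ext a
    have := congrArg (fun f : Module.End ℤ_[p] (FreeAlgebra ℤ_[p] (Fin 3)) => f a) h
    exact Module.IsTorsionFree.isSMulRegular hr this

theorem braidOp_residue (r : FreeAlgebra ℤ_[p] (Fin 3) →+* FreeAlgebra (ZMod p) (Fin 3))
    (hr : ∀ i, r (FreeAlgebra.ι ℤ_[p] i) = FreeAlgebra.ι (ZMod p) i)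
    (hr' : ∀ (c : ℤ_[p]) s, r (c • s) = PadicInt.toZMod c • r s) (i j : Option (Fin 3))
    (a : FreeAlgebra ℤ_[p] (Fin 3)) : r (braidOp ℤ_[p] i j a) = braidOp (ZMod p) i j (r a) := by
  rcases i with _ | i <;> rcases j with _ | j <;> simp only [braidOp]
  · simp
  · simp [hr]
  · simp [hr]
  · induction a using FreeAlgebra.induction with
    | grade0 c =>
      rw [Algebra.algebraMap_eq_smul_one, map_smul, (isDer_pairDer i j).map_one, smul_zero, hr',
        map_one, map_smul, (isDer_pairDer i j).map_one, smul_zero, map_zero]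
    | grade1 k =>
      rw [hr, pairDer_ι, pairDer_ι, map_add]
      split_ifs <;> simp [hr]
    | mul a b ha hb => rw [isDer_pairDer, map_add, map_mul, map_mul, ha, hb, map_mul, isDer_pairDer]
    | add a b ha hb => simp only [map_add, ha, hb]

theorem leading_pentagon (hΦ : IsAssociator 1 Φ) (hb : HasSimplePoleBound p Φ)
    {e : Fin 4 → Option (Fin 3)} (he : Function.Injective e)
    {T : Fin 4 → Fin 4 → Module.End (ZMod p) (FreeAlgebra (ZMod p) (Fin 3))}
    (hT : ∀ i j, T i j = braidOp (ZMod p) (e i) (e j)) :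
    leading Φ (T 0 1) (T 1 2 + T 1 3) + leading Φ (T 0 2 + T 1 2) (T 2 3) =
      leading Φ (T 1 2) (T 2 3) + leading Φ (T 0 1 + T 0 2) (T 1 3 + T 2 3) +
        leading Φ (T 0 1) (T 1 2) := by
  obtain ⟨r, hr, hr'⟩ := exists_residueHom (p := p) (FreeAlgebra.ι (ZMod p) (X := Fin 3))
  obtain ⟨b, hb⟩ := topLift_pentagon hΦ hb ((isBraidFamily_braidOp (R := ℤ_[p])).comp he)
  have hop (i j : Fin 4) (a : FreeAlgebra ℤ_[p] (Fin 3)) :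
      r (braidOp ℤ_[p] (e i) (e j) a) = T i j (r a) := by
    rw [hT, braidOp_residue r hr hr']
  have hop2 (i j k l : Fin 4) (a : FreeAlgebra ℤ_[p] (Fin 3)) :
      r ((braidOp ℤ_[p] (e i) (e j) + braidOp ℤ_[p] (e k) (e l)) a) = (T i j + T k l) (r a) := by
    rw [LinearMap.add_apply, map_add, hop, hop, LinearMap.add_apply]
  have hpart {U V : Module.End ℤ_[p] (FreeAlgebra ℤ_[p] (Fin 3))}
      {U' V' : Module.End (ZMod p) (FreeAlgebra (ZMod p) (Fin 3))}
      (hU : ∀ a, r (U a) = U' (r a)) (hV : ∀ a, r (V a) = V' (r a)) (a) :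
      r (homPart (topLift Φ) (p - 1) U V a) = leading Φ U' V' (r a) :=
    homPart_intertwine (f := topLift Φ) (f' := topResidue Φ) PadicInt.toZMod r.toAddMonoidHom hr'
      (fun _ => (toZMod_integralLift _).symm) hU hV (p - 1) a
  have hsurj : Function.Surjective r := by
    intro y
    induction y using FreeAlgebra.induction with
    | grade0 c =>
      refine ⟨(c.val : ℤ_[p]) • 1, ?_⟩
      rw [hr', map_natCast, ZMod.natCast_zmod_val, map_one, Algebra.algebraMap_eq_smul_one]
    | grade1 i => exact ⟨_, hr i⟩
    | mul a b ha hb =>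
      obtain ⟨a, rfl⟩ := ha
      obtain ⟨b, rfl⟩ := hb
      exact ⟨a * b, map_mul _ _ _⟩
    | add a b ha hb =>
      obtain ⟨a, rfl⟩ := ha
      obtain ⟨b, rfl⟩ := hb
      exact ⟨a + b, map_add _ _ _⟩
  refine LinearMap.ext fun y => ?_
  obtain ⟨a, rfl⟩ := hsurj y
  have h := congrArg (fun f : Module.End ℤ_[p] (FreeAlgebra ℤ_[p] (Fin 3)) => r (f a)) hb
  simp only [LinearMap.sub_apply, LinearMap.add_apply, LinearMap.smul_apply, map_sub, hr',
    toZMod_p, zero_smul] at h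
  rw [map_add, map_add, map_add, hpart (hop 0 1) (hop2 1 2 1 3), hpart (hop2 0 2 1 2) (hop 2 3),
    hpart (hop 1 2) (hop 2 3), hpart (hop2 0 1 0 2) (hop2 1 3 2 3), hpart (hop 0 1) (hop 1 2)] at h
  exact sub_eq_zero.1 h

end Pentagon

/-! ### The derivation attached to the leading pole -/

section Theta

variable {p : ℕ} [hp : Fact p.Prime] {Φ : NCSeries ℚ_[p]}

local notation "𝔸" => FreeAlgebra (ZMod p) (Fin 3)
local notation "𝓛" => Algebra.lmul (ZMod p) (FreeAlgebra (ZMod p) (Fin 3))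
local notation "X₀" => FreeAlgebra.ι (ZMod p) (0 : Fin 3)
local notation "X₁" => FreeAlgebra.ι (ZMod p) (1 : Fin 3)
local notation "X₂" => FreeAlgebra.ι (ZMod p) (2 : Fin 3)
local notation "𝓓" => pairDer (ZMod p)

variable {D : Module.End (ZMod p) (FreeAlgebra (ZMod p) (Fin 3))}

theorem lmul_apply_apply {R A : Type*} [CommRing R] [Ring A] [Algebra R A] (a b : A) :
    Algebra.lmul R A a b = a * b := rfl

/-- For a derivation, [L_a + D, L_b] = L_{[a,b] + D(b)}. -/
theorem commute_lmul_add_der (hD : IsDer D) {a b : FreeAlgebra (ZMod p) (Fin 3)}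
    (h : a * b - b * a + D b = 0) : Commute (𝓛 a + D) (𝓛 b) := by
  refine LinearMap.ext fun c => ?_
  have h1 : D b = b * a - a * b := by
    rw [← sub_eq_zero, ← h]; abel
  simp only [Module.End.mul_apply, LinearMap.add_apply, lmul_apply_apply, hD b c, h1]
  noncomm_ring

/-- On `a` the derivation D acts like the inner derivation of `-s`. Hence D = L_{-s} + (L_s + D),
where the second summand commutes with L_a and L_{-s} and can be dropped, which turns a mixed term
of the pentagon into a left multiplication. -/
theorem leading_lmul_der (h2 : 2 < p) (hΦ : IsAssociator 1 Φ) (hb : HasSimplePoleBound p Φ)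
    (hD : IsDer D) {a s : FreeAlgebra (ZMod p) (Fin 3)} (h : s * a - a * s + D a = 0)
    (hs : D s = 0) : leading Φ (𝓛 a) D = 𝓛 (leading Φ a (-s)) := by
  have h1 := commute_lmul_add_der hD h
  have h3 : Commute (𝓛 s + D) (𝓛 (-s)) := commute_lmul_add_der hD (by simp [hs])
  have h4 : D = 𝓛 (-s) + (𝓛 s + D) := by rw [map_neg]; abel
  rw [map_leading]
  conv_lhs => rw [h4]
  exact leading_add_right h2 hΦ hb h1 h3

theorem leading_der_lmul (h2 : 2 < p) (hΦ : IsAssociator 1 Φ) (hb : HasSimplePoleBound p Φ)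
    (hD : IsDer D) {a s : FreeAlgebra (ZMod p) (Fin 3)} (h : s * a - a * s + D a = 0)
    (hs : D s = 0) : leading Φ D (𝓛 a) = 𝓛 (leading Φ (-s) a) := by
  rw [leading_swap hΦ hb, leading_lmul_der h2 hΦ hb hD h hs, leading_swap hΦ hb a, map_neg]

theorem isDer_leading (h2 : 2 < p) (hΦ : IsAssociator 1 Φ) (hb : HasSimplePoleBound p Φ)
    {D' : Module.End (ZMod p) (FreeAlgebra (ZMod p) (Fin 3))} (hD : IsDer D) (hD' : IsDer D') :
    IsDer (leading Φ D D') :=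
  leading_mem_of_bracket_mem h2 hΦ hb
    (L := derivations (ZMod p) (FreeAlgebra (ZMod p) (Fin 3))) le_rfl
    (fun _ h _ h' => IsDer.bracket h h') hD hD'

/-- Compare [D, L_a] = L_{D(a)} with [L_v + Q, L_a] = L_{[v,a]} and evaluate at 1. It extracts the
value of a derivation on a letter from an operator identity in which one term remains unknown. -/
theorem IsDer.apply_of_commute (hD : IsDer D) {Q : Module.End (ZMod p) 𝔸} {v a : 𝔸}
    (h : D = 𝓛 v + Q) (hQ : Commute Q (𝓛 a)) : D a = v * a - a * v := by
  have h1 : D * 𝓛 a - 𝓛 a * D = 𝓛 (D a) := hD.mul_mulLeft a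
  have h3 : 𝓛 (D a) = 𝓛 (v * a - a * v) := by
    rw [← h1, h, add_mul, mul_add, hQ.eq, map_sub, map_mul, map_mul]
    abel
  simpa using congrArg (fun f : Module.End (ZMod p) 𝔸 => f 1) h3

theorem pentagon_none_first (h2 : 2 < p) (hΦ : IsAssociator 1 Φ) (hb : HasSimplePoleBound p Φ) :
    𝓛 (leading Φ X₀ (-(X₀ + X₁ + X₂))) + leading Φ (𝓛 X₁ + 𝓓 0 1) (𝓓 1 2) =
      leading Φ (𝓓 0 1) (𝓓 1 2) + 𝓛 (leading Φ (X₀ + X₁) (-(X₀ + X₁ + X₂))) +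
        𝓛 (leading Φ X₀ (-(X₀ + X₁))) := by
  have h := leading_pentagon hΦ hb (e := ![none, some 0, some 1, some 2]) (by decide)
    (fun _ _ => rfl)
  have e1 : leading Φ (𝓛 X₀) (𝓓 0 1 + 𝓓 0 2) = 𝓛 (leading Φ X₀ (-(X₀ + X₁ + X₂))) := by
    refine leading_lmul_der h2 hΦ hb ((isDer_pairDer _ _).add (isDer_pairDer _ _)) ?_ ?_
    · simp [pairDer_ι]; noncomm_ring
    · simp [pairDer_ι]
  have e2 : leading Φ (𝓛 (X₀ + X₁)) (𝓓 0 2 + 𝓓 1 2) =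
      𝓛 (leading Φ (X₀ + X₁) (-(X₀ + X₁ + X₂))) := by
    refine leading_lmul_der h2 hΦ hb ((isDer_pairDer _ _).add (isDer_pairDer _ _)) ?_ ?_
    · simp [pairDer_ι]; noncomm_ring
    · simp [pairDer_ι]
  have e3 : leading Φ (𝓛 X₀) (𝓓 0 1) = 𝓛 (leading Φ X₀ (-(X₀ + X₁))) := by
    refine leading_lmul_der h2 hΦ hb (isDer_pairDer _ _) ?_ ?_
    · simp [pairDer_ι]; noncomm_ring
    · simp [pairDer_ι]
  rw [← e1, ← e2, ← e3, map_add]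
  exact h

/-- With the special strand first, the only mixed term left in the pentagon commutes with L_{X₀}:
both X₁ + D₀₁ and D₁₂ do. The element `v` is the X₀-component of the coboundary of (A, B). -/
theorem leading_der_apply_zero (h2 : 2 < p) (hΦ : IsAssociator 1 Φ) (hb : HasSimplePoleBound p Φ)
    {v : FreeAlgebra (ZMod p) (Fin 3)}
    (hv : v = leadA Φ (X₀ + X₁) X₂ + leadA Φ X₀ X₁ - leadA Φ X₀ (X₁ + X₂)) :
    leading Φ (𝓓 0 1) (𝓓 1 2) X₀ = v * X₀ - X₀ * v := by
  have h := pentagon_none_first h2 hΦ hb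
  refine (isDer_leading h2 hΦ hb (isDer_pairDer 0 1) (isDer_pairDer 1 2)).apply_of_commute
    (Q := leading Φ (𝓛 X₁ + 𝓓 0 1) (𝓓 1 2)) ?_ (Commute.symm (commute_leading ?_ ?_))
  · rw [show -(X₀ + X₁ + X₂) = -X₀ - (X₁ + X₂) by abel, leading_neg_sum hΦ hb,
      show -X₀ - (X₁ + X₂) = -(X₀ + X₁) - X₂ by abel, leading_neg_sum hΦ hb,
      show -(X₀ + X₁) = -X₀ - X₁ by abel, leading_neg_sum hΦ hb] at h
    rw [hv, eq_comm, ← sub_eq_zero, ← sub_eq_zero.2 h]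
    simp only [map_add, map_sub, map_neg]
    abel
  · refine Commute.symm (commute_lmul_add_der (isDer_pairDer _ _) ?_)
    simp [pairDer_ι]
  · rw [show 𝓓 1 2 = 𝓛 0 + 𝓓 1 2 by simp]
    refine Commute.symm (commute_lmul_add_der (isDer_pairDer _ _) ?_)
    simp [pairDer_ι]

/-- Here two pentagons are needed. Subtracting the one with the special strand second eliminates
φ(L_{X₁} + D₀₁, D₁₂) and leaves φ(L_{X₀} + D₀₁, L_{X₂} + D₁₂), which commutes with L_{X₁}. -/
theorem leading_der_apply_one (h2 : 2 < p) (hΦ : IsAssociator 1 Φ) (hb : HasSimplePoleBound p Φ)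
    {v : FreeAlgebra (ZMod p) (Fin 3)}
    (hv : v = leadA Φ (X₀ + X₁) X₂ - leadA Φ X₁ X₂ + leadB Φ X₀ X₁ - leadB Φ X₀ (X₁ + X₂)) :
    leading Φ (𝓓 0 1) (𝓓 1 2) X₁ = v * X₁ - X₁ * v := by
  have h := pentagon_none_first h2 hΦ hb
  have h' := leading_pentagon hΦ hb (e := ![some 0, none, some 1, some 2]) (by decide)
    (fun _ _ => rfl)
  have h' : leading Φ (𝓛 X₀) (𝓛 X₁ + 𝓛 X₂) + leading Φ (𝓓 0 1 + 𝓛 X₁) (𝓓 1 2) =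
      leading Φ (𝓛 X₁) (𝓓 1 2) + leading Φ (𝓛 X₀ + 𝓓 0 1) (𝓛 X₂ + 𝓓 1 2) +
        leading Φ (𝓛 X₀) (𝓛 X₁) := h'
  have e1 : leading Φ (𝓛 X₁) (𝓓 1 2) = 𝓛 (leading Φ X₁ (-(X₁ + X₂))) := by
    refine leading_lmul_der h2 hΦ hb (isDer_pairDer _ _) ?_ ?_
    · simp [pairDer_ι]; noncomm_ring
    · simp [pairDer_ι]
  rw [e1, ← map_add 𝓛 X₁, ← map_leading, ← map_leading, add_comm (𝓓 0 1)] at h'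
  refine (isDer_leading h2 hΦ hb (isDer_pairDer 0 1) (isDer_pairDer 1 2)).apply_of_commute
    (Q := leading Φ (𝓛 X₀ + 𝓓 0 1) (𝓛 X₂ + 𝓓 1 2)) ?_ (Commute.symm (commute_leading ?_ ?_))
  · rw [show -(X₀ + X₁ + X₂) = -X₀ - (X₁ + X₂) by abel, leading_neg_sum hΦ hb,
      show -X₀ - (X₁ + X₂) = -(X₀ + X₁) - X₂ by abel, leading_neg_sum hΦ hb,
      show -(X₀ + X₁) = -X₀ - X₁ by abel, leading_neg_sum hΦ hb] at h
    rw [show -(X₁ + X₂) = -X₁ - X₂ by abel, leading_neg_sum hΦ hb,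
      leading_eq_leadB_sub h2 hΦ hb X₀, leading_eq_leadB_sub h2 hΦ hb X₀] at h'
    rw [hv]
    linear_combination (norm := (simp only [map_add, map_sub, map_neg]; abel)) h' - h
  · refine Commute.symm (commute_lmul_add_der (isDer_pairDer _ _) ?_)
    simp [pairDer_ι]
  · refine Commute.symm (commute_lmul_add_der (isDer_pairDer _ _) ?_)
    simp [pairDer_ι]

/-- With the special strand last, the remaining mixed term is φ(D₀₁, D₁₂ + L_{X₁}), which commutes
with L_{X₂}. -/
theorem leading_der_apply_two (h2 : 2 < p) (hΦ : IsAssociator 1 Φ) (hb : HasSimplePoleBound p Φ)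
    {v : FreeAlgebra (ZMod p) (Fin 3)}
    (hv : v = leadB Φ (X₀ + X₁) X₂ - leadB Φ X₁ X₂ - leadB Φ X₀ (X₁ + X₂)) :
    leading Φ (𝓓 0 1) (𝓓 1 2) X₂ = v * X₂ - X₂ * v := by
  have h := leading_pentagon hΦ hb (e := ![some 0, some 1, some 2, none]) (by decide)
    (fun _ _ => rfl)
  have h : leading Φ (𝓓 0 1) (𝓓 1 2 + 𝓛 X₁) + leading Φ (𝓓 0 2 + 𝓓 1 2) (𝓛 X₂) =
      leading Φ (𝓓 1 2) (𝓛 X₂) + leading Φ (𝓓 0 1 + 𝓓 0 2) (𝓛 X₁ + 𝓛 X₂) +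
        leading Φ (𝓓 0 1) (𝓓 1 2) := h
  have e1 : leading Φ (𝓓 0 2 + 𝓓 1 2) (𝓛 X₂) = 𝓛 (leading Φ (-(X₀ + X₁ + X₂)) X₂) := by
    refine leading_der_lmul h2 hΦ hb ((isDer_pairDer _ _).add (isDer_pairDer _ _)) ?_ ?_
    · simp [pairDer_ι]; noncomm_ring
    · simp [pairDer_ι]
  have e2 : leading Φ (𝓓 1 2) (𝓛 X₂) = 𝓛 (leading Φ (-(X₁ + X₂)) X₂) := by
    refine leading_der_lmul h2 hΦ hb (isDer_pairDer _ _) ?_ ?_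
    · simp [pairDer_ι]; noncomm_ring
    · simp [pairDer_ι]
  have e3 : leading Φ (𝓓 0 1 + 𝓓 0 2) (𝓛 (X₁ + X₂)) =
      𝓛 (leading Φ (-(X₀ + X₁ + X₂)) (X₁ + X₂)) := by
    refine leading_der_lmul h2 hΦ hb ((isDer_pairDer _ _).add (isDer_pairDer _ _)) ?_ ?_
    · simp [pairDer_ι]; noncomm_ring
    · simp [pairDer_ι]
  rw [← map_add 𝓛 X₁, e1, e2, e3] at h
  refine (isDer_leading h2 hΦ hb (isDer_pairDer 0 1) (isDer_pairDer 1 2)).apply_of_commute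
    (Q := leading Φ (𝓓 0 1) (𝓓 1 2 + 𝓛 X₁)) ?_ (Commute.symm (commute_leading ?_ ?_))
  · rw [hv, leadB, leadB, leadB, show -(X₀ + X₁) - X₂ = -(X₀ + X₁ + X₂) by abel,
      show -X₁ - X₂ = -(X₁ + X₂) by abel, show -X₀ - (X₁ + X₂) = -(X₀ + X₁ + X₂) by abel,
      eq_comm, ← sub_eq_zero, ← sub_eq_zero.2 h]
    simp only [map_sub]
    abel
  · rw [show 𝓓 0 1 = 𝓛 0 + 𝓓 0 1 by simp]
    refine Commute.symm (commute_lmul_add_der (isDer_pairDer _ _) ?_)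
    simp [pairDer_ι]
  · rw [add_comm]
    refine Commute.symm (commute_lmul_add_der (isDer_pairDer _ _) ?_)
    simp [pairDer_ι]

end Theta

/-! ### The divergence of derivations -/

section Fox

variable {k : Type*} [CommRing k]

variable (k) in
/-- The span of the commutators of an algebra. -/
def commutatorSpan (A : Type*) [Ring A] [Algebra k A] : Submodule k A :=
  Submodule.span k {c | ∃ u v, c = u * v - v * u}

section

variable {A : Type*} [Ring A] [Algebra k A]

theorem sub_mem_commutatorSpan (u v : A) : u * v - v * u ∈ commutatorSpan k A :=
  Submodule.subset_span ⟨u, v, rfl⟩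

theorem commutatorSpan_le_iff {L : Submodule k A} :
    commutatorSpan k A ≤ L ↔ ∀ u v, u * v - v * u ∈ L := by
  refine ⟨fun h u v => h (sub_mem_commutatorSpan u v), fun h => Submodule.span_le.2 ?_⟩
  rintro _ ⟨u, v, rfl⟩
  exact h u v

theorem IsDer.map_commutatorSpan {D : Module.End k A} (h : IsDer D) {a : A}
    (ha : a ∈ commutatorSpan k A) : D a ∈ commutatorSpan k A := by
  refine (commutatorSpan_le_iff (L := (commutatorSpan k A).comap D)).2 (fun u v => ?_) ha
  rw [Submodule.mem_comap, map_sub, h, h]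
  have : D u * v + u * D v - (D v * u + v * D u) =
      (D u * v - v * D u) + (u * D v - D v * u) := by abel
  rw [this]
  exact add_mem (sub_mem_commutatorSpan _ _) (sub_mem_commutatorSpan _ _)

theorem map_mem_commutatorSpan {B : Type*} [Ring B] [Algebra k B] (g : A →ₐ[k] B) {a : A}
    (ha : a ∈ commutatorSpan k A) : g a ∈ commutatorSpan k B := by
  refine (commutatorSpan_le_iff (L := (commutatorSpan k B).comap g.toLinearMap)).2
    (fun u v => ?_) ha
  simpa using sub_mem_commutatorSpan (k := k) (g u) (g v)

theorem map_eq_zero_of_mem_commutatorSpan {B : Type*} [CommRing B] [Algebra k B] (g : A →ₐ[k] B)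
    {a : A} (ha : a ∈ commutatorSpan k A) : g a = 0 :=
  (commutatorSpan_le_iff (L := LinearMap.ker g.toLinearMap)).2
    (fun u v => by simp [mul_comm]) ha

end

variable {X : Type*}

local notation "ε" => FreeAlgebra.algebraMapInv

theorem algebraMapInv_ι (i : X) : ε (FreeAlgebra.ι k i) = (0 : k) := by
  simp [FreeAlgebra.algebraMapInv]

variable [DecidableEq X]

/-- The algebra morphism `a ↦ [[a, ∂_i a], [0, a₀]]`. -/
def foxAux (i : X) :
    FreeAlgebra k X →ₐ[k] Matrix (Fin 2) (Fin 2) (FreeAlgebra k X) :=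
  FreeAlgebra.lift k fun j => !![FreeAlgebra.ι k j, if i = j then 1 else 0; 0, 0]

/-- The left Fox derivatives `∂_i`, with `a = a₀ + ∑ᵢ (∂_i a) x_i`. -/
def fox (i : X) : FreeAlgebra k X →ₗ[k] FreeAlgebra k X where
  toFun a := foxAux i a 0 1
  map_add' a b := by simp
  map_smul' c a := by simp

theorem foxAux_entries (i : X) (a : FreeAlgebra k X) :
    foxAux i a 0 0 = a ∧ foxAux i a 1 0 = 0 ∧ foxAux i a 1 1 = algebraMap k _ (ε a) := by
  induction a using FreeAlgebra.induction with
  | grade0 r => simp [Matrix.algebraMap_matrix_apply]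
  | grade1 j => simp [foxAux, FreeAlgebra.algebraMapInv]
  | mul a b ha hb =>
    obtain ⟨h1, h2, h3⟩ := ha
    obtain ⟨g1, g2, g3⟩ := hb
    simp [Matrix.mul_apply, h1, h2, h3, g1, g2, g3]
  | add a b ha hb =>
    obtain ⟨h1, h2, h3⟩ := ha
    obtain ⟨g1, g2, g3⟩ := hb
    simp [h1, h2, h3, g1, g2, g3]

theorem fox_mul (i : X) (a b : FreeAlgebra k X) :
    fox i (a * b) = a * fox i b + fox i a * algebraMap k _ (ε b) := by
  simp [fox, Matrix.mul_apply, (foxAux_entries i a).1, (foxAux_entries i b).2.2]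

theorem fox_algebraMap (i : X) (r : k) : fox i (algebraMap k (FreeAlgebra k X) r) = 0 := by
  simp [fox, Matrix.algebraMap_matrix_apply]

theorem fox_ι (i j : X) : fox i (FreeAlgebra.ι k j) = if i = j then 1 else 0 := by
  simp [fox, foxAux]

theorem fox_mul_of_const_eq_zero (i : X) (a : FreeAlgebra k X) {b : FreeAlgebra k X}
    (hb : ε b = (0 : k)) : fox i (a * b) = a * fox i b := by
  rw [fox_mul, hb, map_zero, mul_zero, add_zero]

variable [Fintype X]

theorem eq_const_add_fox (a : FreeAlgebra k X) :
    a = algebraMap k _ (ε a) + ∑ i, fox i a * FreeAlgebra.ι k i := by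
  induction a using FreeAlgebra.induction with
  | grade0 r => simp [fox_algebraMap]
  | grade1 j => simp [fox_ι, algebraMapInv_ι]
  | mul a b ha hb =>
    have hab : a * algebraMap k _ (ε b) = algebraMap k _ (ε a) * algebraMap k _ (ε b) +
        ∑ i, fox i a * algebraMap k _ (ε b) * FreeAlgebra.ι k i := by
      conv_lhs => rw [ha]
      rw [add_mul, Finset.sum_mul]
      congr 1
      refine Finset.sum_congr rfl fun i _ => ?_
      rw [mul_assoc, ← Algebra.commutes, mul_assoc]
    conv_lhs => rw [hb]
    rw [mul_add, hab, map_mul, map_mul, Finset.mul_sum, add_assoc, ← Finset.sum_add_distrib]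
    congr 1
    refine Finset.sum_congr rfl fun i _ => ?_
    rw [fox_mul, add_mul, mul_assoc a, add_comm]
  | add a b ha hb =>
    conv_lhs => rw [ha, hb]
    simp only [map_add, add_mul, Finset.sum_add_distrib]
    abel

/-- The divergence of a derivation, the trace of its Jacobian matrix. -/
def divergence : Module.End k (FreeAlgebra k X) →ₗ[k] FreeAlgebra k X where
  toFun D := ∑ i, fox i (D (FreeAlgebra.ι k i))
  map_add' D D' := by simp [Finset.sum_add_distrib]
  map_smul' c D := by simp [Finset.smul_sum]

theorem divergence_apply (D : Module.End k (FreeAlgebra k X)) :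
    divergence D = ∑ i, fox i (D (FreeAlgebra.ι k i)) := rfl

/-- The Leibniz rule applied to ∑ (∂_j D'(x_i)) x_j. The second sum is a product of Jacobian
matrices, whose trace is symmetric up to commutators; this is what makes the divergence a cocycle.
-/
theorem IsDer.fox_comp {D D' : Module.End k (FreeAlgebra k X)} (h : IsDer D)
    (hc : ∀ i, ε (D (FreeAlgebra.ι k i)) = (0 : k)) (hc' : ∀ i, ε (D' (FreeAlgebra.ι k i)) = (0 : k))
    (i : X) : fox i (D (D' (FreeAlgebra.ι k i))) = D (fox i (D' (FreeAlgebra.ι k i))) +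
      ∑ j, fox j (D' (FreeAlgebra.ι k i)) * fox i (D (FreeAlgebra.ι k j)) := by
  conv_lhs => rw [eq_const_add_fox (D' (FreeAlgebra.ι k i)), hc', map_zero, zero_add]
  simp only [map_sum, h _ _, map_add, Finset.sum_add_distrib]
  congr 1
  · simp [fox_mul_of_const_eq_zero _ _ (algebraMapInv_ι _), fox_ι]
  · simp only [fox_mul_of_const_eq_zero _ _ (hc _)]

/-- The divergence is a 1-cocycle, up to commutators. -/
theorem divergence_bracket {D D' : Module.End k (FreeAlgebra k X)} (h : IsDer D) (h' : IsDer D')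
    (hc : ∀ i, ε (D (FreeAlgebra.ι k i)) = (0 : k))
    (hc' : ∀ i, ε (D' (FreeAlgebra.ι k i)) = (0 : k)) :
    divergence (D * D' - D' * D) - (D (divergence D') - D' (divergence D)) ∈
      commutatorSpan k (FreeAlgebra k X) := by
  have h1 : divergence (D * D' - D' * D) - (D (divergence D') - D' (divergence D)) =
      ∑ i, ∑ j, (fox j (D' (FreeAlgebra.ι k i)) * fox i (D (FreeAlgebra.ι k j)) -
        fox i (D (FreeAlgebra.ι k j)) * fox j (D' (FreeAlgebra.ι k i))) := by
    have h2 : ∑ i, ∑ j, fox i (D (FreeAlgebra.ι k j)) * fox j (D' (FreeAlgebra.ι k i)) =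
        ∑ i, ∑ j, fox j (D (FreeAlgebra.ι k i)) * fox i (D' (FreeAlgebra.ι k j)) :=
      Finset.sum_comm
    simp only [divergence_apply, Module.End.mul_apply, map_sub,
      h.fox_comp hc hc', h'.fox_comp hc' hc, Finset.sum_sub_distrib, Finset.sum_add_distrib,
      map_sum, h2]
    abel
  rw [h1]
  exact sum_mem fun i _ => sum_mem fun j _ => sub_mem_commutatorSpan _ _

variable (k X) in
/-- The derivations which map letters to sums of commutators and whose divergence is linear up to
commutators. -/
def linearDivergence : Submodule k (Module.End k (FreeAlgebra k X)) :=
  derivations k (FreeAlgebra k X) ⊓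
    (⨅ i, (commutatorSpan k (FreeAlgebra k X)).comap (LinearMap.applyₗ (FreeAlgebra.ι k i))) ⊓
    (commutatorSpan k _ ⊔ Submodule.span k (Set.range (FreeAlgebra.ι k))).comap divergence

variable (k X) in
/-- The derivations as in `linearDivergence` of divergence zero up to commutators. -/
def zeroDivergence : Submodule k (Module.End k (FreeAlgebra k X)) :=
  linearDivergence k X ⊓ (commutatorSpan k _).comap divergence

theorem mem_linearDivergence {D : Module.End k (FreeAlgebra k X)} :
    D ∈ linearDivergence k X ↔ IsDer D ∧
      (∀ i, D (FreeAlgebra.ι k i) ∈ commutatorSpan k (FreeAlgebra k X)) ∧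
      divergence D ∈ commutatorSpan k _ ⊔ Submodule.span k (Set.range (FreeAlgebra.ι k)) := by
  simp [linearDivergence, mem_derivations, and_assoc]

/-- By the cocycle property it suffices that each derivation sends the divergence of the other to
commutators. Commutators are preserved by any derivation, and letters are sent to commutators by
assumption, hence linear forms too. -/
theorem bracket_mem_zeroDivergence {D D' : Module.End k (FreeAlgebra k X)}
    (h : D ∈ linearDivergence k X) (h' : D' ∈ linearDivergence k X) :
    D * D' - D' * D ∈ zeroDivergence k X := by
  obtain ⟨hd, hx, hdiv⟩ := mem_linearDivergence.1 h
  obtain ⟨hd', hx', hdiv'⟩ := mem_linearDivergence.1 h'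
  have key {E E' : Module.End k (FreeAlgebra k X)} (hE : IsDer E)
      (hE' : ∀ i, E (FreeAlgebra.ι k i) ∈ commutatorSpan k (FreeAlgebra k X))
      (hE'' : divergence E' ∈ commutatorSpan k _ ⊔ Submodule.span k (Set.range (FreeAlgebra.ι k))) :
      E (divergence E') ∈ commutatorSpan k (FreeAlgebra k X) := by
    have : commutatorSpan k _ ⊔ Submodule.span k (Set.range (FreeAlgebra.ι k)) ≤
        (commutatorSpan k (FreeAlgebra k X)).comap E := by
      refine sup_le (fun a ha => hE.map_commutatorSpan ha) (Submodule.span_le.2 ?_)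
      rintro _ ⟨i, rfl⟩
      exact hE' i
    exact this hE''
  have hc (i : X) : ε (D (FreeAlgebra.ι k i)) = (0 : k) :=
    map_eq_zero_of_mem_commutatorSpan _ (hx i)
  have hc' (i : X) : ε (D' (FreeAlgebra.ι k i)) = (0 : k) :=
    map_eq_zero_of_mem_commutatorSpan _ (hx' i)
  have h0 : divergence (D * D' - D' * D) ∈ commutatorSpan k (FreeAlgebra k X) := by
    have := add_mem (divergence_bracket hd hd' hc hc') (sub_mem (key hd hx hdiv') (key hd' hx' hdiv))
    rwa [sub_add_cancel] at this
  refine ⟨mem_linearDivergence.2 ⟨hd.bracket hd', fun i => ?_, Submodule.mem_sup_left h0⟩, h0⟩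
  exact sub_mem (hd.map_commutatorSpan (hx' i)) (hd'.map_commutatorSpan (hx i))

theorem pairDer_mem_linearDivergence {i j : Fin 3} (hij : i ≠ j) :
    pairDer k i j ∈ linearDivergence k (Fin 3) := by
  refine mem_linearDivergence.2 ⟨isDer_pairDer i j, fun l => ?_, Submodule.mem_sup_right ?_⟩
  · rw [pairDer_ι]
    refine add_mem ?_ ?_ <;> split_ifs
    exacts [sub_mem_commutatorSpan _ _, zero_mem _, sub_mem_commutatorSpan _ _, zero_mem _]
  · have h : divergence (pairDer k i j) = -FreeAlgebra.ι k j - FreeAlgebra.ι k i := by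
      rw [divergence_apply]
      simp only [pairDer_ι, map_add, apply_ite (fox _), map_sub, map_zero,
        fox_mul_of_const_eq_zero _ _ (algebraMapInv_ι _), fox_ι, Finset.sum_add_distrib]
      simp [hij, hij.symm, sub_eq_add_neg]
    rw [h]
    exact sub_mem (neg_mem (Submodule.subset_span ⟨j, rfl⟩)) (Submodule.subset_span ⟨i, rfl⟩)

end Fox

/-! ### The cocycle equation for the divergence -/

section Cocycle

variable {p : ℕ} [hp : Fact p.Prime] {Φ : NCSeries ℚ_[p]}

local notation "X₀" => FreeAlgebra.ι (ZMod p) (0 : Fin 3)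
local notation "X₁" => FreeAlgebra.ι (ZMod p) (1 : Fin 3)
local notation "X₂" => FreeAlgebra.ι (ZMod p) (2 : Fin 3)
local notation "𝓓" => pairDer (ZMod p)
local notation "𝓍" => FreeAlgebra.ι (ZMod p) (0 : Fin 2)
local notation "𝓎" => FreeAlgebra.ι (ZMod p) (1 : Fin 2)

theorem leading_mem_commutatorSpan (h2 : 2 < p) (hΦ : IsAssociator 1 Φ)
    (hb : HasSimplePoleBound p Φ) {S : Type*} [Ring S] [Algebra (ZMod p) S] (u v : S) :
    leading Φ u v ∈ commutatorSpan (ZMod p) S :=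
  leading_mem_of_bracket_mem h2 hΦ hb (L := ⊤) le_top (fun a _ b _ => sub_mem_commutatorSpan a b)
    trivial trivial

theorem fox_subst {X : Type*} [DecidableEq X] (i : X) (c : FreeAlgebra (ZMod p) (Fin 2))
    {u v : FreeAlgebra (ZMod p) X} (hu : FreeAlgebra.algebraMapInv u = (0 : ZMod p))
    (hv : FreeAlgebra.algebraMapInv v = (0 : ZMod p)) :
    fox i (FreeAlgebra.lift (ZMod p) ![u, v] c) =
      FreeAlgebra.lift (ZMod p) ![u, v] (pd 0 c) * fox i u +
        FreeAlgebra.lift (ZMod p) ![u, v] (pd 1 c) * fox i v := by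
  conv_lhs => rw [eq_const_add_pd c]
  simp [fox_algebraMap, fox_mul_of_const_eq_zero, hu, hv]

variable (Φ) in
/-- The expression whose trace is the divergence. -/
def divPart : FreeAlgebra (ZMod p) (Fin 2) :=
  𝓍 * pd 0 (leadA Φ 𝓍 𝓎) + 𝓎 * pd 1 (leadB Φ 𝓍 𝓎)

/-- Since φ consists of brackets of length at least two in D₀₁ and D₁₂, φ(D₀₁, D₁₂) has divergence
zero. For a tangential derivation ∂_i[v_i, x_i] = v_i - x_i ∂_i v_i, and the v_i are themselves
commutators. -/
theorem sum_mul_fox_mem (h2 : 2 < p) (hΦ : IsAssociator 1 Φ) (hb : HasSimplePoleBound p Φ)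
    {v : Fin 3 → FreeAlgebra (ZMod p) (Fin 3)} (hv : ∀ i, v i ∈ commutatorSpan (ZMod p) _)
    (h : ∀ i, leading Φ (𝓓 0 1) (𝓓 1 2) (FreeAlgebra.ι _ i) =
      v i * FreeAlgebra.ι _ i - FreeAlgebra.ι _ i * v i) :
    ∑ i, FreeAlgebra.ι _ i * fox i (v i) ∈ commutatorSpan (ZMod p) _ := by
  have h1 : leading Φ (𝓓 0 1) (𝓓 1 2) ∈ zeroDivergence (ZMod p) (Fin 3) :=
    leading_mem_of_bracket_mem h2 hΦ hb (L := linearDivergence (ZMod p) (Fin 3)) inf_le_left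
      (fun _ h _ h' => bracket_mem_zeroDivergence h h') (pairDer_mem_linearDivergence (by decide))
      (pairDer_mem_linearDivergence (by decide))
  have h3 : divergence (leading Φ (𝓓 0 1) (𝓓 1 2)) =
      ∑ i, v i - ∑ i, FreeAlgebra.ι _ i * fox i (v i) := by
    rw [divergence_apply, ← Finset.sum_sub_distrib]
    refine Finset.sum_congr rfl fun i _ => ?_
    rw [h, map_sub, fox_mul_of_const_eq_zero _ _ (algebraMapInv_ι i), fox_ι, if_pos rfl, mul_one,
      fox_mul_of_const_eq_zero _ _ (map_eq_zero_of_mem_commutatorSpan _ (hv i))]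
  have h4 : divergence (leading Φ (𝓓 0 1) (𝓓 1 2)) ∈ commutatorSpan (ZMod p) _ := h1.2
  rw [h3] at h4
  simpa using sub_mem (sum_mem (t := Finset.univ) fun i _ => hv i) h4

/-- The chain rule collects the terms of ∑ X_i ∂_i v_i; for instance X₀∂₀ + X₁∂₁ applied to A(X₀+X₁,
X₂) gives (X₀+X₁)(∂_x A)(X₀+X₁, X₂). -/
theorem divPart_cocycle (h2 : 2 < p) (hΦ : IsAssociator 1 Φ) (hb : HasSimplePoleBound p Φ) :
    FreeAlgebra.lift (ZMod p) ![X₀ + X₁, X₂] (divPart Φ) +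
        FreeAlgebra.lift (ZMod p) ![X₀, X₁] (divPart Φ) -
        FreeAlgebra.lift (ZMod p) ![X₀, X₁ + X₂] (divPart Φ) -
        FreeAlgebra.lift (ZMod p) ![X₁, X₂] (divPart Φ) ∈
      commutatorSpan (ZMod p) (FreeAlgebra (ZMod p) (Fin 3)) := by
  have hm (u v : FreeAlgebra (ZMod p) (Fin 3)) : leadA Φ u v ∈ commutatorSpan (ZMod p) _ :=
    leading_mem_commutatorSpan h2 hΦ hb _ _
  have hm' (u v : FreeAlgebra (ZMod p) (Fin 3)) : leadB Φ u v ∈ commutatorSpan (ZMod p) _ :=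
    leading_mem_commutatorSpan h2 hΦ hb _ _
  have h := sum_mul_fox_mem h2 hΦ hb
    (v := ![leadA Φ (X₀ + X₁) X₂ + leadA Φ X₀ X₁ - leadA Φ X₀ (X₁ + X₂),
      leadA Φ (X₀ + X₁) X₂ - leadA Φ X₁ X₂ + leadB Φ X₀ X₁ - leadB Φ X₀ (X₁ + X₂),
      leadB Φ (X₀ + X₁) X₂ - leadB Φ X₁ X₂ - leadB Φ X₀ (X₁ + X₂)])
    (by
      intro i
      fin_cases i
      · exact sub_mem (add_mem (hm _ _) (hm _ _)) (hm _ _)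
      · exact sub_mem (add_mem (sub_mem (hm _ _) (hm _ _)) (hm' _ _)) (hm' _ _)
      · exact sub_mem (sub_mem (hm' _ _) (hm' _ _)) (hm' _ _))
    (by
      intro i
      fin_cases i
      · exact leading_der_apply_zero h2 hΦ hb rfl
      · exact leading_der_apply_one h2 hΦ hb rfl
      · exact leading_der_apply_two h2 hΦ hb rfl)
  have hA (u v : FreeAlgebra (ZMod p) (Fin 3)) :
      leadA Φ u v = FreeAlgebra.lift (ZMod p) ![u, v] (leadA Φ 𝓍 𝓎) := by
    rw [map_leadA]; simp
  have hB (u v : FreeAlgebra (ZMod p) (Fin 3)) :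
      leadB Φ u v = FreeAlgebra.lift (ZMod p) ![u, v] (leadB Φ 𝓍 𝓎) := by
    rw [map_leadB]; simp
  have h' : X₀ * fox 0 (leadA Φ (X₀ + X₁) X₂ + leadA Φ X₀ X₁ - leadA Φ X₀ (X₁ + X₂)) +
      X₁ * fox 1 (leadA Φ (X₀ + X₁) X₂ - leadA Φ X₁ X₂ + leadB Φ X₀ X₁ - leadB Φ X₀ (X₁ + X₂)) +
      X₂ * fox 2 (leadB Φ (X₀ + X₁) X₂ - leadB Φ X₁ X₂ - leadB Φ X₀ (X₁ + X₂)) ∈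
      commutatorSpan (ZMod p) (FreeAlgebra (ZMod p) (Fin 3)) := by
    rw [Fin.sum_univ_three] at h
    exact h
  convert h' using 1
  simp only [hA _ _, hB _ _, map_add, map_sub]
  simp only [divPart, fox_subst, map_add, map_mul, FreeAlgebra.lift_ι_apply, algebraMapInv_ι,
    add_zero, fox_ι, Matrix.cons_val_zero, Matrix.cons_val_one]
  simp
  noncomm_ring

end Cocycle

/-! ### Homogeneous noncommutative polynomials -/

section Homogeneous

variable {k : Type*} [CommRing k]

local notation "𝓍" => FreeAlgebra.ι k (0 : Fin 2)
local notation "𝓎" => FreeAlgebra.ι k (1 : Fin 2)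

variable (k) in
/-- The noncommutative polynomials which are homogeneous of degree `n`. -/
def homogeneous (n : ℕ) : Submodule k (FreeAlgebra k (Fin 2)) :=
  Submodule.span k {u | ∃ w : List (Fin 2), w.length = n ∧ (w.map (FreeAlgebra.ι k)).prod = u}

theorem prod_mem_homogeneous (w : List (Fin 2)) :
    (w.map (FreeAlgebra.ι k)).prod ∈ homogeneous k w.length :=
  Submodule.subset_span ⟨w, rfl, rfl⟩

theorem homogeneous_le {n : ℕ} {L : Submodule k (FreeAlgebra k (Fin 2))}
    (h : ∀ w : List (Fin 2), w.length = n → (w.map (FreeAlgebra.ι k)).prod ∈ L) :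
    homogeneous k n ≤ L := by
  refine Submodule.span_le.2 ?_
  rintro _ ⟨w, hw, rfl⟩
  exact h w hw

theorem ι_mem_homogeneous (i : Fin 2) : FreeAlgebra.ι k i ∈ homogeneous k 1 := by
  simpa using prod_mem_homogeneous (k := k) [i]

theorem one_mem_homogeneous : (1 : FreeAlgebra k (Fin 2)) ∈ homogeneous k 0 := by
  simpa using prod_mem_homogeneous (k := k) []

theorem mul_mem_homogeneous {m n : ℕ} {a b : FreeAlgebra k (Fin 2)} (ha : a ∈ homogeneous k m)
    (hb : b ∈ homogeneous k n) : a * b ∈ homogeneous k (m + n) := by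
  refine homogeneous_le (L := (homogeneous k (m + n)).comap (LinearMap.mulRight k b))
    (fun w hw => ?_) ha
  refine homogeneous_le (L := (homogeneous k (m + n)).comap (LinearMap.mulLeft k _))
    (fun w' hw' => ?_) hb
  have := prod_mem_homogeneous (k := k) (w ++ w')
  simpa [hw, hw'] using this

theorem pow_mem_homogeneous {a : FreeAlgebra k (Fin 2)} (ha : a ∈ homogeneous k 1) (n : ℕ) :
    a ^ n ∈ homogeneous k n := by
  induction n with
  | zero => simpa using one_mem_homogeneous
  | succ n ih => exact pow_succ a n ▸ mul_mem_homogeneous ih ha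

theorem homPart_mem_homogeneous (f : NCSeries k) (n : ℕ) {u v : FreeAlgebra k (Fin 2)}
    (hu : u ∈ homogeneous k 1) (hv : v ∈ homogeneous k 1) :
    homPart f n u v ∈ homogeneous k n := by
  have key (w : List (Fin 2)) : (w.map ![u, v]).prod ∈ homogeneous k w.length := by
    induction w with
    | nil => simpa using one_mem_homogeneous
    | cons i w ih =>
      have hi : ![u, v] i ∈ homogeneous k 1 := by fin_cases i <;> assumption
      rw [List.map_cons, List.prod_cons, List.length_cons, add_comm]
      exact mul_mem_homogeneous hi ih
  refine sum_mem fun w _ => Submodule.smul_mem _ _ ?_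
  simpa using key (List.ofFn w)

theorem pd_smul (i : Fin 2) (c : k) (a : FreeAlgebra k (Fin 2)) : pd i (c • a) = c • pd i a := by
  simp [pd]

theorem pd_neg (i : Fin 2) (a : FreeAlgebra k (Fin 2)) : pd i (-a) = -pd i a := by
  simp [pd]

theorem pd_sub (i : Fin 2) (a b : FreeAlgebra k (Fin 2)) : pd i (a - b) = pd i a - pd i b := by
  simp [pd]

theorem pd_mem_homogeneous (i : Fin 2) {n : ℕ} {a : FreeAlgebra k (Fin 2)}
    (ha : a ∈ homogeneous k (n + 1)) : pd i a ∈ homogeneous k n := by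
  let P : FreeAlgebra k (Fin 2) →ₗ[k] FreeAlgebra k (Fin 2) :=
    { toFun := pd i, map_add' := pd_add i, map_smul' := pd_smul i }
  refine homogeneous_le (L := (homogeneous k n).comap P) (fun w hw => ?_) ha
  change pd i (w.map (FreeAlgebra.ι k)).prod ∈ homogeneous k n
  clear ha
  induction w generalizing n with
  | nil => simp at hw
  | cons c w ih =>
    rw [List.map_cons, List.prod_cons, pd_mul]
    cases w with
    | nil =>
      obtain rfl : n = 0 := by simpa using hw.symm
      have h1 : pd i (1 : FreeAlgebra k (Fin 2)) = 0 := by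
        simpa using pd_algebraMap (k := k) i 1
      simp only [List.map_nil, List.prod_nil, map_one, mul_one, pd_ι, h1, mul_zero, zero_add]
      split_ifs
      exacts [one_mem_homogeneous, zero_mem _]
    | cons d w =>
      have h0 : FreeAlgebra.algebraMapInv
          ((d :: w).map (FreeAlgebra.ι k)).prod = (0 : k) := by
        simp [algebraMapInv_ι]
      obtain ⟨m, rfl⟩ : ∃ m, n = m + 1 := ⟨w.length, by simpa using hw.symm⟩
      rw [h0, map_zero, mul_zero, add_zero, add_comm m]
      refine mul_mem_homogeneous (ι_mem_homogeneous c) (ih (by simpa using hw))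

variable (k) in
/-- The derivation `x ↦ x`, `y ↦ 0`, which counts the letters `x`. -/
def euler : Module.End k (FreeAlgebra k (Fin 2)) := der ![𝓍, 0]

theorem isDer_euler : IsDer (euler k) := isDer_der _

theorem euler_word (w : List (Fin 2)) : euler k (w.map (FreeAlgebra.ι k)).prod =
    (w.count 0 : k) • (w.map (FreeAlgebra.ι k)).prod := by
  induction w with
  | nil => simp [isDer_euler.map_one]
  | cons i w ih =>
    rw [List.map_cons, List.prod_cons, isDer_euler, ih, euler, der_ι]
    fin_cases i
    · simp [add_smul, add_comm]
    · simp

theorem lift_zero_word (w : List (Fin 2)) :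
    FreeAlgebra.lift k ![0, 𝓎] (w.map (FreeAlgebra.ι k)).prod =
      if w.count 0 = 0 then (w.map (FreeAlgebra.ι k)).prod else 0 := by
  induction w with
  | nil => simp
  | cons i w ih =>
    rw [List.map_cons, List.prod_cons, map_mul, ih, FreeAlgebra.lift_ι_apply]
    fin_cases i
    · simp
    · simp

/-- The trace of a power of `v` under a derivation. -/
theorem IsDer.map_pow {A : Type*} [Ring A] [Algebra k A] {D : Module.End k A} (hD : IsDer D)
    (v : A) (m j : ℕ) :
    v ^ j * D (v ^ m) - (m : k) • (D v * v ^ (j + m - 1)) ∈ commutatorSpan k A := by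
  induction m generalizing j with
  | zero => simp [hD.map_one]
  | succ m ih =>
    have h1 := ih (j + 1)
    have h3 : v ^ j * (D v * v ^ m) - D v * v ^ m * v ^ j ∈ commutatorSpan k A :=
      sub_mem_commutatorSpan _ _
    rw [mul_assoc, ← pow_add, add_comm m j] at h3
    have h4 : j + 1 + m - 1 = j + m := by lia
    have h5 : j + (m + 1) - 1 = j + m := by lia
    rw [h4] at h1
    rw [h5, pow_succ', hD, Nat.cast_succ, add_smul, one_smul, mul_add]
    convert add_mem h1 h3 using 1
    rw [pow_succ, mul_assoc]
    abel

/-- The substitution of `inr x` for the first and `v` for the second letter. -/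
def linHom (v : FreeAlgebra k (Fin 2)) : FreeAlgebra k (Fin 2) →ₐ[k]
    TrivSqZeroExt (FreeAlgebra k (Fin 2)) (FreeAlgebra k (Fin 2)) :=
  FreeAlgebra.lift k ![TrivSqZeroExt.inr 𝓍, TrivSqZeroExt.inl v]

variable (k) in
/-- The evaluation `x ↦ ε`, `y ↦ 1` in dual numbers. -/
def dualHom : FreeAlgebra k (Fin 2) →ₐ[k] TrivSqZeroExt k k :=
  FreeAlgebra.lift k ![TrivSqZeroExt.inr 1, TrivSqZeroExt.inl 1]

theorem fst_linHom_word (v : FreeAlgebra k (Fin 2)) (w : List (Fin 2)) :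
    (linHom v (w.map (FreeAlgebra.ι k)).prod).fst =
      (dualHom k (w.map (FreeAlgebra.ι k)).prod).fst • v ^ w.length := by
  induction w with
  | nil => simp
  | cons i w ih =>
    rw [List.map_cons, List.prod_cons, map_mul, map_mul, TrivSqZeroExt.fst_mul,
      TrivSqZeroExt.fst_mul, ih]
    fin_cases i
    · simp [linHom, dualHom]
    · simp [linHom, dualHom, pow_succ']

/-- Only words with exactly one letter x have an ε-part, and such a word v^i x v^j is cyclically x
v^{i+j}. The factor `v ^ j` on the left keeps track of the letters already passed. On homogeneous
elements the scalar is the sum of the coefficients of the words with a single x. -/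
theorem snd_linHom_word (v : FreeAlgebra k (Fin 2)) (w : List (Fin 2)) (j : ℕ) :
    v ^ j * (linHom v (w.map (FreeAlgebra.ι k)).prod).snd -
      (dualHom k (w.map (FreeAlgebra.ι k)).prod).snd • (𝓍 * v ^ (j + w.length - 1)) ∈
        commutatorSpan k (FreeAlgebra k (Fin 2)) := by
  induction w generalizing j with
  | nil => simp
  | cons i w ih =>
    rw [List.map_cons, List.prod_cons, map_mul, map_mul, TrivSqZeroExt.snd_mul,
      TrivSqZeroExt.snd_mul, fst_linHom_word]
    have h4 : j + 1 + w.length - 1 = j + w.length := by lia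
    have h5 : j + (i :: w).length - 1 = j + w.length := by simp
    rw [h5]
    fin_cases i
    · have h3 : v ^ j * (𝓍 * v ^ w.length) - 𝓍 * v ^ w.length * v ^ j ∈
          commutatorSpan k (FreeAlgebra k (Fin 2)) := sub_mem_commutatorSpan _ _
      rw [mul_assoc, ← pow_add, add_comm w.length j] at h3
      have h6 := Submodule.smul_mem _ (dualHom k (w.map (FreeAlgebra.ι k)).prod).fst h3
      convert h6 using 1
      simp [linHom, dualHom, smul_sub]
    · have h1 := ih (j + 1)
      rw [h4] at h1
      convert h1 using 1
      simp [linHom, dualHom, pow_succ, mul_assoc]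

theorem snd_linHom (v : FreeAlgebra k (Fin 2)) {n : ℕ} {a : FreeAlgebra k (Fin 2)}
    (ha : a ∈ homogeneous k n) :
    (linHom v a).snd - (dualHom k a).snd • (𝓍 * v ^ (n - 1)) ∈
        commutatorSpan k (FreeAlgebra k (Fin 2)) := by
  let P : FreeAlgebra k (Fin 2) →ₗ[k] FreeAlgebra k (Fin 2) :=
    { toFun := fun a => (linHom v a).snd - (dualHom k a).snd • (𝓍 * v ^ (n - 1))
      map_add' := fun a b => by simp only [map_add, TrivSqZeroExt.snd_add, add_smul]; abel
      map_smul' := fun c a => by simp [smul_sub, mul_smul] }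
  refine homogeneous_le (L := (commutatorSpan k _).comap P) (fun w hw => ?_) ha
  have := snd_linHom_word v w 0
  rw [hw] at this
  simpa [P] using this

theorem snd_mem_commutatorSpan {A : Type*} [Ring A] [Algebra k A] {a : TrivSqZeroExt A A}
    (ha : a ∈ commutatorSpan k (TrivSqZeroExt A A)) : a.snd ∈ commutatorSpan k A := by
  let P : TrivSqZeroExt A A →ₗ[k] A :=
    { toFun := fun a => a.snd
      map_add' := fun a b => by simp
      map_smul' := fun c a => by simp }
  refine (commutatorSpan_le_iff (L := (commutatorSpan k A).comap P)).2 (fun u v => ?_) ha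
  have : (u * v - v * u).snd = (u.fst * v.snd - v.snd * u.fst) + (u.snd * v.fst - v.fst * u.snd) := by
    simp [TrivSqZeroExt.snd_mul]
    abel
  change (u * v - v * u).snd ∈ commutatorSpan k A
  rw [this]
  exact add_mem (sub_mem_commutatorSpan _ _) (sub_mem_commutatorSpan _ _)

end Homogeneous

/-! ### Solving the cocycle equation in degree `p - 1` -/

section Euler

variable {p : ℕ} [hp : Fact p.Prime]

local notation "𝓍" => FreeAlgebra.ι (ZMod p) (0 : Fin 2)
local notation "𝓎" => FreeAlgebra.ι (ZMod p) (1 : Fin 2)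
local notation "X₀" => FreeAlgebra.ι (ZMod p) (0 : Fin 3)
local notation "X₁" => FreeAlgebra.ι (ZMod p) (1 : Fin 3)
local notation "X₂" => FreeAlgebra.ι (ZMod p) (2 : Fin 3)

/-- A word containing x exactly c times is an eigenvector with eigenvalue c^{p-1}. As c ≤ `n` < `p`,
this is 1 unless c = 0. -/
theorem euler_pow_apply {n : ℕ} (hn : n < p) {a : FreeAlgebra (ZMod p) (Fin 2)}
    (ha : a ∈ homogeneous (ZMod p) n) :
    (euler (ZMod p) ^ (p - 1)) a = a - FreeAlgebra.lift (ZMod p) ![0, 𝓎] a := by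
  suffices h : a ∈ LinearMap.ker (euler (ZMod p) ^ (p - 1) - LinearMap.id +
      (FreeAlgebra.lift (ZMod p) ![0, 𝓎]).toLinearMap) by
    rw [LinearMap.mem_ker] at h
    simp only [LinearMap.add_apply, LinearMap.sub_apply, LinearMap.id_apply,
      AlgHom.toLinearMap_apply] at h
    rw [sub_add, sub_eq_zero] at h
    exact h
  refine homogeneous_le (fun w hw => ?_) ha
  have hpow (m : ℕ) : (euler (ZMod p) ^ m) (w.map (FreeAlgebra.ι (ZMod p))).prod =
      (w.count 0 : ZMod p) ^ m • (w.map (FreeAlgebra.ι (ZMod p))).prod := by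
    induction m with
    | zero => simp
    | succ m ih => rw [pow_succ', Module.End.mul_apply, ih, map_smul, euler_word, smul_smul, pow_succ]
  rw [LinearMap.mem_ker]
  simp only [LinearMap.add_apply, LinearMap.sub_apply, LinearMap.id_apply,
    AlgHom.toLinearMap_apply, hpow, lift_zero_word]
  by_cases h0 : w.count 0 = 0
  · have hp1 : p - 1 ≠ 0 := by have := hp.out.two_le; lia
    simp [h0, hp1]
  · have h1 : (w.count 0 : ZMod p) ≠ 0 := by
      rw [Ne, ZMod.natCast_eq_zero_iff]
      intro hd
      have := Nat.le_of_dvd (Nat.pos_of_ne_zero h0) hd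
      have := List.count_le_length (a := (0 : Fin 2)) (l := w)
      lia
    simp [h0, ZMod.pow_card_sub_one_eq_one h1]

/-- A homogeneous solution of degree `p - 1` of the cocycle equation is a coboundary. -/
theorem cocycle_solution (h2 : 2 < p) {G : FreeAlgebra (ZMod p) (Fin 2)}
    (hG : G ∈ homogeneous (ZMod p) (p - 1)) (h0 : FreeAlgebra.lift (ZMod p) ![0, 0] G =
      (0 : FreeAlgebra (ZMod p) (Fin 2)))
    (hc : FreeAlgebra.lift (ZMod p) ![X₀ + X₁, X₂] G + FreeAlgebra.lift (ZMod p) ![X₀, X₁] G -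
        FreeAlgebra.lift (ZMod p) ![X₀, X₁ + X₂] G - FreeAlgebra.lift (ZMod p) ![X₁, X₂] G ∈
      commutatorSpan (ZMod p) (FreeAlgebra (ZMod p) (Fin 3))) :
    G + (dualHom (ZMod p) G).snd • ((𝓍 + 𝓎) ^ (p - 1) - 𝓍 ^ (p - 1) - 𝓎 ^ (p - 1)) ∈
      commutatorSpan (ZMod p) (FreeAlgebra (ZMod p) (Fin 2)) := by
  set β := (dualHom (ZMod p) G).snd with hβ
  have hlift {B : Type} [Ring B] [Algebra (ZMod p) B] (g : FreeAlgebra (ZMod p) (Fin 3) →ₐ[ZMod p] B)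
      (u v : FreeAlgebra (ZMod p) (Fin 3)) :
      g (FreeAlgebra.lift (ZMod p) ![u, v] G) = FreeAlgebra.lift (ZMod p) ![g u, g v] G := by
    have : g.comp (FreeAlgebra.lift (ZMod p) ![u, v]) = FreeAlgebra.lift (ZMod p) ![g u, g v] := by
      ext i
      fin_cases i <;> simp
    exact DFunLike.congr_fun this G
  -- Specialising to (0, 0, y) leaves -G(0, y).
  have hy : FreeAlgebra.lift (ZMod p) ![0, 𝓎] G ∈ commutatorSpan (ZMod p) _ := by
    have h := map_mem_commutatorSpan (FreeAlgebra.lift (ZMod p) ![0, 0, 𝓎]) hc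
    simp only [map_sub, map_add, hlift] at h
    simp only [FreeAlgebra.lift_ι_apply, Matrix.cons_val_zero, Matrix.cons_val_one,
      Matrix.cons_val, add_zero, zero_add, h0] at h
    simpa using h
  -- Specialise to (εx, x, y) with ε² = 0 and take the ε-part: G(x+εx, y) yields the Euler
  -- derivation of G, G(εx, x) and G(εx, x+y) yield β x·x^{p-2} and β x(x+y)^{p-2}, and G(x, y)
  -- yields nothing.
  have hE : euler (ZMod p) G + β • (𝓍 ^ (p - 1) - 𝓍 * (𝓍 + 𝓎) ^ (p - 2)) ∈
      commutatorSpan (ZMod p) _ := by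
    have h := snd_mem_commutatorSpan (map_mem_commutatorSpan (FreeAlgebra.lift (ZMod p)
      (![TrivSqZeroExt.inr 𝓍, TrivSqZeroExt.inl 𝓍, TrivSqZeroExt.inl 𝓎] :
        Fin 3 → TrivSqZeroExt (FreeAlgebra (ZMod p) (Fin 2)) (FreeAlgebra (ZMod p) (Fin 2)))) hc)
    simp only [map_sub, map_add, hlift] at h
    simp only [FreeAlgebra.lift_ι_apply, Matrix.cons_val_zero, Matrix.cons_val_one,
      Matrix.cons_val] at h
    have e1 : FreeAlgebra.lift (ZMod p)
        (![TrivSqZeroExt.inr 𝓍 + TrivSqZeroExt.inl 𝓍, TrivSqZeroExt.inl 𝓎] :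
        Fin 2 → TrivSqZeroExt (FreeAlgebra (ZMod p) (Fin 2)) (FreeAlgebra (ZMod p) (Fin 2))) =
        derHom ![𝓍, 0] := by
      refine FreeAlgebra.hom_ext (funext fun i => ?_)
      fin_cases i <;> simp [derHom, add_comm]
    have e2 : (FreeAlgebra.lift (ZMod p)
        (![TrivSqZeroExt.inl 𝓍, TrivSqZeroExt.inl 𝓎] :
        Fin 2 → TrivSqZeroExt (FreeAlgebra (ZMod p) (Fin 2)) (FreeAlgebra (ZMod p) (Fin 2))) G).snd =
        0 := by
      have : FreeAlgebra.lift (ZMod p) (![TrivSqZeroExt.inl 𝓍, TrivSqZeroExt.inl 𝓎] :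
        Fin 2 → TrivSqZeroExt (FreeAlgebra (ZMod p) (Fin 2)) (FreeAlgebra (ZMod p) (Fin 2))) =
          TrivSqZeroExt.inlAlgHom (ZMod p) (FreeAlgebra (ZMod p) (Fin 2))
            (FreeAlgebra (ZMod p) (Fin 2)) := by
        refine FreeAlgebra.hom_ext (funext fun i => ?_)
        fin_cases i <;> simp
      rw [this]
      simp
    rw [e1, ← TrivSqZeroExt.inl_add] at h
    simp only [TrivSqZeroExt.snd_sub, TrivSqZeroExt.snd_add, e2, sub_zero] at h
    have h3 := snd_linHom 𝓍 hG
    have h4 := snd_linHom (𝓍 + 𝓎) hG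
    have h5 := add_mem (sub_mem h h3) h4
    convert h5 using 1
    have h6 : 𝓍 * 𝓍 ^ (p - 1 - 1) = 𝓍 ^ (p - 1) := by
      rw [← pow_succ']; congr 1; lia
    rw [h6, show p - 1 - 1 = p - 2 by lia, ← hβ]
    simp only [linHom, euler, der, LinearMap.coe_mk, AddHom.coe_mk, smul_sub]
    abel
  set M := G + β • ((𝓍 + 𝓎) ^ (p - 1) - 𝓍 ^ (p - 1) - 𝓎 ^ (p - 1)) with hM
  -- For a derivation D, tr D(v^{p-1}) = (`p` - 1) tr(D(v) v^{p-2}), and `p - 1` is -1 modulo `p`.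
  have hpow (v : FreeAlgebra (ZMod p) (Fin 2)) : euler (ZMod p) (v ^ (p - 1)) +
      euler (ZMod p) v * v ^ (p - 2) ∈ commutatorSpan (ZMod p) _ := by
    have := isDer_euler.map_pow v (p - 1) 0
    rw [cast_p_sub_one, neg_smul, one_smul, sub_neg_eq_add, pow_zero, one_mul, zero_add] at this
    exact this
  have hex : euler (ZMod p) 𝓍 = 𝓍 := der_ι _ _
  have hey : euler (ZMod p) 𝓎 = 0 := der_ι _ _
  have hEM : euler (ZMod p) M ∈ commutatorSpan (ZMod p) _ := by
    have h1 := hpow (𝓍 + 𝓎)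
    have h3 := hpow 𝓍
    have h4 := hpow 𝓎
    rw [map_add, hex, hey, add_zero] at h1
    rw [hex] at h3
    rw [hey, zero_mul, add_zero] at h4
    have h5 := add_mem hE (Submodule.smul_mem _ β (sub_mem (sub_mem h1 h3) h4))
    convert h5 using 1
    have h6 : 𝓍 * 𝓍 ^ (p - 2) = 𝓍 ^ (p - 1) := by
      rw [← pow_succ']; congr 1; lia
    rw [hM, h6]
    simp only [map_add, map_smul, map_sub, smul_sub, smul_add]
    abel
  have hMh : M ∈ homogeneous (ZMod p) (p - 1) := by
    refine add_mem hG (Submodule.smul_mem _ _ (sub_mem (sub_mem ?_ ?_) ?_)) <;>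
      apply pow_mem_homogeneous
    exacts [add_mem (ι_mem_homogeneous _) (ι_mem_homogeneous _), ι_mem_homogeneous _,
      ι_mem_homogeneous _]
  -- The Euler derivation sends M to commutators, hence so does each positive power; the power `p -
  -- 1` recovers M - M(0, y), and M(0, y) = G(0, y) is a sum of commutators by `hy`.
  have hfin := euler_pow_apply (by lia) hMh
  have hiter (m : ℕ) : (euler (ZMod p) ^ (m + 1)) M ∈ commutatorSpan (ZMod p) _ := by
    induction m with
    | zero => simpa using hEM
    | succ m ih =>
      rw [pow_succ', Module.End.mul_apply]
      exact isDer_euler.map_commutatorSpan ih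
  have h1 := hiter (p - 2)
  rw [show p - 2 + 1 = p - 1 by lia, hfin] at h1
  have h3 : FreeAlgebra.lift (ZMod p) ![0, 𝓎] M = FreeAlgebra.lift (ZMod p) ![0, 𝓎] G := by
    rw [hM]
    simp [show p - 1 ≠ 0 by lia]
  rw [h3] at h1
  simpa using add_mem h1 hy

end Euler

/-! ### The divergence of the leading pole, up to its coefficient -/

section Trace

variable {p : ℕ} [hp : Fact p.Prime] {Φ : NCSeries ℚ_[p]}

local notation "𝓍" => FreeAlgebra.ι (ZMod p) (0 : Fin 2)
local notation "𝓎" => FreeAlgebra.ι (ZMod p) (1 : Fin 2)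

theorem divPart_mem_homogeneous (h2 : 2 < p) : divPart Φ ∈ homogeneous (ZMod p) (p - 1) := by
  have h (u : FreeAlgebra (ZMod p) (Fin 2)) (hu : u ∈ homogeneous (ZMod p) 1) :
      leading Φ (-𝓍 - 𝓎) u ∈ homogeneous (ZMod p) (p - 2 + 1) := by
    rw [show p - 2 + 1 = p - 1 by lia]
    exact homPart_mem_homogeneous _ _
      (sub_mem (neg_mem (ι_mem_homogeneous _)) (ι_mem_homogeneous _)) hu
  rw [show p - 1 = 1 + (p - 2) by lia]
  exact add_mem
    (mul_mem_homogeneous (ι_mem_homogeneous _) (pd_mem_homogeneous _ (h _ (ι_mem_homogeneous _))))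
    (mul_mem_homogeneous (ι_mem_homogeneous _) (pd_mem_homogeneous _ (h _ (ι_mem_homogeneous _))))

/-- Both sides are the sum of the coefficients of the words y^m x: the constant part of `dualHom`
sets x = 0, y = 1, and applying it to the matrix defining ∂_x gives the matrices on the right. -/
theorem lift_pd_zero {k : Type*} [CommRing k] (c : FreeAlgebra k (Fin 2)) :
    (dualHom k (pd 0 c)).fst =
      FreeAlgebra.lift k ![!![0, 1; 0, 0], (!![1, 0; 0, 0] : Matrix (Fin 2) (Fin 2) k)] c 0 1 := by
  let g : FreeAlgebra k (Fin 2) →ₐ[k] k := (TrivSqZeroExt.fstHom k k k).comp (dualHom k)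
  have h : (AlgHom.mapMatrix g).comp (pdAux 0) =
      FreeAlgebra.lift k ![!![0, 1; 0, 0], (!![1, 0; 0, 0] : Matrix (Fin 2) (Fin 2) k)] := by
    ext i a b
    fin_cases i <;> fin_cases a <;> fin_cases b <;> simp [pdAux, g, dualHom]
  rw [← h]
  rfl

/-- The dual numbers are commutative, so B vanishes there; decomposing B by ∂_x and ∂_y expresses
the contribution of y ∂_y B through ∂_x B. What remains is ∂_x(A - B) = -∂_x φ, that is, minus the
coefficient of y^{p-2}x, which antisymmetry turns into the coefficient of x^{p-2}y. -/
theorem dualHom_divPart (h2 : 2 < p) (hΦ : IsAssociator 1 Φ) (hb : HasSimplePoleBound p Φ) :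
    (dualHom (ZMod p) (divPart Φ)).snd =
      (leading Φ (!![1, 0; 0, 0] : Matrix (Fin 2) (Fin 2) (ZMod p)) !![0, 1; 0, 0]) 0 1 := by
  have h1 : (dualHom (ZMod p) (divPart Φ)).snd = (dualHom (ZMod p) (pd 0 (leadA Φ 𝓍 𝓎))).fst +
      (dualHom (ZMod p) (pd 1 (leadB Φ 𝓍 𝓎))).snd := by
    simp [divPart, dualHom]
  have h3 : (dualHom (ZMod p) (leadB Φ 𝓍 𝓎)).snd = 0 := by
    rw [map_leadB, leadB, leading_eq_zero h2 hΦ hb (Commute.all _ _)]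
    rfl
  rw [eq_const_add_pd (leadB Φ 𝓍 𝓎)] at h3
  have h4 : (dualHom (ZMod p) (pd 0 (leadB Φ 𝓍 𝓎))).fst +
      (dualHom (ZMod p) (pd 1 (leadB Φ 𝓍 𝓎))).snd = 0 := by
    rw [← h3]
    simp [dualHom, TrivSqZeroExt.algebraMap_eq_inl]
  have h5 : leading Φ 𝓍 𝓎 = leadB Φ 𝓍 𝓎 - leadA Φ 𝓍 𝓎 := leading_eq_leadB_sub h2 hΦ hb _ _
  have h6 : (dualHom (ZMod p) (pd 0 (leading Φ 𝓍 𝓎))).fst =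
      (dualHom (ZMod p) (pd 0 (leadB Φ 𝓍 𝓎))).fst - (dualHom (ZMod p) (pd 0 (leadA Φ 𝓍 𝓎))).fst := by
    rw [h5, pd_sub]
    simp
  have h7 := lift_pd_zero (leading Φ 𝓍 𝓎)
  rw [map_leading] at h7
  simp only [FreeAlgebra.lift_ι_apply, Matrix.cons_val_zero, Matrix.cons_val_one] at h7
  rw [leading_swap hΦ hb !![1, 0; 0, 0], Matrix.neg_apply] at h7
  rw [h1]
  linear_combination h4 - h7 + h6

theorem divPart_mem_commutatorSpan (h2 : 2 < p) (hΦ : IsAssociator 1 Φ)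
    (hb : HasSimplePoleBound p Φ) :
    divPart Φ +
      (leading Φ (!![1, 0; 0, 0] : Matrix (Fin 2) (Fin 2) (ZMod p)) !![0, 1; 0, 0]) 0 1 •
        ((𝓍 + 𝓎) ^ (p - 1) - 𝓍 ^ (p - 1) - 𝓎 ^ (p - 1)) ∈
      commutatorSpan (ZMod p) (FreeAlgebra (ZMod p) (Fin 2)) := by
  rw [← dualHom_divPart h2 hΦ hb]
  exact cocycle_solution h2 (divPart_mem_homogeneous h2) (by simp [divPart])
    (divPart_cocycle h2 hΦ hb)

end Trace

/-! ### Associators in triangular matrices -/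

section Triangular

variable {K : Type*} [Field K]

local notation "𝕄" => Matrix (Fin 2) (Fin 2) K

/-- A series of matrices as a matrix of series. -/
def matrixOfSeries (F : 𝕄⟦X⟧) : Matrix (Fin 2) (Fin 2) K⟦X⟧ :=
  Matrix.of fun i j => PowerSeries.mk fun n => PowerSeries.coeff n F i j

theorem coeff_matrixOfSeries (F : 𝕄⟦X⟧) (i j : Fin 2) (n : ℕ) :
    PowerSeries.coeff n (matrixOfSeries F i j) = PowerSeries.coeff n F i j := by
  simp [matrixOfSeries]

theorem matrixOfSeries_mul (F G : 𝕄⟦X⟧) :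
    matrixOfSeries (F * G) = matrixOfSeries F * matrixOfSeries G := by
  ext i j n
  rw [coeff_matrixOfSeries, PowerSeries.coeff_mul, Matrix.mul_apply, map_sum, Matrix.sum_apply]
  simp only [Matrix.mul_apply, PowerSeries.coeff_mul, coeff_matrixOfSeries]
  exact Finset.sum_comm

theorem matrixOfSeries_one : matrixOfSeries (1 : 𝕄⟦X⟧) = 1 := by
  ext i j n
  rw [coeff_matrixOfSeries, PowerSeries.coeff_one, Matrix.one_apply]
  split_ifs with h1 h2 <;> simp_all [Matrix.one_apply, PowerSeries.coeff_one]

theorem homPart_triangular (f : NCSeries K) (n : ℕ) (a b s c d t : K) :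
    homPart f n !![a, b; 0, s] !![c, d; 0, t] 0 0 = homPart f n a c ∧
    homPart f n !![a, b; 0, s] !![c, d; 0, t] 1 0 = 0 ∧
    homPart f n !![a, b; 0, s] !![c, d; 0, t] 1 1 = homPart f n s t := by
  have key (u : FreeAlgebra K (Fin 2)) :
      FreeAlgebra.lift K ![!![a, b; 0, s], !![c, d; 0, t]] u 0 0 = FreeAlgebra.lift K ![a, c] u ∧
      FreeAlgebra.lift K ![!![a, b; 0, s], !![c, d; 0, t]] u 1 0 = 0 ∧
      FreeAlgebra.lift K ![!![a, b; 0, s], !![c, d; 0, t]] u 1 1 =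
        FreeAlgebra.lift K ![s, t] u := by
    induction u using FreeAlgebra.induction with
    | grade0 r => simp [Matrix.algebraMap_matrix_apply]
    | grade1 j => fin_cases j <;> simp
    | mul u v hu hv =>
      obtain ⟨h1, h2, h3⟩ := hu
      obtain ⟨g1, g2, g3⟩ := hv
      simp [Matrix.mul_apply, h1, h2, h3, g1, g2, g3]
    | add u v hu hv =>
      obtain ⟨h1, h2, h3⟩ := hu
      obtain ⟨g1, g2, g3⟩ := hv
      simp [h1, h2, h3, g1, g2, g3]
  simpa [map_homPart] using
    key (homPart f n (FreeAlgebra.ι K (0 : Fin 2)) (FreeAlgebra.ι K (1 : Fin 2)))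

theorem matrixOfSeries_eval (f : NCSeries K) (a b s c d t : K) :
    matrixOfSeries (f.eval (degOne !![a, b; 0, s]) (degOne !![c, d; 0, t])) =
      !![f.eval (degOne a) (degOne c),
        PowerSeries.mk fun n => homPart f n !![a, b; 0, s] !![c, d; 0, t] 0 1;
        0, f.eval (degOne s) (degOne t)] := by
  ext i j n
  obtain ⟨h1, h2, h3⟩ := homPart_triangular f n a b s c d t
  rw [coeff_matrixOfSeries, coeff_eval_degOne]
  fin_cases i <;> fin_cases j <;> simp [coeff_eval_degOne, h1, h2, h3]

theorem matrixOfSeries_exp_idempotent (c s : K) :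
    matrixOfSeries (expSeries K (degOne (c • !![1, s; 0, 0]))) =
      !![expSeries K (degOne c), s • (expSeries K (degOne c) - 1); 0, 1] := by
  ext i j n
  have h (m : ℕ) : !![1, s; 0, 0] ^ (m + 1) = (!![1, s; 0, 0] : 𝕄) := by
    induction m with
    | zero => simp
    | succ m ih => rw [pow_succ, ih, Matrix.mul_fin_two]; simp
  rw [coeff_matrixOfSeries, coeff_expSeries_degOne, smul_pow]
  cases n with
  | zero =>
    have h0 : PowerSeries.constantCoeff (expSeries K (degOne c)) = 1 := by
      rw [← PowerSeries.coeff_zero_eq_constantCoeff_apply, coeff_expSeries_degOne]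
      simp
    fin_cases i <;> fin_cases j <;> simp [h0]
  | succ n =>
    rw [h]
    fin_cases i <;> fin_cases j <;>
      simp [coeff_expSeries_degOne, PowerSeries.coeff_one, mul_comm, mul_assoc]

theorem matrixOfSeries_exp_nilpotent (c : K) :
    matrixOfSeries (expSeries K (degOne (c • !![0, 1; 0, 0]))) =
      !![1, PowerSeries.monomial 1 c; 0, 1] := by
  ext i j n
  have h (m : ℕ) : !![0, 1; 0, 0] ^ (m + 2) = (0 : 𝕄) := by
    have h2 : !![0, 1; 0, 0] ^ 2 = (0 : 𝕄) := by
      rw [pow_two, Matrix.mul_fin_two]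
      ext i j; fin_cases i <;> fin_cases j <;> simp
    rw [pow_add, h2, mul_zero]
  rw [coeff_matrixOfSeries, coeff_expSeries_degOne, smul_pow]
  rcases n with _ | _ | n
  · fin_cases i <;> fin_cases j <;> simp [PowerSeries.coeff_monomial]
  · fin_cases i <;> fin_cases j <;> simp [PowerSeries.coeff_one]
  · rw [h]
    fin_cases i <;> fin_cases j <;> simp [PowerSeries.coeff_monomial, PowerSeries.coeff_one]

theorem expSeries_mul_expSeries_neg [CharZero K] (c : K) :
    expSeries K (degOne c) * expSeries K (degOne (-c)) = 1 := by
  have h (a : K) : expSeries K (degOne a) = PowerSeries.rescale a (PowerSeries.exp K) := by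
    ext n
    rw [coeff_expSeries_degOne, PowerSeries.coeff_rescale, PowerSeries.coeff_exp]
    simp [mul_comm]
  rw [h, h, PowerSeries.exp_mul_exp_eq_exp_add, add_neg_cancel, PowerSeries.rescale_zero_apply]
  simp

variable {μ : K} {Φ : NCSeries K}

theorem isBraidFamily_of_comm {ι S : Type*} [CommRing S] {T : ι → ι → S}
    (h : ∀ i j, T i j = T j i) : IsBraidFamily T where
  symm := h
  three _ _ _ _ _ _ := by rw [Ring.lie_def, mul_comm, sub_self]
  four _ _ _ _ _ _ _ _ _ _ := by rw [Ring.lie_def, mul_comm, sub_self]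

theorem IsAssociator.eval_ne_zero (hΦ : IsAssociator μ Φ) (a b : K) :
    Φ.eval (degOne a) (degOne b) ≠ 0 :=
  left_ne_zero_of_mul_eq_one (hΦ.inversion_mul a b)

/-- In a commutative ring every symmetric family satisfies the braid relations. With t_{0,1} as the
only nonzero generator the pentagon reads Φ(a,0)Φ(0,0) = Φ(0,0)Φ(a,0)Φ(a,0), and cancellation gives
the claim. -/
theorem IsAssociator.eval_zero_right (hΦ : IsAssociator μ Φ) (a : K) :
    Φ.eval (degOne a) (degOne 0) = 1 := by
  have h (c : K) := hΦ.pentagon_of_family (isBraidFamily_of_comm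
    (T := fun i j : Fin 4 => if (i = 0 ∧ j = 1) ∨ (i = 1 ∧ j = 0) then c else 0)
    (by intro i j; congr 1; simp only [eq_iff_iff]; tauto))
  have h0 : Φ.eval (degOne (0 : K)) (degOne 0) = 1 := by
    have := h 0
    simp only [ite_self, add_zero] at this
    have h1 := mul_left_cancel₀ (mul_ne_zero (hΦ.eval_ne_zero 0 0) (hΦ.eval_ne_zero 0 0))
      ((mul_one _).trans this)
    exact h1.symm
  have := h a
  simp [h0] at this
  exact (mul_left_cancel₀ (hΦ.eval_ne_zero a 0) ((mul_one _).trans this)).symm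

theorem IsAssociator.eval_zero_left (hΦ : IsAssociator μ Φ) (a : K) :
    Φ.eval (degOne 0) (degOne a) = 1 := by
  have := hΦ.inversion_mul a 0
  rwa [hΦ.eval_zero_right, one_mul] at this

/-- The functional equation of the part of an associator which is linear in `y`. -/
theorem IsAssociator.linear_part [CharZero K] (hΦ : IsAssociator 1 Φ) :
    (PowerSeries.mk fun n =>
      (1 + (-1) ^ n) * homPart Φ n (!![1, 0; 0, 0] : 𝕄) !![0, 1; 0, 0] 0 1) *
        (expSeries K (degOne (1 / 2 : K)) - expSeries K (degOne (-(1 / 2) : K))) =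
      PowerSeries.monomial 1 (1 / 2) *
        (expSeries K (degOne (1 / 2 : K)) + expSeries K (degOne (-(1 / 2) : K))) -
        (expSeries K (degOne (1 / 2 : K)) - expSeries K (degOne (-(1 / 2) : K))) := by
  let x : 𝕄 := !![1, 0; 0, 0]
  let y : 𝕄 := !![0, 1; 0, 0]
  let z : 𝕄 := !![-1, -1; 0, 0]
  have hxyz : x + y + z = 0 := by ext i j; fin_cases i <;> fin_cases j <;> simp [x, y, z]
  have hyxz : y + x + z = 0 := by rw [add_comm y, hxyz]
  have e1 := congrArg matrixOfSeries (hΦ.hexagon_of_eq hxyz)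
  have e2 := congrArg matrixOfSeries (hΦ.hexagon_of_eq hyxz)
  have e3 := congrArg matrixOfSeries (hΦ.inversion_mul x y)
  have e4 := congrArg matrixOfSeries (hΦ.inversion_mul y z)
  have e5 := congrArg matrixOfSeries (hΦ.inversion_mul x z)
  have hzexp : (1 / 2 : K) • z = (-(1 / 2) : K) • !![1, 1; 0, 0] := by
    ext i j; fin_cases i <;> fin_cases j <;> simp [z]
  -- Conjugation by the involution `h` takes (x, y) to (-z, -y), so Φ(z, y) is determined by Φ(x, y)
  -- up to the sign (-1)^n. The diagonal entries cancel because Φ(1, 0) = Φ(0, 0).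
  have hconj (n : ℕ) : homPart Φ n z y 0 1 = -((-1) ^ n * homPart Φ n x y 0 1) := by
    let h : 𝕄 := !![1, 1; 0, -1]
    have hh : h * h = 1 := by
      ext i j; fin_cases i <;> fin_cases j <;> simp [h]
    let g : 𝕄 →ₐ[K] 𝕄 := MulSemiringAction.toAlgHom K 𝕄
      (ConjAct.toConjAct (⟨h, h, hh, hh⟩ : 𝕄ˣ))
    have hg (a : 𝕄) : g a = h * a * h := rfl
    have hgx : g x = (-1 : K) • z := by
      rw [hg]; ext i j; fin_cases i <;> fin_cases j <;> simp [h, x, z]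
    have hgy : g y = (-1 : K) • y := by
      rw [hg]; ext i j; fin_cases i <;> fin_cases j <;> simp [h, y]
    have h1 := map_homPart g Φ n x y
    rw [hgx, hgy, homPart_smul_smul, hg] at h1
    obtain ⟨t1, t2, t3⟩ := homPart_triangular Φ n 1 0 0 0 1 0
    have h2 : homPart Φ n (1 : K) 0 = homPart Φ n 0 0 := by
      rw [← coeff_eval_degOne, ← coeff_eval_degOne, hΦ.eval_zero_right, hΦ.eval_zero_right]
    have h3 := congrFun (congrFun h1 0) 1
    have h4 : ((-1 : K) ^ n) * (-1) ^ n = 1 := by rw [← mul_pow]; simp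
    simp [Matrix.mul_apply, Matrix.vecMul, dotProduct, h, x, y, t1, t2, t3, h2] at h3
    change homPart Φ n z y 0 1 = -((-1) ^ n * homPart Φ n !![1, 0; 0, 0] !![0, 1; 0, 0] 0 1)
    linear_combination (-(-1) ^ n) * h3 - homPart Φ n z y 0 1 * h4
  have hC : (PowerSeries.mk fun n => (1 + (-1) ^ n) * homPart Φ n x y 0 1) =
      (PowerSeries.mk fun n => homPart Φ n x y 0 1) -
        PowerSeries.mk fun n => homPart Φ n z y 0 1 := by
    ext n
    simp only [PowerSeries.coeff_mk, map_sub, hconj]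
    ring
  change (PowerSeries.mk fun n => (1 + (-1) ^ n) * homPart Φ n x y 0 1) * _ = _
  rw [hC]
  rw [matrixOfSeries_one] at e1 e2 e3 e4 e5
  simp only [matrixOfSeries_mul, hzexp] at e1 e2 e3 e4 e5
  simp only [x, y, z, matrixOfSeries_exp_idempotent, matrixOfSeries_exp_nilpotent,
    matrixOfSeries_eval, hΦ.eval_zero_left, hΦ.eval_zero_right, zero_smul, one_smul]
    at e1 e2 e3 e4 e5 ⊢
  have hq := expSeries_mul_expSeries_neg (1 / 2 : K)
  generalize expSeries K (degOne (1 / 2 : K)) = q at *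
  generalize expSeries K (degOne (-(1 / 2) : K)) = q' at *
  generalize (PowerSeries.mk fun n => homPart Φ n (!![1, 0; 0, 0] : 𝕄) !![0, 1; 0, 0] 0 1) = C at *
  generalize (PowerSeries.mk fun n => homPart Φ n (!![0, 1; 0, 0] : 𝕄) !![1, 0; 0, 0] 0 1) = C' at *
  generalize (PowerSeries.mk fun n => homPart Φ n (!![-1, -1; 0, 0] : 𝕄) !![0, 1; 0, 0] 0 1) = B at *
  generalize (PowerSeries.mk fun n => homPart Φ n (!![0, 1; 0, 0] : 𝕄) !![-1, -1; 0, 0] 0 1) = B' at *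
  generalize (PowerSeries.mk fun n => homPart Φ n (!![1, 0; 0, 0] : 𝕄) !![-1, -1; 0, 0] 0 1) = D' at *
  generalize (PowerSeries.mk fun n => homPart Φ n (!![-1, -1; 0, 0] : 𝕄) !![1, 0; 0, 0] 0 1) = D at *
  generalize Φ.eval (degOne (1 : K)) (degOne (-1 : K)) = f' at *
  generalize Φ.eval (degOne (-1 : K)) (degOne (1 : K)) = f at *
  generalize PowerSeries.monomial 1 (1 / 2 : K) = H at *
  have a1 := congrFun (congrFun e1 0) 0
  have b1 := congrFun (congrFun e1 0) 1
  have b2 := congrFun (congrFun e2 0) 1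
  have b3 := congrFun (congrFun e3 0) 1
  have b4 := congrFun (congrFun e4 0) 1
  have a5 := congrFun (congrFun e5 0) 0
  have b5 := congrFun (congrFun e5 0) 1
  simp [Matrix.mul_apply] at a1 b1 b2 b3 b4 a5 b5
  -- The diagonal of the hexagon makes the scalar value Φ(-1, 1) trivial.
  have hf : f = 1 := by linear_combination a1 - f * hq
  have hf' : f' = 1 := by simpa [hf] using a5
  subst hf hf'
  -- The upper right entries of the two hexagons, with the values at exchanged arguments eliminated
  -- by inversion. The combination `q * c2 - q' * c1` removes the last unknown `D`.
  have c1 : C - B + H + 1 - q + q * D = 0 := by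
    linear_combination b1 - (C + H + B' + 1) * hq - b4
  have c2 : C - B - H + 1 - q' + q' * D = 0 := by
    linear_combination C' * hq + q' * b5 + b3 - b2
  linear_combination q * c2 - q' * c1

end Triangular

/-! ### The coefficient of the leading pole -/

section Coefficient

variable {p : ℕ} [hp : Fact p.Prime] {Φ : NCSeries ℚ_[p]}

variable (p) in
/-- The inclusion of the matrices over `ℤ_p` into those over `ℚ_p`. -/
def matrixCoe : Matrix (Fin 2) (Fin 2) ℤ_[p] →+* Matrix (Fin 2) (Fin 2) ℚ_[p] :=
  (PadicInt.Coe.ringHom : ℤ_[p] →+* ℚ_[p]).mapMatrix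

theorem isScalarExt_matrixCoe : IsScalarExt p (matrixCoe p) := by
  intro r s
  ext i j
  exact PadicInt.coe_mul _ _

theorem matrixCoe_apply (M : Matrix (Fin 2) (Fin 2) ℤ_[p]) (i j : Fin 2) :
    matrixCoe p M i j = (M i j : ℚ_[p]) := rfl

local notation "E₁" => (!![1, 0; 0, 0] : Matrix (Fin 2) (Fin 2) _)
local notation "E₂" => (!![0, 1; 0, 0] : Matrix (Fin 2) (Fin 2) _)

theorem matrixCoe_fst : matrixCoe p E₁ = E₁ := by
  ext i j; fin_cases i <;> fin_cases j <;> simp [matrixCoe]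

theorem matrixCoe_snd : matrixCoe p E₂ = E₂ := by
  ext i j; fin_cases i <;> fin_cases j <;> simp [matrixCoe]

theorem norm_linear_coeff_le (hb : HasSimplePoleBound p Φ) {n : ℕ} (hn : n < p - 1) :
    ‖homPart Φ n (E₁ : Matrix (Fin 2) (Fin 2) ℚ_[p]) E₂ 0 1‖ ≤ 1 := by
  have h := map_homPart_of_integral isScalarExt_matrixCoe
    (fun w hw => hb.norm_le (w := w) (by lia)) (n := n) E₁ E₂
  rw [matrixCoe_fst, matrixCoe_snd] at h
  rw [h, matrixCoe_apply]
  exact PadicInt.norm_le_one _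

theorem exists_linear_coeff (hb : HasSimplePoleBound p Φ) :
    ∃ r : ℤ_[p], (p : ℚ_[p]) * homPart Φ (p - 1) (E₁ : Matrix (Fin 2) (Fin 2) ℚ_[p]) E₂ 0 1 = r ∧
      PadicInt.toZMod r = leading Φ (E₁ : Matrix (Fin 2) (Fin 2) (ZMod p)) E₂ 0 1 := by
  refine ⟨homPart (topLift Φ) (p - 1) E₁ E₂ 0 1, ?_, ?_⟩
  · have h := map_homPart_topLift isScalarExt_matrixCoe hb E₁ E₂
    rw [matrixCoe_fst, matrixCoe_snd] at h
    rw [← matrixCoe_apply, ← h, Matrix.smul_apply, smul_eq_mul]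
  · have h := map_topLift_homPart (Φ := Φ)
      (PadicInt.toZMod : ℤ_[p] →+* ZMod p).mapMatrix
      (fun c s => by ext i j; simp) (p - 1) E₁ E₂
    have h1 : (PadicInt.toZMod : ℤ_[p] →+* ZMod p).mapMatrix E₁ = E₁ := by
      ext i j; fin_cases i <;> fin_cases j <;> simp
    have h3 : (PadicInt.toZMod : ℤ_[p] →+* ZMod p).mapMatrix E₂ = E₂ := by
      ext i j; fin_cases i <;> fin_cases j <;> simp
    rw [h1, h3] at h
    exact congrFun (congrFun h 0) 1

theorem norm_exp_coeff_sub_le (h2 : 2 < p) {m : ℕ} (hm : m < p) :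
    ‖PowerSeries.coeff m
      (expSeries ℚ_[p] (degOne (1 / 2 : ℚ_[p])) - expSeries ℚ_[p] (degOne (-(1 / 2) : ℚ_[p])))‖ ≤ 1 := by
  rw [map_sub, coeff_expSeries_degOne, coeff_expSeries_degOne]
  refine (PadicInt.subring p).sub_mem (norm_exp_coeff h2 hm) ?_
  rw [neg_pow, smul_eq_mul, mul_left_comm]
  exact (PadicInt.subring p).mul_mem (pow_mem (neg_mem (one_mem _)) _) (norm_exp_coeff h2 hm)

/-- The matrix entry is the coefficient of x^{p-2}y: since E₂E₁ = E₂² = 0 and E₁E₂ = E₂, only the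
words x^m y reach it. -/
theorem two_mul_leading (h2 : 2 < p) (hΦ : IsAssociator 1 Φ) (hb : HasSimplePoleBound p Φ) :
    2 * leading Φ (E₁ : Matrix (Fin 2) (Fin 2) (ZMod p)) E₂ 0 1 = 1 := by
  obtain ⟨r, hr, hr'⟩ := exists_linear_coeff hb
  obtain ⟨n, hn⟩ : ∃ n, p = n + 2 := ⟨p - 2, by lia⟩
  have hn1 : p - 1 = n + 1 := by lia
  have hodd : Odd p := hp.out.eq_two_or_odd'.resolve_left (by lia)
  have heven : Even (n + 1) := by
    rw [← hn1]
    exact hodd.tsub_odd odd_one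
  rw [hn1] at hr
  set c : ℕ → ℚ_[p] := fun m => homPart Φ m (E₁ : Matrix (Fin 2) (Fin 2) ℚ_[p]) E₂ 0 1 with hc
  set Q := expSeries ℚ_[p] (degOne (1 / 2 : ℚ_[p])) with hQ
  set Q' := expSeries ℚ_[p] (degOne (-(1 / 2) : ℚ_[p])) with hQ'
  -- Degree `p` is the right one: `Q - Q'` starts as ħ, so `c (p - 1)` appears with the factor 1 +
  -- (-1)^{p-1} = 2, while the other terms on the left are integral or zero. On the right 1/`p`!
  -- brings in the pole.
  have h : PowerSeries.coeff (n + 2) ((PowerSeries.mk fun m => (1 + (-1) ^ m) * c m) * (Q - Q')) =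
    PowerSeries.coeff (n + 2) (PowerSeries.monomial 1 (1 / 2) * (Q + Q') - (Q - Q')) :=
      congrArg _ hΦ.linear_part
  have hX : PowerSeries.monomial 1 (1 / 2 : ℚ_[p]) = (1 / 2 : ℚ_[p]) • PowerSeries.X := by
    ext m
    simp [PowerSeries.coeff_monomial, PowerSeries.coeff_X]
  have hc0 : c 0 = 0 := by simp [hc, homPart_zero_degree]
  have hM : ∑ k ∈ Finset.range n, (1 + (-1) ^ (k + 1)) * c (k + 1) *
      PowerSeries.coeff (n + 2 - (k + 1)) (Q - Q') ∈ PadicInt.subring p := by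
    refine sum_mem fun k hk => ?_
    have := Finset.mem_range.1 hk
    exact mul_mem (mul_mem (add_mem (one_mem _) (pow_mem (neg_mem (one_mem _)) _))
      (norm_linear_coeff_le hb (by lia))) (norm_exp_coeff_sub_le h2 (by lia))
  obtain ⟨M, hM'⟩ : ∃ M : ℤ_[p], (M : ℚ_[p]) =
      ∑ k ∈ Finset.range n, (1 + (-1) ^ (k + 1)) * c (k + 1) *
        PowerSeries.coeff (n + 2 - (k + 1)) (Q - Q') := ⟨⟨_, hM⟩, rfl⟩
  rw [PowerSeries.coeff_mul, Finset.Nat.sum_antidiagonal_eq_sum_range_succ_mk,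
    Finset.sum_range_succ, Finset.sum_range_succ, Finset.sum_range_succ'] at h
  simp only [PowerSeries.coeff_mk] at h
  rw [← hM', hc0, hX, smul_mul_assoc, map_sub (PowerSeries.coeff (n + 2)), PowerSeries.coeff_smul,
    PowerSeries.coeff_succ_X_mul, show n + 2 - (n + 1) = 1 by lia, heven.neg_one_pow] at h
  simp only [Nat.sub_self, map_sub, map_add, hQ, hQ', coeff_expSeries_degOne, neg_pow (1 / 2 : ℚ_[p]),
    heven.neg_one_pow, (hn ▸ hodd).neg_one_pow] at h
  have hf : ((n + 1).factorial : ℚ_[p]) ≠ 0 := Nat.cast_ne_zero.2 (Nat.factorial_ne_zero _)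
  have hp0 : (p : ℚ_[p]) ≠ 0 := Nat.cast_ne_zero.2 hp.out.ne_zero
  have hpn : (n : ℚ_[p]) + 2 = p := by exact_mod_cast hn.symm
  have hn1' : ((n : ℚ_[p]) + 1 + 1) = p := by rw [← hpn]; ring
  have key : (2 : ℚ_[p]) ^ (n + 1) * (n + 1).factorial * (p * M + 2 * r) = p - 1 := by
    rw [← hr]
    change _ * (_ + 2 * (_ * c (n + 1))) = _
    have h3 : (M : ℚ_[p]) + 2 * c (n + 1) = (1 / 2) ^ (n + 1) / ((n + 1).factorial : ℚ_[p]) -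
        (1 / 2) ^ (n + 1) / (p * ((n + 1).factorial : ℚ_[p])) := by
      rw [Nat.factorial_succ (n + 1)] at h
      push_cast at h
      rw [hn1', pow_succ (1 / 2 : ℚ_[p]) (n + 1)] at h
      simp only [smul_eq_mul, Nat.factorial_one, Nat.factorial_zero, Nat.cast_one] at h
      linear_combination h
    have h4 : (p : ℚ_[p]) * M + 2 * (p * c (n + 1)) = p * (M + 2 * c (n + 1)) := by ring
    have h5 : (2 : ℚ_[p]) ^ (n + 1) * (1 / 2) ^ (n + 1) = 1 := by rw [← mul_pow]; simp
    rw [h4, h3]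
    field_simp
    linear_combination (p - 1 : ℚ_[p]) * h5
  have key' : (2 : ℤ_[p]) ^ (n + 1) * (n + 1).factorial * (p * M + 2 * r) = p - 1 := by
    exact PadicInt.ext (by push_cast; exact key)
  -- Modulo `p`, Fermat gives 2^{p-1} = 1 and Wilson gives (`p` - 1)! = -1.
  have h5 := congrArg PadicInt.toZMod key'
  simp only [map_mul, map_pow, map_add, map_sub, map_ofNat, map_natCast, map_one, hr',
    CharP.cast_eq_zero, zero_mul, zero_add, zero_sub] at h5
  rw [← hn1, ZMod.pow_card_sub_one_eq_one, ZMod.wilsons_lemma] at h5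
  · linear_combination -h5
  · have h6 : ((2 : ℕ) : ZMod p) ≠ 0 := by
      rw [Ne, ZMod.natCast_eq_zero_iff]
      exact fun hd => by have := Nat.le_of_dvd two_pos hd; lia
    exact_mod_cast h6

end Coefficient

/-! ### Coefficients of noncommutative polynomials -/

section WordCoeff

variable {k : Type*} [CommRing k]

theorem basisFreeMonoid_apply (w : List (Fin 2)) :
    FreeAlgebra.basisFreeMonoid k (Fin 2) (FreeMonoid.ofList w) = (w.map (FreeAlgebra.ι k)).prod := by
  simp [FreeAlgebra.basisFreeMonoid, FreeAlgebra.equivMonoidAlgebraFreeMonoid, FreeMonoid.lift_apply]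

/-- The coefficient of a word in a noncommutative polynomial. -/
def wordCoeff (w : List (Fin 2)) : FreeAlgebra k (Fin 2) →ₗ[k] k :=
  (FreeAlgebra.basisFreeMonoid k (Fin 2)).coord (FreeMonoid.ofList w)

theorem wordCoeff_prod (w w' : List (Fin 2)) :
    wordCoeff w (w'.map (FreeAlgebra.ι k)).prod = if w' = w then 1 else 0 := by
  classical
  rw [← basisFreeMonoid_apply, wordCoeff, Module.Basis.coord_apply, Module.Basis.repr_self,
    Finsupp.single_apply]
  simp

theorem wordCoeff_homPart (f : NCSeries k) (w : List (Fin 2)) :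
    wordCoeff w (homPart f w.length (FreeAlgebra.ι k 0) (FreeAlgebra.ι k 1)) = f w := by
  simp only [homPart, vec_ι, map_sum, map_smul, wordCoeff_prod]
  rw [Finset.sum_eq_single w.get]
  · simp
  · intro v _ hv
    rw [if_neg, smul_zero]
    exact fun h => hv (List.ofFn_injective (h.trans (List.ofFn_get w).symm))
  · simp

end WordCoeff

/-! ### The lattice of integral polynomials and series integral up to a degree -/

section Integrality

variable {p : ℕ} [hp : Fact p.Prime]

variable (p) in
/-- The inclusion of the polynomials with coefficients in `ℤ_p` into those over `ℚ_p`. -/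
def polyCoe : FreeAlgebra ℤ_[p] (Fin 2) →ₐ[ℤ_[p]] FreeAlgebra ℚ_[p] (Fin 2) :=
  FreeAlgebra.lift ℤ_[p] (FreeAlgebra.ι ℚ_[p])

theorem isScalarExt_polyCoe : IsScalarExt p
    (polyCoe p : FreeAlgebra ℤ_[p] (Fin 2) →+* FreeAlgebra ℚ_[p] (Fin 2)) := by
  intro r s
  have h : (r : ℚ_[p]) = algebraMap ℤ_[p] ℚ_[p] r := rfl
  rw [h, algebraMap_smul]
  exact map_smul (polyCoe p) r s

theorem wordCoeff_polyCoe (w : List (Fin 2)) (b : FreeAlgebra ℤ_[p] (Fin 2)) :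
    wordCoeff w (polyCoe p b) = (wordCoeff w b : ℤ_[p]) := by
  have h : ((wordCoeff w).restrictScalars ℤ_[p]).comp (polyCoe p).toLinearMap =
      (Algebra.linearMap ℤ_[p] ℚ_[p]).comp (wordCoeff w) := by
    refine (FreeAlgebra.basisFreeMonoid ℤ_[p] (Fin 2)).ext fun v => ?_
    have hv : polyCoe p ((FreeMonoid.toList v).map (FreeAlgebra.ι ℤ_[p])).prod =
        ((FreeMonoid.toList v).map (FreeAlgebra.ι ℚ_[p])).prod := by
      rw [map_list_prod, List.map_map]
      congr 2
      ext i
      simp [polyCoe]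
    have hb := basisFreeMonoid_apply (k := ℤ_[p]) (FreeMonoid.toList v)
    rw [FreeMonoid.ofList_toList] at hb
    rw [hb]
    simp only [LinearMap.comp_apply, LinearMap.restrictScalars_apply, AlgHom.toLinearMap_apply, hv,
      wordCoeff_prod, Algebra.linearMap_apply]
    split_ifs <;> simp
  exact LinearMap.congr_fun h b

local notation "𝓍" => FreeAlgebra.ι ℚ_[p] (0 : Fin 2)
local notation "𝓎" => FreeAlgebra.ι ℚ_[p] (1 : Fin 2)

variable (p) in
/-- The lattice of the polynomials with integral coefficients. -/
def integralPolys : Subring (FreeAlgebra ℚ_[p] (Fin 2)) :=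
  (polyCoe p : FreeAlgebra ℤ_[p] (Fin 2) →+* FreeAlgebra ℚ_[p] (Fin 2)).range

local notation "𝓛" => integralPolys p

theorem smul_mem_integralPolys {q : ℚ_[p]} (hq : ‖q‖ ≤ 1) {a : FreeAlgebra ℚ_[p] (Fin 2)}
    (ha : a ∈ 𝓛) : q • a ∈ 𝓛 := by
  obtain ⟨b, rfl⟩ := ha
  exact ⟨integralLift q • b, by rw [isScalarExt_polyCoe, coe_integralLift hq]⟩

theorem ι_mem_integralPolys (i : Fin 2) : FreeAlgebra.ι ℚ_[p] i ∈ 𝓛 :=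
  ⟨FreeAlgebra.ι ℤ_[p] i, by simp [polyCoe]⟩

theorem norm_wordCoeff_le (w : List (Fin 2)) {a : FreeAlgebra ℚ_[p] (Fin 2)} (ha : a ∈ 𝓛) :
    ‖wordCoeff w a‖ ≤ 1 := by
  obtain ⟨b, rfl⟩ := ha
  exact (congrArg norm (wordCoeff_polyCoe w b)).trans_le (PadicInt.norm_le_one _)

theorem prod_mem_integralPolys (w : List (Fin 2)) :
    (w.map (FreeAlgebra.ι ℚ_[p])).prod ∈ 𝓛 := by
  refine Subring.list_prod_mem _ fun a ha => ?_
  obtain ⟨i, -, rfl⟩ := List.mem_map.1 ha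
  exact ι_mem_integralPolys i

theorem homPart_mem_integralPolys {f : NCSeries ℚ_[p]} {n : ℕ}
    (hf : ∀ w, w.length = n → ‖f w‖ ≤ 1) : homPart f n 𝓍 𝓎 ∈ 𝓛 := by
  refine Subring.sum_mem _ fun w _ => smul_mem_integralPolys (hf _ List.length_ofFn) ?_
  rw [vec_ι]
  exact prod_mem_integralPolys _

theorem norm_le_of_homPart_mem {f : NCSeries ℚ_[p]} {n : ℕ} (h : homPart f n 𝓍 𝓎 ∈ 𝓛)
    (w : List (Fin 2)) (hw : w.length = n) : ‖f w‖ ≤ 1 := by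
  subst hw
  rw [← wordCoeff_homPart f w]
  exact norm_wordCoeff_le w h

/-- The series whose coefficients of degree at most `n` are integral. -/
def IsIntegralUpTo (n : ℕ) (F : (FreeAlgebra ℚ_[p] (Fin 2))⟦X⟧) : Prop :=
  ∀ m ≤ n, PowerSeries.coeff m F ∈ 𝓛

theorem IsIntegralUpTo.mul {n : ℕ} {F G : (FreeAlgebra ℚ_[p] (Fin 2))⟦X⟧}
    (hF : IsIntegralUpTo n F) (hG : IsIntegralUpTo n G) : IsIntegralUpTo n (F * G) := by
  intro m hm
  rw [PowerSeries.coeff_mul]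
  refine Subring.sum_mem _ fun q hq => ?_
  have := Finset.HasAntidiagonal.mem_antidiagonal.1 hq
  exact Subring.mul_mem _ (hF _ (by lia)) (hG _ (by lia))

theorem isIntegralUpTo_one (n : ℕ) :
    IsIntegralUpTo n (1 : (FreeAlgebra ℚ_[p] (Fin 2))⟦X⟧) := by
  intro m _
  rw [PowerSeries.coeff_one]
  split_ifs
  exacts [Subring.one_mem _, Subring.zero_mem _]

theorem IsIntegralUpTo.list_prod {n : ℕ} {l : List (FreeAlgebra ℚ_[p] (Fin 2))⟦X⟧}
    (h : ∀ F ∈ l, IsIntegralUpTo n F) : IsIntegralUpTo n l.prod := by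
  induction l with
  | nil => exact isIntegralUpTo_one n
  | cons F l ih =>
    rw [List.prod_cons]
    exact (h F (by simp)).mul (ih fun G hG => h G (by simp [hG]))

end Integrality

/-! ### Substituting series without constant term -/

section Substitution

variable {K U : Type*} [Field K] [Ring U] [Algebra K U]

theorem coeff_list_prod_of_order_one (c : U⟦X⟧ → U) {l : List U⟦X⟧}
    (h : ∀ F ∈ l, PowerSeries.coeff 0 F = 0 ∧ PowerSeries.coeff 1 F = c F) :
    (∀ m < l.length, PowerSeries.coeff m l.prod = 0) ∧
      PowerSeries.coeff l.length l.prod = (l.map c).prod := by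
  induction l with
  | nil => simp
  | cons F l ih =>
    obtain ⟨h0, h1⟩ := h F (by simp)
    obtain ⟨g0, g1⟩ := ih fun G hG => h G (by simp [hG])
    have key (m : ℕ) (hm : m ≤ l.length) : PowerSeries.coeff (m + 1) (F * l.prod) =
        c F * PowerSeries.coeff m l.prod := by
      rw [PowerSeries.coeff_mul, Finset.sum_eq_single (1, m), h1]
      · rintro ⟨a, b⟩ hab hne
        have hab' : a + b = m + 1 := Finset.HasAntidiagonal.mem_antidiagonal.1 hab
        rcases Nat.eq_zero_or_pos a with rfl | ha
        · simp only [h0, zero_mul]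
        · have : b < l.length := by
            by_contra hb
            exact hne (by ext <;> simp <;> lia)
          simp only [g0 b this, mul_zero]
      · intro h
        exact absurd (Finset.HasAntidiagonal.mem_antidiagonal.2 (add_comm 1 m)) h
    refine ⟨fun m hm => ?_, ?_⟩
    · rw [List.prod_cons]
      rcases m with _ | m
      · rw [PowerSeries.coeff_mul, Finset.Nat.antidiagonal_zero, Finset.sum_singleton, h0, zero_mul]
      · rw [List.length_cons] at hm
        rw [key m (by lia), g0 m (by lia), mul_zero]
    · rw [List.prod_cons, List.length_cons, key _ le_rfl, g1, List.map_cons, List.prod_cons]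

/-- The coefficient of degree `m` of `f(A, B)` is the sum of the homogeneous part of degree `m` of `f`
and of terms which depend only on the coefficients of `f` of lower degree. -/
theorem coeff_eval_eq_homPart_add (f : NCSeries K) {A B : U⟦X⟧} {a b : U}
    (hA : PowerSeries.coeff 0 A = 0) (hA' : PowerSeries.coeff 1 A = a)
    (hB : PowerSeries.coeff 0 B = 0) (hB' : PowerSeries.coeff 1 B = b) (m : ℕ) :
    PowerSeries.coeff m (f.eval A B) = homPart f m a b +
      ∑ k ∈ Finset.range m, ∑ w : Fin k → Fin 2,
        f (List.ofFn w) • PowerSeries.coeff m ((List.ofFn w).map ![A, B]).prod := by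
  rw [NCSeries.eval, PowerSeries.coeff_mk, Finset.sum_range_succ, add_comm]
  congr 1
  refine Finset.sum_congr rfl fun w _ => ?_
  have h := (coeff_list_prod_of_order_one (PowerSeries.coeff 1) (l := (List.ofFn w).map ![A, B]) ?_).2
  · rw [List.map_map, map_vec, hA', hB', List.length_map, List.length_ofFn] at h
    rw [h]
  · intro F hF
    obtain ⟨i, -, rfl⟩ := List.mem_map.1 hF
    fin_cases i
    exacts [⟨hA, rfl⟩, ⟨hB, rfl⟩]

end Substitution

/-! ### The generator of an associator -/

section Generator

variable {p : ℕ} [hp : Fact p.Prime] {Φ ψ : NCSeries ℚ_[p]}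

local notation "𝓍" => FreeAlgebra.ι ℚ_[p] (0 : Fin 2)
local notation "𝓎" => FreeAlgebra.ι ℚ_[p] (1 : Fin 2)
local notation "𝓛" => integralPolys p

theorem isIntegralUpTo_eval (hb : HasSimplePoleBound p Φ) (i j : Fin 2) : IsIntegralUpTo (p - 2)
      (Φ.eval (degOne (FreeAlgebra.ι ℚ_[p] i)) (degOne (FreeAlgebra.ι ℚ_[p] j))) := by
  intro m hm
  have h2 := hp.out.two_le
  have h := map_homPart_of_integral isScalarExt_polyCoe (fun w hw => hb.norm_le (w := w) (by lia))
    (n := m) (FreeAlgebra.ι ℤ_[p] i) (FreeAlgebra.ι ℤ_[p] j)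
  rw [coeff_eval_degOne]
  simp only [AlgHom.coe_toRingHom, polyCoe, FreeAlgebra.lift_ι_apply] at h
  rw [h]
  exact ⟨_, rfl⟩

theorem mul_degOne_mul {U : Type*} [Ring U] (F G : U⟦X⟧) (a : U) :
    F * degOne a * G = F * PowerSeries.C a * G * PowerSeries.X := by
  have h : degOne a = PowerSeries.C a * PowerSeries.X := by
    ext n
    simp [degOne, PowerSeries.coeff_monomial, PowerSeries.coeff_X]
  rw [h, ← mul_assoc, mul_assoc _ PowerSeries.X, ← (PowerSeries.commute_X G).eq, ← mul_assoc]

/-- The central factor ħ of the middle term shifts degrees by one. Therefore Φ(y, x) y Φ(x, y) is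
still integral in degree `p - 1`, although Φ need not be. -/
theorem IsIntegralUpTo.mul_degOne_mul {n : ℕ} {F G : (FreeAlgebra ℚ_[p] (Fin 2))⟦X⟧}
    (hF : IsIntegralUpTo n F) (hG : IsIntegralUpTo n G) {a : FreeAlgebra ℚ_[p] (Fin 2)}
    (ha : a ∈ 𝓛) : IsIntegralUpTo (n + 1) (F * degOne a * G) := by
  have hC : IsIntegralUpTo n (PowerSeries.C a) := by
    intro m _
    rw [PowerSeries.coeff_C]
    split_ifs
    exacts [ha, Subring.zero_mem _]
  rw [KashiwaraVergne.mul_degOne_mul]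
  rintro (_ | m) hm
  · rw [PowerSeries.coeff_zero_mul_X]
    exact Subring.zero_mem _
  · rw [PowerSeries.coeff_succ_mul_X]
    exact (hF.mul hC).mul hG m (by lia)

variable (Φ) in
/-- The series `Φ(y, x) y Φ(x, y)`. -/
def conjY : (FreeAlgebra ℚ_[p] (Fin 2))⟦X⟧ :=
  Φ.eval (yhat ℚ_[p]) (xhat _) * yhat _ * Φ.eval (xhat _) (yhat _)

theorem isIntegralUpTo_conjY (h2 : 2 < p) (hb : HasSimplePoleBound p Φ) :
    IsIntegralUpTo (p - 1) (conjY Φ) := by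
  rw [show p - 1 = p - 2 + 1 by lia]
  exact (isIntegralUpTo_eval hb 1 0).mul_degOne_mul (isIntegralUpTo_eval hb 0 1)
    (ι_mem_integralPolys 1)

theorem coeff_conjY (hb : HasSimplePoleBound p Φ) :
    PowerSeries.coeff 0 (conjY Φ) = 0 ∧ PowerSeries.coeff 1 (conjY Φ) = 𝓎 := by
  have h (i j : Fin 2) : PowerSeries.constantCoeff
      (Φ.eval (degOne (FreeAlgebra.ι ℚ_[p] i)) (degOne (FreeAlgebra.ι ℚ_[p] j))) = 1 := by
    rw [← PowerSeries.coeff_zero_eq_constantCoeff_apply, coeff_eval_degOne, homPart_zero_degree,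
      hb.const, one_smul]
  rw [conjY, yhat, mul_degOne_mul, PowerSeries.coeff_zero_mul_X, PowerSeries.coeff_succ_mul_X,
    PowerSeries.coeff_zero_eq_constantCoeff_apply, map_mul, map_mul, xhat, h, h]
  simp

/-- Since Φ⁻¹yΦ = y + higher terms, substitution changes ψ_m only by terms built from coefficients
of ψ of lower degree, which are integral by assumption. -/
theorem coeff_eval_conjY (h2 : 2 < p) (hb : HasSimplePoleBound p Φ) {m : ℕ} (hm : m ≤ p - 1)
    (hψ : ∀ w : List (Fin 2), w.length < m → ‖ψ w‖ ≤ 1) :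
    PowerSeries.coeff m (ψ.eval (xhat ℚ_[p]) (conjY Φ)) - homPart ψ m 𝓍 𝓎 ∈ 𝓛 := by
  have hx (n : ℕ) : IsIntegralUpTo n (xhat ℚ_[p]) := by
    intro l _
    rw [xhat, degOne, PowerSeries.coeff_monomial]
    split_ifs
    exacts [ι_mem_integralPolys 0, Subring.zero_mem _]
  rw [coeff_eval_eq_homPart_add ψ (a := 𝓍) (by simp [xhat, degOne, PowerSeries.coeff_monomial])
    (by simp [xhat, degOne]) (coeff_conjY hb).1 (coeff_conjY hb).2, add_sub_cancel_left]
  refine Subring.sum_mem _ fun k hk => Subring.sum_mem _ fun w _ => smul_mem_integralPolys ?_ ?_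
  · exact hψ _ (by simpa using hk)
  · refine IsIntegralUpTo.list_prod (n := p - 1) (fun F hF => ?_) m hm
    obtain ⟨i, -, rfl⟩ := List.mem_map.1 hF
    fin_cases i
    exacts [hx _, isIntegralUpTo_conjY h2 hb]

theorem IsGenerator.eq (hΦ : IsAssociator 1 Φ) (h : IsGenerator Φ ψ) :
    Φ.eval (yhat ℚ_[p]) (xhat _) * (scalingDeriv Φ).eval (xhat _) (yhat _) =
      ψ.eval (xhat _) (conjY Φ) := by
  have h' := h
  simp only [IsGenerator, hΦ.inverse_eq] at h'
  exact h'

theorem isIntegralUpTo_scalingDeriv (hb : HasSimplePoleBound p Φ) :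
    IsIntegralUpTo (p - 2) ((scalingDeriv Φ).eval (xhat ℚ_[p]) (yhat _)) := by
  intro m hm
  have := hp.out.two_le
  rw [xhat, yhat, coeff_eval_degOne]
  refine homPart_mem_integralPolys fun w hw => ?_
  refine (PadicInt.subring p).mul_mem (natCast_mem (PadicInt.subring p) _) ?_
  exact hb.norm_le (by lia)

theorem homPart_scalingDeriv (n : ℕ) : homPart (scalingDeriv Φ) n 𝓍 𝓎 =
    (n : ℚ_[p]) • homPart Φ n 𝓍 𝓎 := by
  rw [← homPart_smul_coeff]
  exact homPart_congr (fun w hw => by rw [scalingDeriv, hw]; rfl) _ _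

/-- The defining equation is triangular in the degree and is solved for ψ inductively; below degree
`p - 1` its left side is integral. -/
theorem IsGenerator.norm_le (h2 : 2 < p) (hΦ : IsAssociator 1 Φ) (hb : HasSimplePoleBound p Φ)
    (h : IsGenerator Φ ψ) {w : List (Fin 2)} (hw : w.length < p - 1) : ‖ψ w‖ ≤ 1 := by
  induction hm : w.length using Nat.strong_induction_on generalizing w with
  | _ m ih =>
    have h1 := coeff_eval_conjY (ψ := ψ) h2 hb (m := m) (by lia)
      (fun v hv => ih _ hv (by lia) rfl)
    have h3 := (isIntegralUpTo_eval hb 1 0).mul (isIntegralUpTo_scalingDeriv hb) m (by lia)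
    rw [← h.eq hΦ] at h1
    have h4 := Subring.sub_mem _ h3 h1
    refine norm_le_of_homPart_mem ?_ w hm
    simpa [xhat, yhat] using h4

/-- The scaling derivative has no constant term, so the pole of the factor Φ(y, x) in degree `p - 1`
is never reached; only 1·(`p` - 1)Φ_{p-1} can fail to be integral. -/
theorem IsGenerator.homPart_top (h2 : 2 < p) (hΦ : IsAssociator 1 Φ)
    (hb : HasSimplePoleBound p Φ) (h : IsGenerator Φ ψ) :
    homPart ψ (p - 1) 𝓍 𝓎 - (p - 1 : ℚ_[p]) • homPart Φ (p - 1) 𝓍 𝓎 ∈ 𝓛 := by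
  have h1 := coeff_eval_conjY (ψ := ψ) h2 hb le_rfl (fun v hv => h.norm_le h2 hΦ hb hv)
  rw [← h.eq hΦ] at h1
  have h3 : PowerSeries.coeff (p - 1) (Φ.eval (yhat ℚ_[p]) (xhat _) *
      (scalingDeriv Φ).eval (xhat _) (yhat _)) - (p - 1 : ℚ_[p]) • homPart Φ (p - 1) 𝓍 𝓎 ∈ 𝓛 := by
    have hn : p - 1 = p - 2 + 1 := by lia
    have hc : ((p - 1 : ℕ) : ℚ_[p]) = p - 1 := by rw [Nat.cast_sub (by lia), Nat.cast_one]
    have h0 : PowerSeries.coeff 0 ((scalingDeriv Φ).eval (xhat ℚ_[p]) (yhat _)) = 0 := by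
      rw [xhat, yhat, coeff_eval_degOne, homPart_scalingDeriv]
      simp
    have h0' : PowerSeries.coeff 0 (Φ.eval (yhat ℚ_[p]) (xhat _)) = 1 := by
      rw [xhat, yhat, coeff_eval_degOne, homPart_zero_degree, hb.const, one_smul]
    have ht : PowerSeries.coeff (p - 1) ((scalingDeriv Φ).eval (xhat ℚ_[p]) (yhat _)) =
        (p - 1 : ℚ_[p]) • homPart Φ (p - 1) 𝓍 𝓎 := by
      rw [xhat, yhat, coeff_eval_degOne, homPart_scalingDeriv, hc]
    rw [PowerSeries.coeff_mul, Finset.Nat.sum_antidiagonal_eq_sum_range_succ_mk,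
      Finset.sum_range_succ, hn, Finset.sum_range_succ', ← hn]
    simp only [Nat.sub_self, Nat.sub_zero, h0, h0', mul_zero, add_zero, one_mul, ht,
      add_sub_cancel_right]
    refine Subring.sum_mem _ fun k hk => ?_
    have := Finset.mem_range.1 hk
    exact Subring.mul_mem _ (isIntegralUpTo_eval hb 1 0 _ (by lia))
      (isIntegralUpTo_scalingDeriv hb _ (by lia))
  have h4 := Subring.sub_mem _ h3 h1
  simpa using h4

theorem IsGenerator.norm_top (h2 : 2 < p) (hΦ : IsAssociator 1 Φ) (hb : HasSimplePoleBound p Φ)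
    (h : IsGenerator Φ ψ) {w : List (Fin 2)} (hw : w.length = p - 1) :
    ‖(p : ℚ_[p]) * ψ w‖ ≤ 1 ∧ residue p (p * ψ w) = -topResidue Φ w := by
  have h1 := norm_wordCoeff_le w (h.homPart_top h2 hΦ hb)
  rw [← hw, map_sub, map_smul, wordCoeff_homPart, wordCoeff_homPart, smul_eq_mul] at h1
  obtain ⟨r, hr⟩ : ∃ r : ℤ_[p], (r : ℚ_[p]) = ψ w - (p - 1) * Φ w := ⟨⟨_, h1⟩, rfl⟩
  have h3 : (p : ℚ_[p]) * ψ w = (((p - 1) * integralLift ((p : ℚ_[p]) * Φ w) + p * r : ℤ_[p]) : ℚ_[p]) := by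
    push_cast
    rw [coe_integralLift (hb.pole w hw), hr]
    ring
  rw [h3]
  refine ⟨PadicInt.norm_le_one _, ?_⟩
  rw [residue_coe]
  simp [topResidue, toZMod_integralLift]

theorem IsGenerator.sigma_eq (h2 : 2 < p) (hΦ : IsAssociator 1 Φ) (hb : HasSimplePoleBound p Φ)
    (h : IsGenerator Φ ψ) : sigma p ψ =
      -leading Φ (FreeAlgebra.ι (ZMod p) (0 : Fin 2)) (FreeAlgebra.ι (ZMod p) 1) := by
  rw [leading, ← homPart_neg_coeff, ← homPart_congr (f := fun w => residue p (p * ψ w))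
    (f' := -topResidue Φ) (fun w hw => (h.norm_top h2 hΦ hb hw).2)]
  simp only [homPart, vec_ι]
  rfl

theorem IsGenerator.subst_sigma (h2 : 2 < p) (hΦ : IsAssociator 1 Φ) (hb : HasSimplePoleBound p Φ)
    (h : IsGenerator Φ ψ) (u v : FreeAlgebra (ZMod p) (Fin 2)) :
    subst (sigma p ψ) u v = -leading Φ u v := by
  rw [h.sigma_eq h2 hΦ hb, subst, map_neg, map_leading]
  simp

theorem tr_divPart (h2 : 2 < p) (hΦ : IsAssociator 1 Φ) (hb : HasSimplePoleBound p Φ) :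
    tr (-divPart Φ) = (1 / 2 : ZMod p) •
      tr ((FreeAlgebra.ι (ZMod p) (0 : Fin 2) + FreeAlgebra.ι (ZMod p) 1) ^ (p - 1) -
        FreeAlgebra.ι (ZMod p) 0 ^ (p - 1) - FreeAlgebra.ι (ZMod p) 1 ^ (p - 1)) := by
  have h := divPart_mem_commutatorSpan h2 hΦ hb
  -- This is where β = 1/2 enters.
  rw [eq_one_div_of_mul_eq_one_right (two_mul_leading h2 hΦ hb)] at h
  rw [← map_smul, tr, Submodule.mkQ_apply, Submodule.mkQ_apply, Submodule.Quotient.eq]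
  refine (Submodule.neg_mem_iff _).1 ?_
  rwa [neg_sub', neg_neg, sub_neg_eq_add]

end Generator

end KashiwaraVergne

end

theorem proposition3p7 (p : ℕ) [Fact p.Prime] (hp : 2 < p)
    (Φ ψ : KashiwaraVergne.NCSeries ℚ_[p])
    (hΦ : KashiwaraVergne.IsAssociator (1 : ℚ_[p]) Φ)
    (hbound : KashiwaraVergne.HasSimplePoleBound p Φ)
    (hψ : KashiwaraVergne.IsGenerator Φ ψ) :
    -- the part of degree `p - 1` of `p ψ` is integral, so that its reduction modulo `p` makes sense
    (∀ w : List (Fin 2), w.length = p - 1 → ‖(p : ℚ_[p]) * ψ w‖ ≤ 1) ∧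
    ∀ x y a b : FreeAlgebra (ZMod p) (Fin 2),
      x = FreeAlgebra.ι (ZMod p) 0 → y = FreeAlgebra.ι (ZMod p) 1 →
      a = KashiwaraVergne.subst (KashiwaraVergne.sigma p ψ) (-x - y) x →
      b = KashiwaraVergne.subst (KashiwaraVergne.sigma p ψ) (-x - y) y →
      KashiwaraVergne.tr (x * KashiwaraVergne.pd 0 a + y * KashiwaraVergne.pd 1 b) =
        (1 / 2 : ZMod p) •
          KashiwaraVergne.tr ((x + y) ^ (p - 1) - x ^ (p - 1) - y ^ (p - 1)) := by
  refine ⟨fun w hw => (hψ.norm_top hp hΦ hbound hw).1, ?_⟩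
  rintro x y a b rfl rfl rfl rfl
  -- As σ_p = -φ, the elements `a` and `b` are the negatives of A and B, and the expression under
  -- the trace is `-divPart Φ`.
  rw [← KashiwaraVergne.tr_divPart hp hΦ hbound, hψ.subst_sigma hp hΦ hbound,
    hψ.subst_sigma hp hΦ hbound, KashiwaraVergne.pd_neg, KashiwaraVergne.pd_neg, mul_neg, mul_neg,
    ← neg_add]
  rfl
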